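/- Let $\omega\subset\mathbb{R}^2$ be a bounded, simply connected domain (open set) with Lipschitz boundary, let $a<b$ be real numbers, and put $\Omega:=\omega\times(a,b)\subset\mathbb{R}^3$, with points written $x=(x',x_3)$, $x'=(x_1,x_2)$. Let $\mathrm{A}(\Omega)=-X_1^2-X_2^2$, where $$X_1=\partial_{x_1}+\tfrac{x_2}{2}\,\partial_{x_3},\qquad X_2=\partial_{x_2}-\tfrac{x_1}{2}\,\partial_{x_3},$$ be the Heisenberg Laplacian on $\Omega$ with Dirichlet boundary condition, that is, the nonnegative self-adjoint operator in $L^2(\Omega)$ associated with the closure of the quadratic form $\mathrm{a}[u]=\int_\Omega |X_1u|^2+|X_2u|^2\,\mathrm{d}x$, initially defined on $C_0^\infty(\Omega)$. For $x'\in\omega$ let $\delta(x'):=\operatorname{dist}(x',\partial\omega)$, for $\beta>0$ let $\omega^\beta:=\{x'\in\omega \mid \delta(x')<\beta\}$, and let $c=c(\omega)>0$ be the Hardy constant of $\omega$, given by $$c^{-2}:=\inf_{0\neq v\in C_0^\infty(\omega)}\frac{\int_\omega|\nabla v(x')|^2\,\mathrm{d}x'}{\int_\omega |v(x')/\delta(x')|^2\,\mathrm{d}x'}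 .$$ Then for every $u\in\mathrm{Dom}(\mathrm{A}(\Omega))$ and every $\beta>0$ one has $u\in\mathrm{Dom}(\mathrm{A}(\Omega)^{1/c})$, where $\mathrm{A}(\Omega)^{1/c}$ is the power defined by the spectral theorem, and $$\int_a^b\int_{\omega^\beta}|u(x',x_3)|^2\,\mathrm{d}x'\,\mathrm{d}x_3\;\le\; c^{2+\frac2c}\,\beta^{2+\frac2c}\,\big\|\mathrm{A}(\Omega)u\big\|_{L^2(\Omega)}\,\big\|\mathrm{A}(\Omega)^{1/c}u\big\|_{L^2(\Omega)} .$$ -/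

import Mathlib

open MeasureTheory Set

open scoped NNReal

noncomputable section

/-! ### Geometry of the cross-section -/

/-- The Euclidean plane, the space of the variable `x' = (x₁, x₂)`. -/
abbrev Plane : Type := EuclideanSpace ℝ (Fin 2)

/-- The space `ℝ³`, with points written as `x = (x', x₃)`. Its measure is the product of the
Lebesgue measures, that is, Lebesgue measure on `ℝ³`. (Only the topology, the smooth structure and
the measure of this space are used below, never the norm of the product.) -/
abbrev Space : Type := Plane × ℝ

/-- `ω` has Lipschitz boundary: near each boundary point `p`, in suitable orthonormal coordinates,
`ω` is the set of points strictly above the graph of a Lipschitz function. -/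
def HasLipschitzBoundary (ω : Set Plane) : Prop :=
  ∀ p ∈ frontier ω, ∃ (e : Plane ≃ₗᵢ[ℝ] Plane) (K : ℝ≥0) (g : ℝ → ℝ) (r : ℝ),
    0 < r ∧ LipschitzWith K g ∧ ∀ x ∈ Metric.ball p r, x ∈ ω ↔ g (e x 0) < e x 1

/-- The distance `δ(x')` from `x'` to the boundary of `ω`. -/
def bdryDist (ω : Set Plane) (x : Plane) : ℝ := Metric.infDist x (frontier ω)

/-- The boundary strip `ω^β = {x' ∈ ω | δ(x') < β}`. -/
def bdryStrip (ω : Set Plane) (β : ℝ) : Set Plane := {x | x ∈ ω ∧ bdryDist ω x < β}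

/-! ### Test functions and the Hardy constant -/

/-- `φ ∈ C₀^∞(U)`: a smooth complex valued function with compact support contained in `U`. -/
structure IsTestFunction {E : Type*} [NormedAddCommGroup E] [NormedSpace ℝ E]
    (U : Set E) (φ : E → ℂ) : Prop where
  contDiff : ContDiff ℝ ((⊤ : ℕ∞) : WithTop ℕ∞) φ
  hasCompactSupport : HasCompactSupport φ
  tsupport_subset : tsupport φ ⊆ U

/-- The partial derivative `∂φ/∂xᵢ` of a function on the plane. -/
def planePartial (i : Fin 2) (φ : Plane → ℂ) (x : Plane) : ℂ :=
  fderiv ℝ φ x (EuclideanSpace.single i 1)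

/-- The quotient `∫_ω |∇φ|² / ∫_ω |φ/δ|²`. -/
def hardyQuotient (ω : Set Plane) (φ : Plane → ℂ) : ℝ :=
  (∫ x in ω, (‖planePartial 0 φ x‖ ^ 2 + ‖planePartial 1 φ x‖ ^ 2)) /
    ∫ x in ω, (‖φ x‖ / bdryDist ω x) ^ 2

/-- The Hardy constant `c = c(ω)`, given by `c⁻² = inf_φ ∫_ω |∇φ|² / ∫_ω |φ/δ|²`, the infimum over
all nonzero `φ ∈ C₀^∞(ω)`. -/
def hardyConst (ω : Set Plane) : ℝ :=
  (sInf {q : ℝ | ∃ φ : Plane → ℂ, IsTestFunction ω φ ∧ φ ≠ 0 ∧ q = hardyQuotient ω φ}) ^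
    (-(1 / 2) : ℝ)

/-! ### The Heisenberg Laplacian -/

/-- `X₁ = ∂_{x₁} + (x₂/2) ∂_{x₃}`. -/
def heisX1 (φ : Space → ℂ) (x : Space) : ℂ :=
  fderiv ℝ φ x (EuclideanSpace.single 0 1, x.1 1 / 2)

/-- `X₂ = ∂_{x₂} - (x₁/2) ∂_{x₃}`. -/
def heisX2 (φ : Space → ℂ) (x : Space) : ℂ :=
  fderiv ℝ φ x (EuclideanSpace.single 1 1, -(x.1 0 / 2))

/-- The complex Hilbert space `L²(Ω)`. -/
abbrev L2 (Ω : Set Space) : Type := Lp ℂ 2 ((volume : Measure Space).restrict Ω)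

theorem IsTestFunction.add {E : Type*} [NormedAddCommGroup E] [NormedSpace ℝ E] {U : Set E}
    {φ ψ : E → ℂ} (hφ : IsTestFunction U φ) (hψ : IsTestFunction U ψ) :
    IsTestFunction U (φ + ψ) where
  contDiff := hφ.contDiff.add hψ.contDiff
  hasCompactSupport := hφ.hasCompactSupport.add hψ.hasCompactSupport
  tsupport_subset :=
    (tsupport_add φ ψ).trans (union_subset hφ.tsupport_subset hψ.tsupport_subset)

theorem IsTestFunction.smul {E : Type*} [NormedAddCommGroup E] [NormedSpace ℝ E] {U : Set E}
    {φ : E → ℂ} (c : ℂ) (hφ : IsTestFunction U φ) : IsTestFunction U (c • φ) where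
  contDiff := contDiff_const.smul hφ.contDiff
  hasCompactSupport := hφ.hasCompactSupport.smul_left (f := fun _ => c)
  tsupport_subset := (tsupport_smul_subset_right (fun _ => c) φ).trans hφ.tsupport_subset

theorem IsTestFunction.zero {E : Type*} [NormedAddCommGroup E] [NormedSpace ℝ E] {U : Set E} :
    IsTestFunction U (0 : E → ℂ) where
  contDiff := contDiff_const
  hasCompactSupport := HasCompactSupport.zero
  tsupport_subset := by simp [tsupport]

theorem IsTestFunction.fderiv_add {E : Type*} [NormedAddCommGroup E] [NormedSpace ℝ E] {U : Set E}
    {φ ψ : E → ℂ} (hφ : IsTestFunction U φ) (hψ : IsTestFunction U ψ) (x v : E) :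
    fderiv ℝ (φ + ψ) x v = fderiv ℝ φ x v + fderiv ℝ ψ x v := by
  rw [_root_.fderiv_add (hφ.contDiff.differentiable (by simp) x)
    (hψ.contDiff.differentiable (by simp) x)]
  rfl

theorem IsTestFunction.fderiv_smul {E : Type*} [NormedAddCommGroup E] [NormedSpace ℝ E] {U : Set E}
    {φ : E → ℂ} (c : ℂ) (hφ : IsTestFunction U φ) (x v : E) :
    fderiv ℝ (c • φ) x v = c • fderiv ℝ φ x v := by
  rw [fderiv_const_smul (hφ.contDiff.differentiable (by simp) x)]
  rfl

/-- The triples `(φ, X₁φ, X₂φ)` with `φ ∈ C₀^∞(Ω)`, as elements of `L²(Ω)³`: the graph of the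
Heisenberg gradient on test functions. -/
def testGraph (Ω : Set Space) : Submodule ℂ (L2 Ω × L2 Ω × L2 Ω) where
  carrier := {p | ∃ φ : Space → ℂ, IsTestFunction Ω φ ∧
    p.1 =ᵐ[volume.restrict Ω] φ ∧
    p.2.1 =ᵐ[volume.restrict Ω] heisX1 φ ∧
    p.2.2 =ᵐ[volume.restrict Ω] heisX2 φ}
  zero_mem' := by
    refine ⟨0, IsTestFunction.zero, Lp.coeFn_zero _ _ _, ?_, ?_⟩
    · filter_upwards [Lp.coeFn_zero ℂ 2 ((volume : Measure Space).restrict Ω)] with x hx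
      simpa [heisX1] using hx
    · filter_upwards [Lp.coeFn_zero ℂ 2 ((volume : Measure Space).restrict Ω)] with x hx
      simpa [heisX2] using hx
  add_mem' := by
    rintro p q ⟨φ, hφ, h0, h1, h2⟩ ⟨ψ, hψ, k0, k1, k2⟩
    refine ⟨φ + ψ, hφ.add hψ, (Lp.coeFn_add _ _).trans (h0.add k0),
      (Lp.coeFn_add _ _).trans ((h1.add k1).trans (.of_eq ?_)),
      (Lp.coeFn_add _ _).trans ((h2.add k2).trans (.of_eq ?_))⟩
    · funext x
      exact (hφ.fderiv_add hψ x _).symm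
    · funext x
      exact (hφ.fderiv_add hψ x _).symm
  smul_mem' := by
    rintro c p ⟨φ, hφ, h0, h1, h2⟩
    refine ⟨c • φ, hφ.smul c, (Lp.coeFn_smul _ _).trans (h0.const_smul c),
      (Lp.coeFn_smul _ _).trans ((h1.const_smul c).trans (.of_eq ?_)),
      (Lp.coeFn_smul _ _).trans ((h2.const_smul c).trans (.of_eq ?_))⟩
    · funext x
      exact (hφ.fderiv_smul c x _).symm
    · funext x
      exact (hφ.fderiv_smul c x _).symm

/-- The closure of the quadratic form `a[u] = ∫_Ω |X₁u|² + |X₂u|²`, initially defined on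
`C₀^∞(Ω)`, recorded by the triples `(u, X₁u, X₂u)` with `u` in the form domain: such a triple is a
limit in `L²(Ω)³` of triples `(φₙ, X₁φₙ, X₂φₙ)`, that is, `φₙ → u` in `L²(Ω)` and `(φₙ)` is Cauchy
for the form, and then `a[u] = ‖X₁u‖² + ‖X₂u‖²`. -/
def formGraph (Ω : Set Space) : Submodule ℂ (L2 Ω × L2 Ω × L2 Ω) :=
  (testGraph Ω).topologicalClosure

/-- The graph of the operator associated with the closed form `a`: the pairs `(u, f)` such that `u`
lies in the form domain and `a[v, u] = ⟨v, f⟩` for all `v` in the form domain. -/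
def heisenbergGraph (Ω : Set Space) : Submodule ℂ (L2 Ω × L2 Ω) where
  carrier := {p | ∃ g₁ g₂ : L2 Ω, (p.1, g₁, g₂) ∈ formGraph Ω ∧
    ∀ v h₁ h₂ : L2 Ω, (v, h₁, h₂) ∈ formGraph Ω →
      inner ℂ h₁ g₁ + inner ℂ h₂ g₂ = inner ℂ v p.2}
  zero_mem' := ⟨0, 0, (formGraph Ω).zero_mem, fun v h₁ h₂ _ => by simp⟩
  add_mem' := by
    rintro p q ⟨g₁, g₂, hg, H⟩ ⟨k₁, k₂, hk, K⟩
    refine ⟨g₁ + k₁, g₂ + k₂, (formGraph Ω).add_mem hg hk, fun v h₁ h₂ hv => ?_⟩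
    have e1 := H v h₁ h₂ hv
    have e2 := K v h₁ h₂ hv
    simp only [inner_add_right, Prod.snd_add, ← e1, ← e2]
    ring
  smul_mem' := by
    rintro c p ⟨g₁, g₂, hg, H⟩
    refine ⟨c • g₁, c • g₂, (formGraph Ω).smul_mem c hg, fun v h₁ h₂ hv => ?_⟩
    have e1 := H v h₁ h₂ hv
    simp only [inner_smul_right, Prod.smul_snd, ← e1]
    ring

/-- The Heisenberg Laplacian `A(Ω) = -X₁² - X₂²` with Dirichlet boundary condition, an unbounded
operator in `L²(Ω)` whose domain `Dom(A(Ω))` is the domain of this partially defined map. -/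
def heisenbergLaplacian (Ω : Set Space) : L2 Ω →ₗ.[ℂ] L2 Ω :=
  (heisenbergGraph Ω).toLinearPMap

/-! ### Real powers of nonnegative self-adjoint operators -/

open Classical in
/-- The bounded operator `(1 + T)⁻¹`, for an operator `T` such that `1 + T` has a bounded everywhere
defined inverse (as every nonnegative self-adjoint operator `T` does). -/
def resolventAtOne {H : Type*} [NormedAddCommGroup H] [InnerProductSpace ℂ H]
    (T : H →ₗ.[ℂ] H) : H →L[ℂ] H :=
  if h : ∃ R : H →L[ℂ] H, ∀ f : H, (R f, f - R f) ∈ T.graph then h.choose else 0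

/-- The power `T ^ s`, for `s ≥ 0`, of a nonnegative self-adjoint, possibly unbounded, operator `T`,
as given by the spectral theorem. With `R = (1 + T)⁻¹` one has `0 ≤ R ≤ 1`, `R` is injective and
`T = (1 - R) R⁻¹`, so that `T ^ s = (1 - R) ^ s (R ^ s)⁻¹` with domain the range of `R ^ s`: the
graph of `T ^ s` consists of the pairs `(R ^ s w, (1 - R) ^ s w)`. The powers of the bounded
nonnegative operators `R` and `1 - R` are those of the continuous functional calculus. -/
def nonnegPower {H : Type*} [NormedAddCommGroup H] [InnerProductSpace ℂ H] [CompleteSpace H]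
    (T : H →ₗ.[ℂ] H) (s : ℝ) : H →ₗ.[ℂ] H :=
  (LinearMap.range
    (((resolventAtOne T ^ s : H →L[ℂ] H) : H →ₗ[ℂ] H).prod
      (((1 - resolventAtOne T) ^ s : H →L[ℂ] H) : H →ₗ[ℂ] H))).toLinearPMap

end

/-!
The argument combines two consequences of Hardy's inequality with an argument of Davies.

Let `δ` be the distance to `∂ω`, and `λ = c⁻²`. Hardy's inequality on `ω` passes to the Heisenberg
gradient on `Ω`: for a test function `φ` on `Ω` the function `ρ(x') = (∫ |φ(x', x₃)|² dx₃)^{1/2}`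
satisfies `|∇ρ|² ≤ ∫ |X₁φ|² + |X₂φ|² dx₃`, because `Re ∫ conj φ ∂₃φ dx₃ = 0` lets one replace
`∂₁`, `∂₂` by `X₁`, `X₂`. Hence `λ ∫ |u|² / δ² ≤ a[u]` on the form domain
(`hardyInf_mul_norm_sq_le`), that is, `λ δ⁻² ≤ A(Ω)`.

For bounded Lipschitz `ω` one has `0 < λ ≤ 1/4`. Positivity is Hardy's inequality with some constant,
obtained from the one-dimensional one in boundary charts (`hardyInf_pos`); the upper bound comes
from testing with `δ ^ s`, `s ↓ 1/2` (`hardyInf_le`). So `α = 1 / c = √λ` lies in `(0, 1/2]`, and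
`2 α ≤ 1` makes the map `x ↦ x ^ (2 α)` operator monotone. Raising the operator inequality to this
power (Heinz) gives `‖δ ^ (-2 α) u‖ ≤ c ^ (2 α) ‖A(Ω) ^ α u‖` and `Dom A(Ω) ⊆ Dom A(Ω) ^ α`
(`exists_mem_domain_norm_distWeight_le`). In terms of `R = (1 + A(Ω))⁻¹` this is the operator
monotonicity applied to `R (k (1 - R) + ε R)⁻¹`, followed by `ε → 0`
(`norm_rpow_neg_mul_rpow_le`).

Finally let `σ = max(δ, β) ^ (-α)`. The localization formula
`a[σu] = Re ⟨σ² u, A(Ω) u⟩ + ‖(∇σ) u‖²` and Hardy's inequality for `σu` give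
`∫ (λ σ² / δ² - |∇σ|²) |u|² ≤ ‖A(Ω) u‖ ‖σ² u‖`. As `α² = λ`, the bracket vanishes where `δ > β`, and
where `δ < β` it is at least `λ β ^ (-2 α - 2)`; moreover `σ² ≤ δ ^ (-2 α)`. This is the
claim. All powers of `δ` are replaced by powers of `max(δ, β')`, so that only bounded continuous
weights occur, and `σ` by smooth functions of a smooth approximation of `δ`
(`integral_strip_le_of_approx`).
-/

noncomputable section

/-! ### The Heinz inequality for fractional powers -/

section Heinz

variable {H : Type*} [NormedAddCommGroup H] [InnerProductSpace ℂ H] [CompleteSpace H]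

theorem spectrum_subset_Icc_of_nonneg_of_le_one {R : H →L[ℂ] H} (h0 : 0 ≤ R) (h1 : R ≤ 1)
    {x : ℝ} (hx : x ∈ spectrum ℝ R) : 0 ≤ x ∧ x ≤ 1 := by
  refine ⟨spectrum_nonneg_of_nonneg h0 hx, ?_⟩
  have h1' : R ≤ algebraMap ℝ (H →L[ℂ] H) 1 := by simpa using h1
  exact (le_algebraMap_iff_spectrum_le (IsSelfAdjoint.of_nonneg h0)).1 h1' x hx

theorem inner_selfAdjoint_apply_self {B : H →L[ℂ] H} (hB : IsSelfAdjoint B) (w : H) :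
    inner ℂ w ((B * B) w) = ((‖B w‖ ^ 2 : ℝ) : ℂ) := by
  have : inner ℂ w ((B * B) w) = inner ℂ (B w) (B w) := by
    rw [mul_apply_eq_comp]
    exact (ContinuousLinearMap.isSelfAdjoint_iff_isSymmetric.1 hB w (B w)).symm
  rw [this, inner_self_eq_norm_sq_to_K]
  push_cast
  rfl

theorem rpow_mul_rpow_of_nonneg {A : H →L[ℂ] H} (hA : 0 ≤ A) {s t : ℝ} (hs : 0 ≤ s) (ht : 0 ≤ t) :
    A ^ s * A ^ t = A ^ (s + t) := by
  rw [CFC.rpow_eq_cfc_real hA, CFC.rpow_eq_cfc_real hA, CFC.rpow_eq_cfc_real hA,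
    ← cfc_mul (fun x : ℝ => x ^ s) (fun x : ℝ => x ^ t) A
      (Real.continuous_rpow_const hs).continuousOn (Real.continuous_rpow_const ht).continuousOn]
  refine cfc_congr fun x hx => ?_
  exact (Real.rpow_add_of_nonneg (spectrum_nonneg_of_nonneg hA hx) hs ht).symm

/-- Injectivity passes to positive powers with exponent at most one. -/
theorem injective_rpow_of_injective {R : H →L[ℂ] H} (h0 : 0 ≤ R)
    (hinj : Function.Injective R) {s : ℝ} (hs : 0 ≤ s) (hs1 : s ≤ 1) :
    Function.Injective (R ^ s : H →L[ℂ] H) := by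
  have h : R ^ (1 - s) * R ^ s = R := by
    rw [rpow_mul_rpow_of_nonneg h0 (by linarith) hs]
    simpa using CFC.rpow_one R
  intro x y hxy
  apply hinj
  rw [← h, mul_apply_eq_comp, mul_apply_eq_comp, hxy]

theorem denseRange_of_selfAdjoint_of_injective {B : H →L[ℂ] H} (hB : IsSelfAdjoint B)
    (hinj : Function.Injective B) : DenseRange B := by
  have : (B.range : Submodule ℂ H).topologicalClosure = ⊤ := by
    rw [Submodule.topologicalClosure_eq_top_iff, ContinuousLinearMap.orthogonal_range,
      hB.adjoint_eq]
    exact LinearMap.ker_eq_bot.2 hinj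
  rw [DenseRange, dense_iff_closure_eq]
  exact congrArg (fun S : Submodule ℂ H => (S : Set H)) this

theorem one_sub_rpow_eq_cfc {R : H →L[ℂ] H} (h0 : 0 ≤ R) (h1 : R ≤ 1) {α : ℝ} (hα : 0 ≤ α) :
    (1 - R) ^ α = cfc (fun x : ℝ => (1 - x) ^ α) R := by
  have hsa := IsSelfAdjoint.of_nonneg h0
  have e : (1 - R : H →L[ℂ] H) = cfc (fun x : ℝ => 1 - x) R := by
    rw [cfc_sub (fun _ => (1 : ℝ)) (fun x => x) R, cfc_const_one ℝ R, cfc_id' ℝ R]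
  rw [CFC.rpow_eq_cfc_real (by simpa using h1), e, ← cfc_comp' (fun x : ℝ => x ^ α) _ R
    (Real.continuous_rpow_const hα).continuousOn]

set_option maxHeartbeats 1000000 in
/-- The inequality for `k (1 - R) + ε R`, whose inverse relative to `R` is bounded, in place of
`k (1 - R)`. Operator monotonicity of `x ↦ x ^ (2 α)` is applied to
`R (k (1 - R) + ε R)⁻¹ ≤ E`. -/
theorem norm_rpow_neg_mul_rpow_le_of_pos {R E : H →L[ℂ] H} (h0 : 0 ≤ R) (h1 : R ≤ 1)
    (hinj : Function.Injective R) (hE : IsStrictlyPositive E) {k : ℝ} (hk : 0 < k)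
    (h : ∀ f : H, ‖(E ^ (-(1 / 2) : ℝ)) (R f)‖ ^ 2 ≤ k * (inner ℂ (R f) (f - R f)).re)
    {α : ℝ} (hα0 : 0 < α) (hα : α ≤ 1 / 2) {ε : ℝ} (hε : 0 < ε) (w : H) :
    ‖(E ^ (-α)) ((R ^ α) w)‖ ≤ ‖cfc (fun x : ℝ => (k * (1 - x) + ε * x) ^ α) R w‖ := by
  have hsa := IsSelfAdjoint.of_nonneg h0
  have hsp : ∀ x ∈ spectrum ℝ R, 0 ≤ x ∧ x ≤ 1 := fun x hx =>
    spectrum_subset_Icc_of_nonneg_of_le_one h0 h1 hx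
  have hp : ∀ x ∈ spectrum ℝ R, 0 < k * (1 - x) + ε * x := by
    intro x hx
    obtain ⟨a, b⟩ := hsp x hx
    rcases a.eq_or_lt with rfl | a
    · simpa using hk
    · have : 0 < ε * x := by positivity
      nlinarith [mul_nonneg hk.le (sub_nonneg.2 b)]
  have hpc : Continuous fun x : ℝ => k * (1 - x) + ε * x := by fun_prop
  have hEα : ∀ s : ℝ, IsSelfAdjoint (E ^ s : H →L[ℂ] H) := fun s =>
    IsSelfAdjoint.of_nonneg CFC.rpow_nonneg
  -- `n s` is the power `P ^ s` of `P = k (1 - R) + ε R`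
  have hcp : ∀ s : ℝ, ContinuousOn (fun x : ℝ => (k * (1 - x) + ε * x) ^ s) (spectrum ℝ R) :=
    fun s x hx => (hpc.continuousAt.rpow_const (Or.inl (hp x hx).ne')).continuousWithinAt
  have hcr : ∀ s : ℝ, 0 ≤ s → ContinuousOn (fun x : ℝ => x ^ s) (spectrum ℝ R) :=
    fun s hs => (Real.continuous_rpow_const hs).continuousOn
  set n : ℝ → (H →L[ℂ] H) := fun s => cfc (fun x : ℝ => (k * (1 - x) + ε * x) ^ s) R with hn
  have hnsa : ∀ s, IsSelfAdjoint (n s) := fun s => cfc_predicate _ _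
  have hr : ∀ s : ℝ, R ^ s = cfc (fun x : ℝ => x ^ s) R := fun s => CFC.rpow_eq_cfc_real h0
  have hrsa : ∀ s : ℝ, IsSelfAdjoint (R ^ s : H →L[ℂ] H) := fun s =>
    IsSelfAdjoint.of_nonneg CFC.rpow_nonneg
  have hnn : ∀ s t, n s * n t = n (s + t) := by
    intro s t
    rw [hn]
    simp only
    rw [← cfc_mul _ _ R (hcp s) (hcp t)]
    exact cfc_congr fun x hx => (Real.rpow_add (hp x hx) s t).symm
  have hn0 : n 0 = 1 := by
    rw [hn]
    simp only [Real.rpow_zero]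
    exact cfc_const_one ℝ R
  have hn1 : n 1 = k • (1 - R) + ε • R := by
    rw [hn]
    simp only [Real.rpow_one]
    rw [cfc_add R (fun x : ℝ => k * (1 - x)) (fun x => ε * x),
      cfc_const_mul k (fun x : ℝ => 1 - x) R,
      cfc_const_mul ε (fun x : ℝ => x) R, cfc_sub (fun _ => (1 : ℝ)) (fun x => x) R,
      cfc_const_one ℝ R, cfc_id' ℝ R]
  have hrr : (R ^ (1 / 2 : ℝ)) * (R ^ (1 / 2 : ℝ)) = R := by
    rw [rpow_mul_rpow_of_nonneg h0 (by norm_num) (by norm_num)]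
    simpa [add_halves] using (show R ^ ((1 / 2 : ℝ) + 1 / 2) = R by
      rw [add_halves]; exact CFC.rpow_one R)
  have hnrc : Commute (R ^ (1 / 2 : ℝ)) (n (-(1 / 2))) := by
    rw [hr]
    exact cfc_commute_cfc _ _ _
  -- the case `α = 1 / 2`, with the factor `R ^ (1 / 2)` removed by density
  have key1 : ∀ g : H, ‖(E ^ (-(1 / 2) : ℝ)) ((R ^ (1 / 2 : ℝ)) g)‖ ^ 2 ≤
      k * (inner ℂ g (g - R g)).re := by
    have hd : DenseRange (R ^ (1 / 2 : ℝ) : H →L[ℂ] H) :=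
      denseRange_of_selfAdjoint_of_injective (hrsa _)
        (injective_rpow_of_injective h0 hinj (by norm_num) (by norm_num))
    intro g
    refine hd.induction_on (p := fun g => ‖(E ^ (-(1 / 2) : ℝ)) ((R ^ (1 / 2 : ℝ)) g)‖ ^ 2 ≤
      k * (inner ℂ g (g - R g)).re) g ?_ ?_
    · apply isClosed_le
      · fun_prop
      · exact continuous_const.mul (Complex.continuous_re.comp
          (continuous_id.inner (continuous_id.sub R.continuous)))
    · intro f
      have hf := h f
      have e1 : (R ^ (1 / 2 : ℝ)) ((R ^ (1 / 2 : ℝ)) f) = R f := by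
        rw [← mul_apply_eq_comp, hrr]
      have e2 : inner ℂ ((R ^ (1 / 2 : ℝ)) f) ((R ^ (1 / 2 : ℝ)) f - R ((R ^ (1 / 2 : ℝ)) f)) =
          inner ℂ (R f) (f - R f) := by
        have e3 : (R ^ (1 / 2 : ℝ)) f - R ((R ^ (1 / 2 : ℝ)) f) =
            (R ^ (1 / 2 : ℝ)) (f - R f) := by
          rw [map_sub, ← e1]
          congr 1
          exact (DFunLike.congr_fun hrr _).symm
        rw [e3]
        rw [← e1]
        exact (ContinuousLinearMap.isSelfAdjoint_iff_isSymmetric.1 (hrsa (1 / 2)) _ _).symm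
      rw [e1, e2]
      exact hf
  have key2 : ∀ g : H, ‖(E ^ (-(1 / 2) : ℝ)) ((R ^ (1 / 2 : ℝ)) g)‖ ≤ ‖n (1 / 2) g‖ := by
    intro g
    have e : inner ℂ g ((n (1 / 2) * n (1 / 2)) g) = _ :=
      inner_selfAdjoint_apply_self (hnsa _) g
    rw [hnn, add_halves, hn1] at e
    have hRg : 0 ≤ (inner ℂ g (R g)).re :=
      ((ContinuousLinearMap.nonneg_iff_isPositive R).1 h0).re_inner_nonneg_right g
    have e' := congrArg Complex.re e
    rw [Complex.ofReal_re] at e'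
    simp only [add_apply, smul_apply,
      sub_apply, one_apply_eq_self, inner_add_right,
      Complex.add_re, inner_smul_right_eq_smul, Complex.smul_re, smul_eq_mul] at e'
    refine le_of_sq_le_sq ?_ (norm_nonneg _)
    rw [← e']
    nlinarith [key1 g, mul_nonneg hε.le hRg]
  -- `Q = (R P⁻¹) ^ (1 / 2)`
  set Q : H →L[ℂ] H := R ^ (1 / 2 : ℝ) * n (-(1 / 2)) with hQ
  have hQsa : IsSelfAdjoint Q := (hrsa _).commute_iff (hnsa _) |>.1 hnrc
  have hQE : ‖Q * E ^ (-(1 / 2) : ℝ)‖ ≤ 1 := by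
    have : ‖E ^ (-(1 / 2) : ℝ) * Q‖ ≤ 1 := by
      refine ContinuousLinearMap.opNorm_le_bound _ zero_le_one fun x => ?_
      rw [mul_apply_eq_comp, hQ, mul_apply_eq_comp]
      refine (key2 _).trans ?_
      rw [← mul_apply_eq_comp, hnn]
      norm_num [hn0]
    rw [← norm_star, star_mul, hQsa.star_eq, (hEα _).star_eq]
    exact this
  have hcrp : ∀ s : ℝ, 0 ≤ s → ContinuousOn
      (fun x : ℝ => x ^ s * (k * (1 - x) + ε * x) ^ (-s)) (spectrum ℝ R) :=
    fun s hs => (hcr s hs).mul (hcp _)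
  have hQcfc : ∀ s : ℝ, 0 ≤ s → R ^ s * n (-s) =
      cfc (fun x : ℝ => x ^ s * (k * (1 - x) + ε * x) ^ (-s)) R := by
    intro s hs
    rw [hr, hn]
    simp only
    rw [← cfc_mul _ _ R (hcr s hs) (hcp _)]
  have hnnQ : ∀ s : ℝ, 0 ≤ s → 0 ≤ R ^ s * n (-s) := by
    intro s hs
    rw [hQcfc s hs]
    exact cfc_nonneg fun x hx => mul_nonneg (Real.rpow_nonneg (hsp x hx).1 _)
      (Real.rpow_nonneg (hp x hx).le _)
  have hmulQ : ∀ s : ℝ, 0 ≤ s →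
      (R ^ s * n (-s)) * (R ^ s * n (-s)) = R ^ (s + s) * n (-(s + s)) := by
    intro s hs
    rw [hQcfc s hs, hQcfc _ (by linarith), ← cfc_mul _ _ R (hcrp s hs) (hcrp s hs)]
    refine cfc_congr fun x hx => ?_
    rw [neg_add, Real.rpow_add (hp x hx), Real.rpow_add_of_nonneg (hsp x hx).1 hs hs]
    ring
  -- `‖Q E ^ (-1/2)‖ ≤ 1` says that `R P⁻¹ = Q² ≤ E`
  have hle : R * n (-1) ≤ E := by
    have hR1 : R * n (-1) = R ^ (1 : ℝ) * n (-1) := by rw [CFC.rpow_one R]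
    rw [hR1, le_iff_norm_sqrt_mul_rpow _ _ (hnnQ 1 zero_le_one) hE]
    rw [CFC.sqrt_unique (b := Q) _ (hnnQ _ (by norm_num))]
    · exact hQE
    · rw [hQ, hmulQ _ (by norm_num)]
      norm_num
  have hS0 : 0 ≤ R * n (-1) := by
    have := hnnQ 1 zero_le_one
    rwa [CFC.rpow_one R] at this
  have hpow : (R * n (-1)) ^ (2 * α) = R ^ (α + α) * n (-(α + α)) := by
    have hR1 : R * n (-1) = R ^ (1 : ℝ) * n (-1) := by rw [CFC.rpow_one R]
    rw [CFC.rpow_eq_cfc_real hS0, hR1, hQcfc 1 zero_le_one, hQcfc _ (by linarith),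
      ← cfc_comp' (fun x : ℝ => x ^ (2 * α)) _ R
      (Real.continuous_rpow_const (by linarith)).continuousOn (hcrp _ zero_le_one)]
    refine cfc_congr fun x hx => ?_
    rw [Real.mul_rpow (Real.rpow_nonneg (hsp x hx).1 _) (Real.rpow_nonneg (hp x hx).le _),
      ← Real.rpow_mul (hsp x hx).1, ← Real.rpow_mul (hp x hx).le]
    ring_nf
  have hmono : (R * n (-1)) ^ (2 * α) ≤ E ^ (2 * α) :=
    CFC.rpow_le_rpow ⟨by linarith, by linarith⟩ hle
  rw [hpow] at hmono
  rw [le_iff_norm_sqrt_mul_rpow _ _ (hnnQ _ (by linarith)) (hE.rpow _ _),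
    CFC.sqrt_unique (b := R ^ α * n (-α)) (hmulQ α hα0.le) (hnnQ _ hα0.le),
    CFC.rpow_rpow E _ _ (by linarith) hE,
    show 2 * α * -(1 / 2) = -α by ring] at hmono
  have hfin : ‖E ^ (-α) * (R ^ α * n (-α))‖ ≤ 1 := by
    rw [← norm_star, star_mul, (hEα _).star_eq, (IsSelfAdjoint.of_nonneg (hnnQ α hα0.le)).star_eq]
    exact hmono
  have e : R ^ α = (R ^ α * n (-α)) * n α := by
    rw [mul_assoc, hnn]
    simp [hn0]
  calc ‖(E ^ (-α)) ((R ^ α) w)‖ = ‖(E ^ (-α) * (R ^ α * n (-α))) (n α w)‖ := by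
        conv_lhs => rw [e]
        rfl
    _ ≤ 1 * ‖n α w‖ := ContinuousLinearMap.le_of_opNorm_le _ hfin _
    _ = _ := one_mul _

/-- **Heinz inequality**, with the nonnegative operator `T` given by `R = (1 + T)⁻¹`: if
`E⁻¹ ≤ k T` in the sense of forms, then `‖E ^ (-α) u‖ ≤ k ^ α ‖T ^ α u‖` for `0 < α ≤ 1/2`, where
`u = R ^ α w` and `T ^ α u = (1 - R) ^ α w`. -/
theorem norm_rpow_neg_mul_rpow_le {R E : H →L[ℂ] H} (h0 : 0 ≤ R) (h1 : R ≤ 1)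
    (hinj : Function.Injective R) (hE : IsStrictlyPositive E) {k : ℝ} (hk : 0 < k)
    (h : ∀ f : H, ‖(E ^ (-(1 / 2) : ℝ)) (R f)‖ ^ 2 ≤ k * (inner ℂ (R f) (f - R f)).re)
    {α : ℝ} (hα0 : 0 < α) (hα : α ≤ 1 / 2) (w : H) :
    ‖(E ^ (-α)) ((R ^ α) w)‖ ≤ k ^ α * ‖((1 - R) ^ α) w‖ := by
  have hsp : ∀ x ∈ spectrum ℝ R, 0 ≤ x ∧ x ≤ 1 := fun x hx =>
    spectrum_subset_Icc_of_nonneg_of_le_one h0 h1 hx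
  have hsa := IsSelfAdjoint.of_nonneg h0
  have hbound : ∀ ε > 0, ‖(E ^ (-α)) ((R ^ α) w)‖ ≤
      k ^ α * ‖((1 - R) ^ α) w‖ + ε ^ α * ‖w‖ := by
    intro ε hε
    refine (norm_rpow_neg_mul_rpow_le_of_pos h0 h1 hinj hE hk h hα0 hα hε w).trans ?_
    have hc1 : Continuous fun x : ℝ => (k * (1 - x) + ε * x) ^ α :=
      (by fun_prop : Continuous fun x : ℝ => k * (1 - x) + ε * x).rpow_const fun _ => Or.inr hα0.le
    have hc2 : Continuous fun x : ℝ => (1 - x) ^ α :=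
      (by fun_prop : Continuous fun x : ℝ => 1 - x).rpow_const fun _ => Or.inr hα0.le
    have hd : ‖cfc (fun x : ℝ => (k * (1 - x) + ε * x) ^ α) R - k ^ α • (1 - R) ^ α‖ ≤ ε ^ α := by
      have hc3 : Continuous fun x : ℝ => k ^ α • (1 - x) ^ α := hc2.const_smul (k ^ α)
      rw [one_sub_rpow_eq_cfc h0 h1 hα0.le, ← cfc_smul (k ^ α) _ R hc2.continuousOn,
        ← cfc_sub _ _ R hc1.continuousOn hc3.continuousOn]
      refine norm_cfc_le (Real.rpow_nonneg hε.le _) fun x hx => ?_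
      obtain ⟨hx0, hx1⟩ := hsp x hx
      have hkx : 0 ≤ k * (1 - x) := mul_nonneg hk.le (by linarith)
      have hεx : 0 ≤ ε * x := mul_nonneg hε.le hx0
      rw [smul_eq_mul, ← Real.mul_rpow hk.le (by linarith), Real.norm_eq_abs, abs_of_nonneg
        (sub_nonneg.2 (Real.rpow_le_rpow hkx (by linarith) hα0.le)), sub_le_iff_le_add]
      have h3 := Real.rpow_add_le_add_rpow hkx hεx hα0.le (by linarith)
      have h4 : (ε * x) ^ α ≤ ε ^ α := Real.rpow_le_rpow hεx (by nlinarith) hα0.le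
      linarith
    have e : cfc (fun x : ℝ => (k * (1 - x) + ε * x) ^ α) R w =
        (cfc (fun x : ℝ => (k * (1 - x) + ε * x) ^ α) R - k ^ α • (1 - R) ^ α) w +
          k ^ α • ((1 - R) ^ α) w := by simp
    rw [e]
    refine (norm_add_le _ _).trans ?_
    rw [norm_smul, Real.norm_of_nonneg (Real.rpow_nonneg hk.le _), add_comm]
    gcongr
    exact ContinuousLinearMap.le_of_opNorm_le _ hd _
  have hlim : Filter.Tendsto (fun ε : ℝ => k ^ α * ‖((1 - R) ^ α) w‖ + ε ^ α * ‖w‖)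
      (nhdsWithin 0 (Ioi 0)) (nhds (k ^ α * ‖((1 - R) ^ α) w‖ + 0 ^ α * ‖w‖)) := by
    refine Filter.Tendsto.mono_left ?_ nhdsWithin_le_nhds
    exact (((Real.continuous_rpow_const hα0.le).mul continuous_const).const_add _).tendsto 0
  rw [Real.zero_rpow hα0.ne', zero_mul, add_zero] at hlim
  exact ge_of_tendsto hlim (eventually_nhdsWithin_of_forall fun ε hε => hbound ε hε)

end Heinz

/-! ### Weighted bounds for powers of nonnegative operators -/

section WeightedPower

variable {H : Type*} [NormedAddCommGroup H] [InnerProductSpace ℂ H] [CompleteSpace H]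

/-! Here `A` is an algebra of functions on `ι`, with evaluations `ev i`, represented on `H` by `φ`,
and `p s` is the element of `A` given by the function `r ^ s`. -/

section Representation

variable {A : Type*} [CStarAlgebra A] {ι : Type*} {ev : ι → A →⋆ₐ[ℂ] ℂ}
  (hevc : ∀ i, Continuous (ev i)) (hev : ∀ a b : A, (∀ i, ev i a = ev i b) → a = b)
  (φ : A →⋆ₐ[ℂ] (H →L[ℂ] H)) {r : ι → ℝ} (hr : ∀ i, 0 < r i)
  {p : ℝ → A} (hp : ∀ s i, ev i (p s) = ((r i ^ s : ℝ) : ℂ))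

include hev hr hp

theorem mul_eq_of_eval_rpow (s t : ℝ) : p s * p t = p (s + t) := by
  refine hev _ _ fun i => ?_
  rw [map_mul, hp, hp, hp, Real.rpow_add (hr i), Complex.ofReal_mul]

omit hr in
theorem eq_one_of_eval_rpow : p 0 = 1 := by
  refine hev _ _ fun i => ?_
  rw [hp, map_one, Real.rpow_zero, Complex.ofReal_one]

omit hr in
theorem isSelfAdjoint_of_eval_rpow (s : ℝ) : IsSelfAdjoint (p s) := by
  refine hev _ _ fun i => ?_
  rw [map_star, hp]
  exact Complex.conj_ofReal _

theorem map_nonneg_of_eval_rpow (s : ℝ) : 0 ≤ φ (p s) := by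
  have : φ (p s) = star (φ (p (s / 2))) * φ (p (s / 2)) := by
    rw [← map_star, (isSelfAdjoint_of_eval_rpow hev hp _).star_eq, ← map_mul,
      mul_eq_of_eval_rpow hev hr hp, add_halves]
  rw [this]
  exact star_mul_self_nonneg _

theorem isUnit_of_eval_rpow (s : ℝ) : IsUnit (p s) :=
  ⟨⟨p s, p (-s), by rw [mul_eq_of_eval_rpow hev hr hp, add_neg_cancel,
      eq_one_of_eval_rpow hev hp],
    by rw [mul_eq_of_eval_rpow hev hr hp, neg_add_cancel, eq_one_of_eval_rpow hev hp]⟩, rfl⟩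

include hevc in
/-- In a representation of an algebra of functions, powers of operators are given by pointwise
powers. -/
theorem map_rpow_of_eval_rpow (hφ : Continuous φ) (s : ℝ) : φ (p 1) ^ s = φ (p s) := by
  have hsa := isSelfAdjoint_of_eval_rpow hev hp 1
  have hc : ContinuousOn (fun x : ℝ => x ^ s) (spectrum ℝ (p 1)) := fun x hx =>
    (Real.continuousAt_rpow_const _ _ (Or.inl fun h0 => by
      rw [h0] at hx
      exact spectrum.zero_notMem ℝ (isUnit_of_eval_rpow hev hr hp 1) hx)).continuousWithinAt
  have hcfc : cfc (fun x : ℝ => x ^ s) (p 1) = p s := by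
    refine hev _ _ fun i => ?_
    rw [StarAlgHom.map_cfc (ev i) (fun x : ℝ => x ^ s) (p 1) hc (hevc i) hsa (hsa.map _),
      hp, hp, Real.rpow_one]
    exact cfc_algebraMap (A := ℂ) (r i) (fun x : ℝ => x ^ s)
  rw [CFC.rpow_eq_cfc_real (map_nonneg_of_eval_rpow hev φ hr hp 1), ← hcfc]
  exact (StarAlgHom.map_cfc φ _ _ hc hφ hsa (hsa.map _)).symm

end Representation

section Operator

variable {T : H →ₗ.[ℂ] H}

omit [CompleteSpace H] in
theorem resolventAtOne_mem_graph (h : ∃ R : H →L[ℂ] H, ∀ f : H, (R f, f - R f) ∈ T.graph)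
    (f : H) : (resolventAtOne T f, f - resolventAtOne T f) ∈ T.graph := by
  rw [resolventAtOne, dif_pos h]
  exact h.choose_spec f

variable (hsymm : ∀ u v : T.domain, inner ℂ (T u) (v : H) = inner ℂ (u : H) (T v))
  (hnonneg : ∀ u : T.domain, 0 ≤ (inner ℂ (u : H) (T u)).re)
  (hres : ∃ R : H →L[ℂ] H, ∀ f : H, (R f, f - R f) ∈ T.graph)

include hres

omit [CompleteSpace H] in
theorem resolventAtOne_mem_domain (f : H) : resolventAtOne T f ∈ T.domain :=
  LinearPMap.mem_domain_of_mem_graph (resolventAtOne_mem_graph hres f)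

omit [CompleteSpace H] in
theorem apply_resolventAtOne (f : H) :
    T ⟨resolventAtOne T f, resolventAtOne_mem_domain hres f⟩ = f - resolventAtOne T f := by
  obtain ⟨y, hy, hy'⟩ := (LinearPMap.mem_graph_iff T).1 (resolventAtOne_mem_graph hres f)
  refine Eq.trans ?_ hy'
  congr 1
  exact Subtype.ext hy.symm

omit [CompleteSpace H] in
theorem injective_resolventAtOne : Function.Injective (resolventAtOne T) := by
  refine (injective_iff_map_eq_zero _).2 fun f hf => ?_
  have h := resolventAtOne_mem_graph hres f
  rw [hf, sub_zero] at h
  exact LinearPMap.graph_fst_eq_zero_snd T h rfl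

include hsymm in
omit [CompleteSpace H] in
theorem isSymmetric_resolventAtOne (f g : H) :
    inner ℂ (resolventAtOne T f) g = inner ℂ f (resolventAtOne T g) := by
  have h := hsymm ⟨_, resolventAtOne_mem_domain hres f⟩ ⟨_, resolventAtOne_mem_domain hres g⟩
  rw [apply_resolventAtOne hres, apply_resolventAtOne hres, inner_sub_left, inner_sub_right] at h
  exact (sub_left_injective h).symm

include hsymm hnonneg in
omit [CompleteSpace H] in
theorem resolventAtOne_nonneg : 0 ≤ resolventAtOne T := by
  rw [ContinuousLinearMap.nonneg_iff_isPositive]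
  refine ⟨fun f g => isSymmetric_resolventAtOne hsymm hres f g, fun f => ?_⟩
  have h := hnonneg ⟨_, resolventAtOne_mem_domain hres f⟩
  rw [apply_resolventAtOne hres, inner_sub_right, Complex.sub_re,
    ← RCLike.re_eq_complex_re, inner_self_eq_norm_sq] at h
  change 0 ≤ RCLike.re (inner ℂ (resolventAtOne T f) f)
  nlinarith [sq_nonneg ‖resolventAtOne T f‖]

include hsymm hnonneg in
theorem resolventAtOne_le_one : resolventAtOne T ≤ 1 := by
  rw [← sub_nonneg, ContinuousLinearMap.nonneg_iff_isPositive]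
  refine ⟨fun f g => ?_, fun f => ?_⟩
  · change inner ℂ (f - resolventAtOne T f) g = inner ℂ f (g - resolventAtOne T g)
    rw [inner_sub_left, inner_sub_right, isSymmetric_resolventAtOne hsymm hres]
  · have h := hnonneg ⟨_, resolventAtOne_mem_domain hres f⟩
    rw [apply_resolventAtOne hres] at h
    change 0 ≤ RCLike.re (inner ℂ (f - resolventAtOne T f) f)
    have e : inner ℂ (f - resolventAtOne T f) f = inner ℂ (f - resolventAtOne T f)
        ((f - resolventAtOne T f) + resolventAtOne T f) := by rw [sub_add_cancel]
    rw [e, inner_add_right, map_add, inner_self_eq_norm_sq,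
      inner_re_symm (𝕜 := ℂ) (f - resolventAtOne T f)]
    exact add_nonneg (sq_nonneg _) h

include hnonneg in
omit [CompleteSpace H] in
/-- The domain of `T` is the range of `(1 + T)⁻¹`. -/
theorem resolventAtOne_apply_add (u : T.domain) : resolventAtOne T (u + T u) = u := by
  set w : T.domain := u - ⟨_, resolventAtOne_mem_domain hres (u + T u)⟩ with hw
  have h1 : T w = -(w : H) := by
    rw [hw, LinearPMap.map_sub, apply_resolventAtOne hres]
    simp only [AddSubgroupClass.coe_sub]
    abel
  have h2 := hnonneg w
  rw [h1, inner_neg_right, Complex.neg_re, ← RCLike.re_eq_complex_re,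
    inner_self_eq_norm_sq] at h2
  have h3 : (w : H) = 0 := by
    rw [← norm_eq_zero]
    nlinarith [sq_nonneg ‖(w : H)‖]
  rw [hw] at h3
  exact (sub_eq_zero.1 h3).symm

include hsymm hnonneg in
/-- Since `R ^ α` is injective, `R ^ α w ↦ (1 - R) ^ α w` is well defined. -/
theorem nonnegPower_spec {α : ℝ} (hα0 : 0 ≤ α) (hα1 : α ≤ 1) (w : H) :
    ∃ hu : (resolventAtOne T ^ α) w ∈ (nonnegPower T α).domain,
      nonnegPower T α ⟨_, hu⟩ = ((1 - resolventAtOne T) ^ α) w := by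
  have h0 := resolventAtOne_nonneg hsymm hnonneg hres
  have hinj := injective_rpow_of_injective h0 (injective_resolventAtOne hres) hα0 hα1
  set g : Submodule ℂ (H × H) := LinearMap.range
    (((resolventAtOne T ^ α : H →L[ℂ] H) : H →ₗ[ℂ] H).prod
      (((1 - resolventAtOne T) ^ α : H →L[ℂ] H) : H →ₗ[ℂ] H)) with hg
  have hfun : ∀ x ∈ g, x.1 = 0 → x.2 = 0 := by
    rintro x ⟨v, rfl⟩ hv
    have hv' : (resolventAtOne T ^ α) v = (resolventAtOne T ^ α) 0 := by
      rw [map_zero]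
      exact hv
    rw [hinj hv']
    exact map_zero _
  have hgraph : (nonnegPower T α).graph = g := Submodule.toLinearPMap_graph_eq g hfun
  have hmem : ((resolventAtOne T ^ α) w, ((1 - resolventAtOne T) ^ α) w) ∈
      (nonnegPower T α).graph := by
    rw [hgraph]
    exact ⟨w, rfl⟩
  refine ⟨LinearPMap.mem_domain_of_mem_graph hmem, ?_⟩
  obtain ⟨y, hy, hy'⟩ := (LinearPMap.mem_graph_iff _).1 hmem
  refine Eq.trans ?_ hy'
  congr 1
  exact Subtype.ext hy.symm

include hsymm hnonneg in
/-- Let the weight `r⁻¹`, acting on `H` by multiplication, be bounded by `k T` in the sense of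
forms. Then `Dom T ⊆ Dom T ^ α` and `‖r ^ (-α) u‖ ≤ k ^ α ‖T ^ α u‖` for `u ∈ Dom T` and
`0 < α ≤ 1/2`. -/
theorem exists_mem_domain_nonnegPower_norm_le {A : Type*} [CStarAlgebra A] {ι : Type*}
    {ev : ι → A →⋆ₐ[ℂ] ℂ} (hevc : ∀ i, Continuous (ev i))
    (hev : ∀ a b : A, (∀ i, ev i a = ev i b) → a = b)
    (φ : A →⋆ₐ[ℂ] (H →L[ℂ] H)) (hφ : Continuous φ) {r : ι → ℝ} (hr : ∀ i, 0 < r i)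
    {p : ℝ → A} (hp : ∀ s i, ev i (p s) = ((r i ^ s : ℝ) : ℂ)) {k : ℝ} (hk : 0 < k)
    (h : ∀ u : T.domain, ‖φ (p (-(1 / 2))) u‖ ^ 2 ≤ k * (inner ℂ (u : H) (T u)).re)
    {α : ℝ} (hα0 : 0 < α) (hα : α ≤ 1 / 2) (u : T.domain) :
    ∃ hu : (u : H) ∈ (nonnegPower T α).domain,
      ‖φ (p (-α)) u‖ ≤ k ^ α * ‖nonnegPower T α ⟨u, hu⟩‖ := by
  have h0 := resolventAtOne_nonneg hsymm hnonneg hres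
  have h1 := resolventAtOne_le_one hsymm hnonneg hres
  set w : H := (resolventAtOne T ^ (1 - α)) (u + T u) with hw
  have hu : (u : H) = (resolventAtOne T ^ α) w := by
    rw [hw, ← mul_apply_eq_comp, rpow_mul_rpow_of_nonneg h0 hα0.le (by linarith),
      add_sub_cancel, CFC.rpow_one _, resolventAtOne_apply_add hnonneg hres]
  have hE : IsStrictlyPositive (φ (p 1)) :=
    IsUnit.isStrictlyPositive ((isUnit_of_eval_rpow hev hr hp 1).map φ)
      (map_nonneg_of_eval_rpow hev φ hr hp 1)
  obtain ⟨hd, hval⟩ := nonnegPower_spec hsymm hnonneg hres hα0.le (by linarith : α ≤ 1) w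
  have key := norm_rpow_neg_mul_rpow_le h0 h1 (injective_resolventAtOne hres) hE hk
    (fun f => by
      rw [map_rpow_of_eval_rpow hevc hev φ hr hp hφ]
      have := h ⟨_, resolventAtOne_mem_domain hres f⟩
      rwa [apply_resolventAtOne hres] at this) hα0 hα w
  rw [map_rpow_of_eval_rpow hevc hev φ hr hp hφ, ← hu, ← hval] at key
  have hd' : (u : H) ∈ (nonnegPower T α).domain := by rw [hu]; exact hd
  refine ⟨hd', key.trans (le_of_eq ?_)⟩
  congr 4
  exact hu.symm

end Operator

end WeightedPower

/-! ### Multiplication operators on `L²` -/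

section Multiplication

open scoped BoundedContinuousFunction

variable {X : Type*} [TopologicalSpace X] [MeasurableSpace X] [OpensMeasurableSpace X]
  {μ : Measure X}

theorem BoundedContinuousFunction.memLp_mul (m : X →ᵇ ℂ) (f : Lp ℂ 2 μ) :
    MemLp (fun x => m x * f x) 2 μ :=
  (Lp.memLp f).of_le_mul (c := ‖m‖)
    (m.continuous.aestronglyMeasurable.mul (Lp.aestronglyMeasurable f))
    (Filter.Eventually.of_forall fun x => by
      rw [norm_mul]
      exact mul_le_mul_of_nonneg_right (m.norm_coe_le_norm x) (norm_nonneg _))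

variable (μ) in
/-- Multiplication by a bounded continuous function, as a bounded operator on `L²`. -/
def mulOperator (m : X →ᵇ ℂ) : Lp ℂ 2 μ →L[ℂ] Lp ℂ 2 μ :=
  LinearMap.mkContinuous
    { toFun := fun f => (m.memLp_mul f).toLp _
      map_add' := fun f g => by
        apply Lp.ext
        filter_upwards [(m.memLp_mul (f + g)).coeFn_toLp, (m.memLp_mul f).coeFn_toLp,
          (m.memLp_mul g).coeFn_toLp, Lp.coeFn_add f g,
          Lp.coeFn_add ((m.memLp_mul f).toLp _) ((m.memLp_mul g).toLp _)] with x h1 h2 h3 h4 h5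
        rw [h1, h5, Pi.add_apply, h2, h3, h4, Pi.add_apply, mul_add]
      map_smul' := fun c f => by
        apply Lp.ext
        filter_upwards [(m.memLp_mul (c • f)).coeFn_toLp, (m.memLp_mul f).coeFn_toLp,
          Lp.coeFn_smul c f, Lp.coeFn_smul c ((m.memLp_mul f).toLp _)] with x h1 h2 h3 h4
        simp only [RingHom.id_apply]
        rw [h1, h4, Pi.smul_apply, h2, h3, Pi.smul_apply, smul_eq_mul, smul_eq_mul]
        ring } ‖m‖ (fun f => by
          refine Lp.norm_le_mul_norm_of_ae_le_mul ?_
          filter_upwards [(m.memLp_mul f).coeFn_toLp] with x h1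
          simp only [LinearMap.coe_mk, AddHom.coe_mk]
          rw [h1, norm_mul]
          exact mul_le_mul_of_nonneg_right (m.norm_coe_le_norm x) (norm_nonneg _))

theorem coeFn_mulOperator (m : X →ᵇ ℂ) (f : Lp ℂ 2 μ) :
    mulOperator μ m f =ᵐ[μ] fun x => m x * f x :=
  (m.memLp_mul f).coeFn_toLp

theorem norm_mulOperator_le (m : X →ᵇ ℂ) : ‖mulOperator μ m‖ ≤ ‖m‖ :=
  LinearMap.mkContinuous_norm_le _ (norm_nonneg _) _

theorem inner_mulOperator_left (m : X →ᵇ ℂ) (f g : Lp ℂ 2 μ) :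
    inner ℂ (mulOperator μ m f) g = inner ℂ f (mulOperator μ (star m) g) := by
  rw [L2.inner_def, L2.inner_def]
  refine integral_congr_ae ?_
  filter_upwards [coeFn_mulOperator m f, coeFn_mulOperator (star m) g] with x h1 h2
  rw [h1, h2]
  simp only [RCLike.inner_apply, map_mul, BoundedContinuousFunction.star_apply]
  rw [RCLike.star_def]
  ring

variable (μ) in
/-- Multiplication operators form a representation of the bounded continuous functions. -/
def mulOperatorHom : (X →ᵇ ℂ) →⋆ₐ[ℂ] (Lp ℂ 2 μ →L[ℂ] Lp ℂ 2 μ) where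
  toFun := mulOperator μ
  map_one' := by
    ext1 f
    apply Lp.ext
    filter_upwards [coeFn_mulOperator 1 f] with x h1
    rw [h1]
    simp
  map_mul' m n := by
    ext1 f
    apply Lp.ext
    rw [mul_apply_eq_comp]
    filter_upwards [coeFn_mulOperator (m * n) f, coeFn_mulOperator m (mulOperator μ n f),
      coeFn_mulOperator n f] with x h1 h2 h3
    rw [h1, h2, h3, BoundedContinuousFunction.mul_apply, mul_assoc]
  map_zero' := by
    ext1 f
    apply Lp.ext
    filter_upwards [coeFn_mulOperator 0 f, Lp.coeFn_zero ℂ 2 μ] with x h1 h2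
    have e : (0 : Lp ℂ 2 μ →L[ℂ] Lp ℂ 2 μ) f = 0 := rfl
    rw [h1, e, h2]
    simp
  map_add' m n := by
    ext1 f
    apply Lp.ext
    rw [add_apply]
    filter_upwards [coeFn_mulOperator (m + n) f, coeFn_mulOperator m f,
      coeFn_mulOperator n f, Lp.coeFn_add (mulOperator μ m f) (mulOperator μ n f)]
      with x h1 h2 h3 h4
    rw [h1, h4, Pi.add_apply, h2, h3, BoundedContinuousFunction.add_apply, add_mul]
  commutes' c := by
    ext1 f
    apply Lp.ext
    filter_upwards [coeFn_mulOperator (algebraMap ℂ (X →ᵇ ℂ) c) f, Lp.coeFn_smul c f] with x h1 h2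
    have e : (algebraMap ℂ (Lp ℂ 2 μ →L[ℂ] Lp ℂ 2 μ) c) f = c • f := rfl
    rw [h1, e, h2]
    simp [Algebra.algebraMap_eq_smul_one]
  map_star' m := by
    rw [ContinuousLinearMap.star_eq_adjoint]
    refine (ContinuousLinearMap.eq_adjoint_iff _ _).2 fun f g => ?_
    rw [inner_mulOperator_left, star_star]

theorem continuous_mulOperatorHom : Continuous (mulOperatorHom μ : (X →ᵇ ℂ) → _) :=
  AddMonoidHomClass.continuous_of_bound (mulOperatorHom μ) 1 fun m => by
    rw [one_mul]
    exact norm_mulOperator_le m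

/-- A bounded continuous real function, as a complex valued one. -/
def bddReal (m : X → ℝ) (hm : Continuous m) (hb : ∃ C, ∀ x, |m x| ≤ C) : X →ᵇ ℂ :=
  BoundedContinuousFunction.ofNormedAddCommGroup (fun x => (m x : ℂ))
    (Complex.continuous_ofReal.comp hm) hb.choose
    (fun x => by simpa using hb.choose_spec x)

variable (μ) in
open Classical in
/-- Multiplication by a real valued function, as a bounded operator on `L²`. The function is meant
to be continuous and bounded; the value is zero otherwise. -/
def realMul (m : X → ℝ) : Lp ℂ 2 μ →L[ℂ] Lp ℂ 2 μ :=
  if h : Continuous m ∧ ∃ C, ∀ x, |m x| ≤ C then mulOperatorHom μ (bddReal m h.1 h.2) else 0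

/-- Continuity and boundedness of a real valued function. -/
def IsBddCont (m : X → ℝ) : Prop := Continuous m ∧ ∃ C, ∀ x, |m x| ≤ C

omit [MeasurableSpace X] [OpensMeasurableSpace X] in
theorem IsBddCont.mul {m n : X → ℝ} (hm : IsBddCont m) (hn : IsBddCont n) :
    IsBddCont (fun x => m x * n x) := by
  obtain ⟨C, hC⟩ := hm.2
  obtain ⟨D, hD⟩ := hn.2
  refine ⟨hm.1.mul hn.1, C * D, fun x => ?_⟩
  rw [abs_mul]
  exact mul_le_mul (hC x) (hD x) (abs_nonneg _) ((abs_nonneg _).trans (hC x))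

theorem realMul_eq {m : X → ℝ} (hm : IsBddCont m) :
    realMul μ m = mulOperatorHom μ (bddReal m hm.1 hm.2) := dif_pos hm

theorem coeFn_realMul {m : X → ℝ} (hm : IsBddCont m) (f : Lp ℂ 2 μ) :
    realMul μ m f =ᵐ[μ] fun x => (m x : ℂ) * f x := by
  rw [realMul_eq hm]
  exact coeFn_mulOperator _ f

theorem isSelfAdjoint_realMul (m : X → ℝ) : IsSelfAdjoint (realMul μ m) := by
  by_cases hm : IsBddCont m
  · rw [realMul_eq hm]
    refine IsSelfAdjoint.map ?_ (mulOperatorHom μ)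
    ext x
    exact Complex.conj_ofReal _
  · have : realMul μ m = 0 := dif_neg hm
    rw [this]
    exact .zero _

theorem inner_realMul_left (m : X → ℝ) (f g : Lp ℂ 2 μ) :
    inner ℂ (realMul μ m f) g = inner ℂ f (realMul μ m g) :=
  ContinuousLinearMap.isSelfAdjoint_iff_isSymmetric.1 (isSelfAdjoint_realMul m) f g

theorem realMul_mul {m n : X → ℝ} (hm : IsBddCont m) (hn : IsBddCont n) :
    realMul μ (fun x => m x * n x) = realMul μ m * realMul μ n := by
  rw [realMul_eq (hm.mul hn), realMul_eq hm, realMul_eq hn, ← map_mul]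
  congr 1
  ext x
  exact Complex.ofReal_mul _ _

theorem realMul_apply_mul {m n : X → ℝ} (hm : IsBddCont m) (hn : IsBddCont n) (f : Lp ℂ 2 μ) :
    realMul μ m (realMul μ n f) = realMul μ (fun x => m x * n x) f := by
  rw [realMul_mul hm hn]
  rfl

omit [TopologicalSpace X] [OpensMeasurableSpace X] in
theorem integrable_norm_sq (f : Lp ℂ 2 μ) : Integrable (fun x => ‖f x‖ ^ 2) μ :=
  (Lp.memLp f).integrable_norm_pow two_ne_zero

omit [TopologicalSpace X] [OpensMeasurableSpace X] in
theorem norm_sq_eq_integral (f : Lp ℂ 2 μ) : ‖f‖ ^ 2 = ∫ x, ‖f x‖ ^ 2 ∂μ := by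
  have h := L2.inner_def (𝕜 := ℂ) f f
  rw [inner_self_eq_norm_sq_to_K] at h
  have h2 : ∀ x, inner ℂ (f x) (f x) = ((‖f x‖ ^ 2 : ℝ) : ℂ) := fun x => by
    rw [inner_self_eq_norm_sq_to_K]
    simp
  simp_rw [h2] at h
  refine Complex.ofReal_injective ?_
  rw [← integral_complex_ofReal, Complex.ofReal_pow]
  exact h

theorem integrable_mul_norm_sq {m : X → ℝ} (hm : IsBddCont m) (f : Lp ℂ 2 μ) :
    Integrable (fun x => m x * ‖f x‖ ^ 2) μ := by
  obtain ⟨C, hC⟩ := hm.2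
  exact (integrable_norm_sq f).bdd_mul hm.1.aestronglyMeasurable
    (Filter.Eventually.of_forall fun x => by simpa using hC x)

theorem norm_realMul_sq {m : X → ℝ} (hm : IsBddCont m) (f : Lp ℂ 2 μ) :
    ‖realMul μ m f‖ ^ 2 = ∫ x, m x ^ 2 * ‖f x‖ ^ 2 ∂μ := by
  rw [norm_sq_eq_integral]
  refine integral_congr_ae ?_
  filter_upwards [coeFn_realMul hm f] with x hx
  rw [hx, norm_mul, mul_pow, Complex.norm_real, Real.norm_eq_abs, sq_abs]

theorem norm_realMul_le_of_le {m n : X → ℝ} (hm : IsBddCont m) (hn : IsBddCont n)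
    (h : ∀ x, |m x| ≤ |n x|) (f : Lp ℂ 2 μ) : ‖realMul μ m f‖ ≤ ‖realMul μ n f‖ := by
  refine Lp.norm_le_norm_of_ae_le ?_
  filter_upwards [coeFn_realMul hm f, coeFn_realMul hn f] with x hx hy
  rw [hx, hy, norm_mul, norm_mul, Complex.norm_real, Complex.norm_real]
  exact mul_le_mul_of_nonneg_right (h x) (norm_nonneg _)

/-- Evaluation at a point, as a representation of the bounded continuous functions. -/
def evalStarAlgHom (x : X) : (X →ᵇ ℂ) →⋆ₐ[ℂ] ℂ where
  toFun f := f x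
  map_one' := rfl
  map_mul' _ _ := rfl
  map_zero' := rfl
  map_add' _ _ := rfl
  commutes' _ := rfl
  map_star' _ := rfl

omit [MeasurableSpace X] [OpensMeasurableSpace X] in
theorem continuous_evalStarAlgHom (x : X) : Continuous (evalStarAlgHom x) :=
  (BoundedContinuousFunction.lipschitz_eval_const x).continuous

section PowersOfMultiplication

variable {e : X → ℝ} (he : IsBddCont e) {b : ℝ} (hb : 0 < b) (hbe : ∀ x, b ≤ e x)

include he hb hbe

omit [MeasurableSpace X] [OpensMeasurableSpace X] in
theorem isBddCont_rpow (s : ℝ) : IsBddCont (fun x => e x ^ s) := by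
  refine ⟨he.1.rpow_const fun x => Or.inl (hb.trans_le (hbe x)).ne', ?_⟩
  obtain ⟨C, hC⟩ := he.2
  refine ⟨max (C ^ s) (b ^ s), fun x => ?_⟩
  have h0 : 0 < e x := hb.trans_le (hbe x)
  have hC' : e x ≤ C := (le_abs_self _).trans (hC x)
  rw [abs_of_nonneg (Real.rpow_nonneg h0.le _)]
  rcases le_total 0 s with hs | hs
  · exact (Real.rpow_le_rpow h0.le hC' hs).trans (le_max_left _ _)
  · exact (Real.rpow_le_rpow_of_nonpos hb (hbe x) hs).trans (le_max_right _ _)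

/-- If `e⁻² ≤ k T` in the sense of forms, then `‖e ^ (-2 α) u‖ ≤ k ^ α ‖T ^ α u‖`, for `α ≤ 1/2`. -/
theorem exists_mem_domain_nonnegPower_realMul_le {T : Lp ℂ 2 μ →ₗ.[ℂ] Lp ℂ 2 μ}
    (hsymm : ∀ u v : T.domain, inner ℂ (T u) (v : Lp ℂ 2 μ) = inner ℂ (u : Lp ℂ 2 μ) (T v))
    (hnonneg : ∀ u : T.domain, 0 ≤ (inner ℂ (u : Lp ℂ 2 μ) (T u)).re)
    (hres : ∃ R : Lp ℂ 2 μ →L[ℂ] Lp ℂ 2 μ, ∀ f, (R f, f - R f) ∈ T.graph)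
    {k : ℝ} (hk : 0 < k)
    (h : ∀ u : T.domain, ‖realMul μ (fun x => e x ^ (-1 : ℝ)) u‖ ^ 2 ≤
      k * (inner ℂ (u : Lp ℂ 2 μ) (T u)).re)
    {α : ℝ} (hα0 : 0 < α) (hα : α ≤ 1 / 2) (u : T.domain) :
    ∃ hu : (u : Lp ℂ 2 μ) ∈ (nonnegPower T α).domain,
      ‖realMul μ (fun x => e x ^ (-(2 * α))) u‖ ≤ k ^ α * ‖nonnegPower T α ⟨u, hu⟩‖ := by
  have hp : ∀ s : ℝ, IsBddCont fun x => e x ^ (2 * s) := fun s => isBddCont_rpow he hb hbe _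
  have h2 : ∀ s : ℝ, mulOperatorHom μ (bddReal _ (hp s).1 (hp s).2) =
      realMul μ fun x => e x ^ (2 * s) := fun s => (realMul_eq (hp s)).symm
  have key := exists_mem_domain_nonnegPower_norm_le hsymm hnonneg hres
    (A := X →ᵇ ℂ) (ev := evalStarAlgHom) continuous_evalStarAlgHom
    (fun a b hab => BoundedContinuousFunction.ext hab) (mulOperatorHom μ)
    continuous_mulOperatorHom (r := fun x => e x ^ (2 : ℝ))
    (fun x => Real.rpow_pos_of_pos (hb.trans_le (hbe x)) _)
    (p := fun s => bddReal _ (hp s).1 (hp s).2)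
    (fun s x => by
      rw [← Real.rpow_mul (hb.trans_le (hbe x)).le]
      rfl) hk (fun u => by
        rw [h2, show (2 : ℝ) * -(1 / 2) = -1 by norm_num]
        exact h u) hα0 hα u
  simp only [h2] at key
  obtain ⟨hu, hle⟩ := key
  refine ⟨hu, ?_⟩
  rwa [mul_neg] at hle

end PowersOfMultiplication

end Multiplication

/-! ### The Dirichlet form and its operator -/

section Operator

variable {Ω : Set Space}

theorem IsTestFunction.continuous_fderiv_apply {E : Type*} [NormedAddCommGroup E]
    [NormedSpace ℝ E] {U : Set E} {φ : E → ℂ} (hφ : IsTestFunction U φ) {v : E → E}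
    (hv : Continuous v) : Continuous fun x => fderiv ℝ φ x (v x) :=
  (hφ.contDiff.continuous_fderiv (by simp)).clm_apply hv

theorem IsTestFunction.hasCompactSupport_fderiv_apply {E : Type*} [NormedAddCommGroup E]
    [NormedSpace ℝ E] {U : Set E} {φ : E → ℂ} (hφ : IsTestFunction U φ) (v : E → E) :
    HasCompactSupport fun x => fderiv ℝ φ x (v x) :=
  (hφ.hasCompactSupport.fderiv (𝕜 := ℝ)).mono fun x hx => by
    contrapose! hx
    simp only [Function.mem_support, not_not] at hx ⊢
    rw [hx]
    rfl

theorem continuous_heisX1 {φ : Space → ℂ} (hφ : IsTestFunction Ω φ) : Continuous (heisX1 φ) :=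
  hφ.continuous_fderiv_apply (v := fun x => (EuclideanSpace.single 0 1, x.1 1 / 2)) (by fun_prop)

theorem continuous_heisX2 {φ : Space → ℂ} (hφ : IsTestFunction Ω φ) : Continuous (heisX2 φ) :=
  hφ.continuous_fderiv_apply (v := fun x => (EuclideanSpace.single 1 1, -(x.1 0 / 2)))
    (by fun_prop)

theorem hasCompactSupport_heisX1 {φ : Space → ℂ} (hφ : IsTestFunction Ω φ) :
    HasCompactSupport (heisX1 φ) := hφ.hasCompactSupport_fderiv_apply _

theorem hasCompactSupport_heisX2 {φ : Space → ℂ} (hφ : IsTestFunction Ω φ) :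
    HasCompactSupport (heisX2 φ) := hφ.hasCompactSupport_fderiv_apply _

theorem exists_mem_testGraph {φ : Space → ℂ} (hφ : IsTestFunction Ω φ) :
    ∃ p ∈ testGraph Ω, p.1 =ᵐ[volume.restrict Ω] φ ∧
      p.2.1 =ᵐ[volume.restrict Ω] heisX1 φ ∧ p.2.2 =ᵐ[volume.restrict Ω] heisX2 φ := by
  have h0 : MemLp φ 2 (volume.restrict Ω) :=
    hφ.contDiff.continuous.memLp_of_hasCompactSupport hφ.hasCompactSupport
  have h1 : MemLp (heisX1 φ) 2 (volume.restrict Ω) :=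
    (continuous_heisX1 hφ).memLp_of_hasCompactSupport (hasCompactSupport_heisX1 hφ)
  have h2 : MemLp (heisX2 φ) 2 (volume.restrict Ω) :=
    (continuous_heisX2 hφ).memLp_of_hasCompactSupport (hasCompactSupport_heisX2 hφ)
  exact ⟨(h0.toLp, h1.toLp, h2.toLp), ⟨φ, hφ, h0.coeFn_toLp, h1.coeFn_toLp, h2.coeFn_toLp⟩,
    h0.coeFn_toLp, h1.coeFn_toLp, h2.coeFn_toLp⟩

theorem testGraph_le_formGraph : testGraph Ω ≤ formGraph Ω := Submodule.le_topologicalClosure _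

/-- Test functions are dense in `L²(Ω)`. -/
theorem eq_zero_of_inner_test_eq_zero (hΩ : IsOpen Ω) (f : L2 Ω)
    (h : ∀ p ∈ testGraph Ω, inner ℂ p.1 f = 0) : f = 0 := by
  have hloc : LocallyIntegrable (f : Space → ℂ) (volume.restrict Ω) :=
    (Lp.memLp f).locallyIntegrable (by norm_num)
  have key := hΩ.ae_eq_zero_of_integral_contDiff_smul_eq_zero (hloc.locallyIntegrableOn Ω)
    fun g hg hgc hgs => ?_
  · apply Lp.ext
    filter_upwards [key, ae_restrict_mem hΩ.measurableSet,
      Lp.coeFn_zero ℂ 2 ((volume : Measure Space).restrict Ω)] with x h1 h2 h3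
    rw [h1 h2, h3]
    rfl
  · have hsupp : Function.support (fun x => (g x : ℂ)) = Function.support g := by
      ext x
      simp
    have hφ : IsTestFunction Ω (fun x => (g x : ℂ)) :=
      { contDiff := Complex.ofRealCLM.contDiff.comp hg
        hasCompactSupport := hgc.comp_left Complex.ofReal_zero
        tsupport_subset := by rwa [tsupport, hsupp] }
    obtain ⟨p, hp, hp0, -, -⟩ := exists_mem_testGraph hφ
    rw [← h p hp, L2.inner_def]
    refine integral_congr_ae ?_
    filter_upwards [hp0] with x hx
    rw [hx, RCLike.inner_apply, Complex.real_smul]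
    simp [mul_comm]

/-- The relation `heisenbergGraph Ω` is single valued, because the form domain is dense. -/
theorem heisenbergGraph_fst_eq_zero (hΩ : IsOpen Ω) (x : L2 Ω × L2 Ω)
    (hx : x ∈ heisenbergGraph Ω) (h0 : x.1 = 0) : x.2 = 0 := by
  obtain ⟨g₁, g₂, hg, H⟩ := hx
  have h1 := H _ _ _ hg
  have h2 : ‖g₁‖ ^ 2 + ‖g₂‖ ^ 2 = 0 := by
    have h2 := congrArg Complex.re h1
    rwa [h0, inner_zero_left, Complex.add_re, ← RCLike.re_eq_complex_re, inner_self_eq_norm_sq,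
      inner_self_eq_norm_sq] at h2
  have h3 : g₁ = 0 := by
    rw [← norm_eq_zero]
    nlinarith [sq_nonneg ‖g₁‖, sq_nonneg ‖g₂‖]
  have h4 : g₂ = 0 := by
    rw [← norm_eq_zero]
    nlinarith [sq_nonneg ‖g₁‖, sq_nonneg ‖g₂‖]
  refine eq_zero_of_inner_test_eq_zero hΩ _ fun p hp => ?_
  rw [← H p.1 p.2.1 p.2.2 (testGraph_le_formGraph hp), h3, h4]
  simp

theorem heisenbergLaplacian_graph (hΩ : IsOpen Ω) :
    (heisenbergLaplacian Ω).graph = heisenbergGraph Ω :=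
  Submodule.toLinearPMap_graph_eq _ (heisenbergGraph_fst_eq_zero hΩ)

/-- Elements of `Dom(A(Ω))` lie in the form domain, and `a[v, u] = ⟨v, A(Ω) u⟩`. -/
theorem heisenbergLaplacian_spec (hΩ : IsOpen Ω) (u : (heisenbergLaplacian Ω).domain) :
    ∃ g₁ g₂ : L2 Ω, ((u : L2 Ω), g₁, g₂) ∈ formGraph Ω ∧
      ∀ v h₁ h₂ : L2 Ω, (v, h₁, h₂) ∈ formGraph Ω →
        inner ℂ h₁ g₁ + inner ℂ h₂ g₂ = inner ℂ v (heisenbergLaplacian Ω u) := by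
  have h := LinearPMap.mem_graph _ u
  rw [heisenbergLaplacian_graph hΩ] at h
  exact h

theorem heisenbergLaplacian_symm (hΩ : IsOpen Ω) (u v : (heisenbergLaplacian Ω).domain) :
    inner ℂ (heisenbergLaplacian Ω u) (v : L2 Ω) =
      inner ℂ (u : L2 Ω) (heisenbergLaplacian Ω v) := by
  obtain ⟨g₁, g₂, hg, H⟩ := heisenbergLaplacian_spec hΩ u
  obtain ⟨k₁, k₂, hk, K⟩ := heisenbergLaplacian_spec hΩ v
  rw [← inner_conj_symm, ← H _ _ _ hk, ← K _ _ _ hg, map_add, inner_conj_symm, inner_conj_symm]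

theorem heisenbergLaplacian_nonneg (hΩ : IsOpen Ω) (u : (heisenbergLaplacian Ω).domain) :
    0 ≤ (inner ℂ (u : L2 Ω) (heisenbergLaplacian Ω u)).re := by
  obtain ⟨g₁, g₂, hg, H⟩ := heisenbergLaplacian_spec hΩ u
  rw [← H _ _ _ hg, Complex.add_re, ← RCLike.re_eq_complex_re, inner_self_eq_norm_sq,
    inner_self_eq_norm_sq]
  positivity

/-- The resolvent is obtained by orthogonal projection, in `L²(Ω)³`, of `(f, 0, 0)` to the closed
subspace of the triples `(u, X₁u, X₂u)`. -/
theorem exists_resolvent_heisenbergLaplacian (hΩ : IsOpen Ω) :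
    ∃ R : L2 Ω →L[ℂ] L2 Ω, ∀ f, (R f, f - R f) ∈ (heisenbergLaplacian Ω).graph := by
  rw [heisenbergLaplacian_graph hΩ]
  let e₂ := WithLp.prodContinuousLinearEquiv 2 ℂ (L2 Ω) (L2 Ω)
  let e₁ := WithLp.prodContinuousLinearEquiv 2 ℂ (L2 Ω) (WithLp 2 (L2 Ω × L2 Ω))
  let j : WithLp 2 (L2 Ω × WithLp 2 (L2 Ω × L2 Ω)) →L[ℂ] L2 Ω × L2 Ω × L2 Ω :=
    ((ContinuousLinearMap.id ℂ (L2 Ω)).prodMap (e₂ : WithLp 2 (L2 Ω × L2 Ω) →L[ℂ] L2 Ω × L2 Ω)).comp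
      (e₁ : WithLp 2 (L2 Ω × WithLp 2 (L2 Ω × L2 Ω)) →L[ℂ] L2 Ω × WithLp 2 (L2 Ω × L2 Ω))
  have hj : ∀ x, j x = (x.fst, x.snd.fst, x.snd.snd) := fun x => rfl
  let V : Submodule ℂ (WithLp 2 (L2 Ω × WithLp 2 (L2 Ω × L2 Ω))) :=
    (formGraph Ω).comap (j : WithLp 2 (L2 Ω × WithLp 2 (L2 Ω × L2 Ω)) →ₗ[ℂ] L2 Ω × L2 Ω × L2 Ω)
  have hVc : IsClosed (V : Set (WithLp 2 (L2 Ω × WithLp 2 (L2 Ω × L2 Ω)))) :=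
    (Submodule.isClosed_topologicalClosure _).preimage j.continuous
  have : CompleteSpace V := hVc.completeSpace_coe
  let ι : L2 Ω →L[ℂ] WithLp 2 (L2 Ω × WithLp 2 (L2 Ω × L2 Ω)) :=
    (e₁.symm : L2 Ω × WithLp 2 (L2 Ω × L2 Ω) →L[ℂ] _).comp (ContinuousLinearMap.inl ℂ _ _)
  have hι : ∀ f, (ι f).fst = f ∧ (ι f).snd = 0 := fun f => ⟨rfl, rfl⟩
  refine ⟨(ContinuousLinearMap.fst ℂ (L2 Ω) (L2 Ω × L2 Ω)).comp
    (j.comp (V.starProjection.comp ι)), fun f => ?_⟩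
  set z := V.starProjection (ι f) with hz
  refine ⟨z.snd.fst, z.snd.snd, ?_, fun v h₁ h₂ hv => ?_⟩
  · have hzV : z ∈ V := V.starProjection_apply_mem _
    exact hzV
  · set w : WithLp 2 (L2 Ω × WithLp 2 (L2 Ω × L2 Ω)) := WithLp.toLp 2 (v, WithLp.toLp 2 (h₁, h₂))
    have hw : w ∈ V := hv
    have h := Submodule.starProjection_inner_eq_zero (K := V) (ι f) w hw
    rw [← inner_conj_symm, map_eq_zero, inner_sub_right, sub_eq_zero, WithLp.prod_inner_apply,
      WithLp.prod_inner_apply, WithLp.prod_inner_apply] at h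
    change inner ℂ v f + inner ℂ (WithLp.toLp 2 (h₁, h₂) : WithLp 2 (L2 Ω × L2 Ω)) 0 =
      inner ℂ v z.fst + (inner ℂ h₁ z.snd.fst + inner ℂ h₂ z.snd.snd) at h
    rw [inner_zero_right, add_zero] at h
    change inner ℂ h₁ z.snd.fst + inner ℂ h₂ z.snd.snd = inner ℂ v (f - z.fst)
    rw [inner_sub_right, h]
    ring

end Operator

/-! ### Multiplication by functions of `x'` -/

section Leibniz

variable {Ω : Set Space}

/-- The partial derivative of a real function on the plane. -/
def planeDeriv (i : Fin 2) (σ : Plane → ℝ) (x : Plane) : ℝ :=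
  fderiv ℝ σ x (EuclideanSpace.single i 1)

theorem fderiv_ofReal_comp_fst_mul {σ : Plane → ℝ} (hσ : Differentiable ℝ σ) {φ : Space → ℂ}
    (hφ : Differentiable ℝ φ) (x v : Space) :
    fderiv ℝ (fun y : Space => (σ y.1 : ℂ) * φ y) x v =
      (σ x.1 : ℂ) * fderiv ℝ φ x v + (fderiv ℝ σ x.1 v.1 : ℂ) * φ x := by
  have h1 : HasFDerivAt (fun y : Space => σ y.1)
      ((fderiv ℝ σ x.1).comp (ContinuousLinearMap.fst ℝ Plane ℝ)) x :=
    (hσ x.1).hasFDerivAt.comp x hasFDerivAt_fst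
  have h2 := h1.smul (hφ x).hasFDerivAt
  have h3 : (fun y : Space => (σ y.1 : ℂ) * φ y) = fun y => σ y.1 • φ y := by
    funext y
    rw [Complex.real_smul]
  rw [h3]
  erw [h2.fderiv]
  simp

theorem IsTestFunction.ofReal_comp_fst_mul {σ : Plane → ℝ}
    (hσ : ContDiff ℝ ((⊤ : ℕ∞) : WithTop ℕ∞) σ) {φ : Space → ℂ} (hφ : IsTestFunction Ω φ) :
    IsTestFunction Ω (fun y : Space => (σ y.1 : ℂ) * φ y) where
  contDiff := (Complex.ofRealCLM.contDiff.comp (hσ.comp contDiff_fst)).mul hφ.contDiff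
  hasCompactSupport := hφ.hasCompactSupport.mul_left
  tsupport_subset := (tsupport_mul_subset_right (f := fun y : Space => (σ y.1 : ℂ))).trans
    hφ.tsupport_subset

/-- The form domain is stable under multiplication by smooth functions of `x'` which are bounded
together with their first derivatives, and the product rule holds. -/
theorem mul_mem_formGraph {σ : Plane → ℝ} (hσ : ContDiff ℝ ((⊤ : ℕ∞) : WithTop ℕ∞) σ)
    (h0 : IsBddCont fun x : Space => σ x.1)
    (h1 : IsBddCont fun x : Space => planeDeriv 0 σ x.1)
    (h2 : IsBddCont fun x : Space => planeDeriv 1 σ x.1)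
    {u g₁ g₂ : L2 Ω} (hu : (u, g₁, g₂) ∈ formGraph Ω) :
    (realMul _ (fun x : Space => σ x.1) u,
      realMul _ (fun x : Space => σ x.1) g₁ + realMul _ (fun x : Space => planeDeriv 0 σ x.1) u,
      realMul _ (fun x : Space => σ x.1) g₂ + realMul _ (fun x : Space => planeDeriv 1 σ x.1) u) ∈
      formGraph Ω := by
  let Φ : L2 Ω × L2 Ω × L2 Ω → L2 Ω × L2 Ω × L2 Ω := fun p =>
    (realMul _ (fun x : Space => σ x.1) p.1,
      realMul _ (fun x : Space => σ x.1) p.2.1 +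
        realMul _ (fun x : Space => planeDeriv 0 σ x.1) p.1,
      realMul _ (fun x : Space => σ x.1) p.2.2 +
        realMul _ (fun x : Space => planeDeriv 1 σ x.1) p.1)
  have hΦ : Continuous Φ := by fun_prop
  refine map_mem_closure (f := Φ) hΦ hu fun p hp => ?_
  obtain ⟨φ, hφ, e0, e1, e2⟩ := hp
  have hd := hσ.differentiable (by simp)
  have hφd := hφ.contDiff.differentiable (by simp)
  refine ⟨_, hφ.ofReal_comp_fst_mul hσ, ?_, ?_, ?_⟩
  · filter_upwards [coeFn_realMul h0 p.1, e0] with x a b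
    rw [a, b]
  · filter_upwards [Lp.coeFn_add (realMul _ (fun x : Space => σ x.1) p.2.1)
      (realMul _ (fun x : Space => planeDeriv 0 σ x.1) p.1),
      coeFn_realMul h0 p.2.1, coeFn_realMul h1 p.1, e0, e1] with x a b c d e
    rw [a, Pi.add_apply, b, c, d, e]
    exact (fderiv_ofReal_comp_fst_mul hd hφd x _).symm
  · filter_upwards [Lp.coeFn_add (realMul _ (fun x : Space => σ x.1) p.2.2)
      (realMul _ (fun x : Space => planeDeriv 1 σ x.1) p.1),
      coeFn_realMul h0 p.2.2, coeFn_realMul h2 p.1, e0, e2] with x a b c d e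
    rw [a, Pi.add_apply, b, c, d, e]
    exact (fderiv_ofReal_comp_fst_mul hd hφd x _).symm

/-- The localization formula `a[σu] = Re ⟨σ²u, A(Ω)u⟩ + ‖(∇σ)u‖²`. -/
theorem form_mul_eq (hΩ : IsOpen Ω) {σ : Plane → ℝ} (hσ : ContDiff ℝ ((⊤ : ℕ∞) : WithTop ℕ∞) σ)
    (h0 : IsBddCont fun x : Space => σ x.1)
    (h1 : IsBddCont fun x : Space => planeDeriv 0 σ x.1)
    (h2 : IsBddCont fun x : Space => planeDeriv 1 σ x.1)
    (u : (heisenbergLaplacian Ω).domain) :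
    ∃ k₁ k₂ : L2 Ω, (realMul _ (fun x : Space => σ x.1) (u : L2 Ω), k₁, k₂) ∈ formGraph Ω ∧
      ‖k₁‖ ^ 2 + ‖k₂‖ ^ 2 =
        (inner ℂ (realMul _ (fun x : Space => σ x.1 * σ x.1) (u : L2 Ω))
          (heisenbergLaplacian Ω u)).re +
        ‖realMul _ (fun x : Space => planeDeriv 0 σ x.1) (u : L2 Ω)‖ ^ 2 +
        ‖realMul _ (fun x : Space => planeDeriv 1 σ x.1) (u : L2 Ω)‖ ^ 2 := by
  obtain ⟨g₁, g₂, hg, H⟩ := heisenbergLaplacian_spec hΩ u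
  have hk := mul_mem_formGraph hσ h0 h1 h2 hg
  have hkk := mul_mem_formGraph hσ h0 h1 h2 hk
  refine ⟨_, _, hk, ?_⟩
  have hH := congrArg Complex.re (H _ _ _ hkk)
  rw [realMul_apply_mul h0 h0] at hH
  rw [← hH]
  have gen : ∀ {τ : Space → ℝ} (_ : IsBddCont τ) (g : L2 Ω),
      ‖realMul _ (fun x : Space => σ x.1) g + realMul _ τ (u : L2 Ω)‖ ^ 2 =
      (inner ℂ (realMul _ (fun x : Space => σ x.1)
          (realMul _ (fun x : Space => σ x.1) g + realMul _ τ (u : L2 Ω)) +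
        realMul _ τ (realMul _ (fun x : Space => σ x.1) (u : L2 Ω))) g).re +
      ‖realMul _ τ (u : L2 Ω)‖ ^ 2 := by
    intro τ hτ g
    have hcomm : realMul _ τ (realMul _ (fun x : Space => σ x.1) (u : L2 Ω)) =
        realMul _ (fun x : Space => σ x.1) (realMul _ τ (u : L2 Ω)) := by
      rw [realMul_apply_mul hτ h0, realMul_apply_mul h0 hτ]
      simp_rw [mul_comm]
    rw [hcomm, ← map_add, inner_realMul_left, ← inner_self_eq_norm_sq (𝕜 := ℂ),
      ← inner_self_eq_norm_sq (𝕜 := ℂ)]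
    simp only [inner_add_left, inner_add_right, map_add, RCLike.re_eq_complex_re, Complex.add_re]
    have hs : (inner ℂ (realMul _ (fun x : Space => σ x.1) g) (realMul _ τ (u : L2 Ω))).re =
      (inner ℂ (realMul _ τ (u : L2 Ω)) (realMul _ (fun x : Space => σ x.1) g)).re :=
      inner_re_symm (𝕜 := ℂ) _ _
    rw [hs]
    ring
  rw [gen h1 g₁, gen h2 g₂, Complex.add_re]
  ring

end Leibniz

/-! ### Smooth approximation of Lipschitz functions -/

section Mollification

open scoped Convolution

/-- A `1`-Lipschitz function is bounded below by a smooth `1`-Lipschitz function, up to a uniform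
error. -/
theorem exists_contDiff_lipschitz_approx {f : Plane → ℝ} (hf : LipschitzWith 1 f) {η : ℝ}
    (hη : 0 < η) :
    ∃ d : Plane → ℝ, ContDiff ℝ ((⊤ : ℕ∞) : WithTop ℕ∞) d ∧ LipschitzWith 1 d ∧
      ∀ x, f x ≤ d x ∧ d x ≤ f x + η := by
  let φ : ContDiffBump (0 : Plane) := ⟨η / 4, η / 2, by linarith, by linarith⟩
  set g : Plane → ℝ := φ.normed volume ⋆[ContinuousLinearMap.lsmul ℝ ℝ, volume] f with hg
  have hgs : ContDiff ℝ ((⊤ : ℕ∞) : WithTop ℕ∞) g :=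
    φ.hasCompactSupport_normed.contDiff_convolution_left _ φ.contDiff_normed
      hf.continuous.locallyIntegrable
  have hclose : ∀ x, dist (g x) (f x) ≤ η / 2 := fun x =>
    φ.dist_normed_convolution_le hf.continuous.aestronglyMeasurable fun y hy =>
      (hf.dist_le_mul y x).trans (by simpa using hy.le)
  have hint : ∀ x, Integrable (fun t => φ.normed volume t * f (x - t)) := fun x =>
    (φ.continuous_normed.mul (hf.continuous.comp (continuous_const.sub continuous_id))
      ).integrable_of_hasCompactSupport φ.hasCompactSupport_normed.mul_right
  have hlip : LipschitzWith 1 g := by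
    refine LipschitzWith.of_dist_le_mul fun x y => ?_
    have e : g x - g y = ∫ t, φ.normed volume t * (f (x - t) - f (y - t)) := by
      simp only [mul_sub]
      rw [integral_sub (hint x) (hint y)]
      rfl
    rw [Real.dist_eq, e, NNReal.coe_one, one_mul]
    calc |∫ t, φ.normed volume t * (f (x - t) - f (y - t))|
        ≤ ∫ t, φ.normed volume t * dist x y := by
          rw [← Real.norm_eq_abs]
          refine norm_integral_le_of_norm_le (φ.integrable_normed.mul_const _)
            (Filter.Eventually.of_forall fun t => ?_)
          rw [norm_mul, Real.norm_of_nonneg (φ.nonneg_normed t)]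
          refine mul_le_mul_of_nonneg_left ?_ (φ.nonneg_normed t)
          have := hf.dist_le_mul (x - t) (y - t)
          rwa [NNReal.coe_one, one_mul, Real.dist_eq, dist_sub_right] at this
      _ = dist x y := by rw [integral_mul_const, φ.integral_normed, one_mul]
  refine ⟨fun x => g x + η / 2, hgs.add contDiff_const, ?_, fun x => ?_⟩
  · refine LipschitzWith.of_dist_le_mul fun x y => ?_
    rw [dist_add_right]
    exact hlip.dist_le_mul x y
  · have := abs_le.1 (Real.dist_eq _ _ ▸ hclose x)
    constructor <;> linarith [this.1, this.2]

end Mollification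

/-! ### Gradients of functions on the plane -/

section Gradient

/-- `|∇φ|²`. -/
def gradSq (φ : Plane → ℂ) (x : Plane) : ℝ :=
  ‖planePartial 0 φ x‖ ^ 2 + ‖planePartial 1 φ x‖ ^ 2

theorem gradSq_nonneg (φ : Plane → ℂ) (x : Plane) : 0 ≤ gradSq φ x := by
  unfold gradSq
  positivity

theorem plane_eq_sum (v : Plane) :
    v = v 0 • EuclideanSpace.single 0 1 + v 1 • EuclideanSpace.single 1 1 := by
  ext i
  fin_cases i <;> simp

theorem norm_sq_plane (v : Plane) : ‖v‖ ^ 2 = v 0 ^ 2 + v 1 ^ 2 := by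
  rw [EuclideanSpace.norm_sq_eq, Fin.sum_univ_two, Real.norm_eq_abs, Real.norm_eq_abs, sq_abs,
    sq_abs]

theorem norm_fderiv_apply_sq_le (φ : Plane → ℂ) (x v : Plane) (hv : ‖v‖ = 1) :
    ‖fderiv ℝ φ x v‖ ^ 2 ≤ gradSq φ x := by
  have h1 : v 0 ^ 2 + v 1 ^ 2 = 1 := by rw [← norm_sq_plane, hv, one_pow]
  have h2 : ‖fderiv ℝ φ x v‖ ≤
      |v 0| * ‖planePartial 0 φ x‖ + |v 1| * ‖planePartial 1 φ x‖ := by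
    conv_lhs => rw [plane_eq_sum v]
    rw [map_add, map_smul, map_smul]
    refine (norm_add_le _ _).trans ?_
    rw [norm_smul, norm_smul, Real.norm_eq_abs, Real.norm_eq_abs]
    rfl
  have h3 := pow_le_pow_left₀ (norm_nonneg _) h2 2
  unfold gradSq
  have h4 : |v 0| ^ 2 + |v 1| ^ 2 = 1 := by rw [sq_abs, sq_abs, h1]
  nlinarith [sq_nonneg (|v 0| * ‖planePartial 1 φ x‖ - |v 1| * ‖planePartial 0 φ x‖)]

/-- A `1`-Lipschitz function has gradient of length at most one. -/
theorem planeDeriv_sq_add_sq_le {d : Plane → ℝ} (hd : LipschitzWith 1 d) (x : Plane) :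
    planeDeriv 0 d x ^ 2 + planeDeriv 1 d x ^ 2 ≤ 1 := by
  set a := planeDeriv 0 d x
  set b := planeDeriv 1 d x
  set v : Plane := a • EuclideanSpace.single 0 1 + b • EuclideanSpace.single 1 1 with hv
  have h0 : v 0 = a := by simp [hv]
  have h1 : v 1 = b := by simp [hv]
  have h2 : ‖v‖ ^ 2 = a ^ 2 + b ^ 2 := by rw [norm_sq_plane, h0, h1]
  have h3 : fderiv ℝ d x v = a ^ 2 + b ^ 2 := by
    rw [hv, map_add, map_smul, map_smul, smul_eq_mul, smul_eq_mul, sq, sq]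
    rfl
  have h4 : |fderiv ℝ d x v| ≤ 1 * ‖v‖ :=
    (fderiv ℝ d x).le_of_opNorm_le (norm_fderiv_le_of_lipschitz ℝ hd) v
  rw [h3, ← h2, abs_of_nonneg (sq_nonneg _), one_mul] at h4
  rw [← h2]
  nlinarith [norm_nonneg v]

theorem IsTestFunction.continuous_planePartial {ω : Set Plane} {φ : Plane → ℂ}
    (hφ : IsTestFunction ω φ) (i : Fin 2) : Continuous (planePartial i φ) :=
  hφ.continuous_fderiv_apply continuous_const

theorem IsTestFunction.continuous_gradSq {ω : Set Plane} {φ : Plane → ℂ}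
    (hφ : IsTestFunction ω φ) : Continuous (gradSq φ) :=
  ((hφ.continuous_planePartial 0).norm.pow 2).add ((hφ.continuous_planePartial 1).norm.pow 2)

theorem IsTestFunction.hasCompactSupport_gradSq {ω : Set Plane} {φ : Plane → ℂ}
    (hφ : IsTestFunction ω φ) : HasCompactSupport (gradSq φ) := by
  refine (hφ.hasCompactSupport.fderiv (𝕜 := ℝ)).mono fun x hx => ?_
  contrapose! hx
  simp only [Function.mem_support, not_not] at hx ⊢
  simp [gradSq, planePartial, hx]

theorem IsTestFunction.integrable_gradSq {ω : Set Plane} {φ : Plane → ℂ}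
    (hφ : IsTestFunction ω φ) : Integrable (gradSq φ) :=
  hφ.continuous_gradSq.integrable_of_hasCompactSupport hφ.hasCompactSupport_gradSq

theorem IsTestFunction.apply_eq_zero {E : Type*} [NormedAddCommGroup E] [NormedSpace ℝ E]
    {U : Set E} {φ : E → ℂ} (hφ : IsTestFunction U φ) {x : E} (hx : x ∉ U) : φ x = 0 :=
  image_eq_zero_of_notMem_tsupport fun h => hx (hφ.tsupport_subset h)

end Gradient

/-! ### Integration along lines -/

section Lines

/-- The point of the plane with coordinates `(s, y)` in the orthonormal frame given by `e`. -/
def framePoint (e : Plane ≃ₗᵢ[ℝ] Plane) (s y : ℝ) : Plane := e.symm !₂[s, y]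

theorem apply_framePoint (e : Plane ≃ₗᵢ[ℝ] Plane) (s y : ℝ) :
    e (framePoint e s y) = !₂[s, y] := e.apply_symm_apply _

theorem framePoint_apply (e : Plane ≃ₗᵢ[ℝ] Plane) (x : Plane) :
    framePoint e (e x 0) (e x 1) = x := by
  rw [framePoint, e.symm_apply_eq]
  ext i
  fin_cases i <;> simp

theorem dist_framePoint (e : Plane ≃ₗᵢ[ℝ] Plane) (s y z : ℝ) :
    dist (framePoint e s y) (framePoint e s z) = |y - z| := by
  rw [framePoint, framePoint, e.symm.dist_map, EuclideanSpace.dist_eq, Fin.sum_univ_two]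
  simp [Real.dist_eq, Real.sqrt_sq_eq_abs]

theorem hasDerivAt_framePoint (e : Plane ≃ₗᵢ[ℝ] Plane) (s y : ℝ) :
    HasDerivAt (framePoint e s) (e.symm (EuclideanSpace.single 1 1)) y := by
  have h : framePoint e s = fun y => framePoint e s 0 + y • e.symm (EuclideanSpace.single 1 1) := by
    funext y
    rw [framePoint, framePoint, ← map_smul, ← map_add]
    congr 1
    ext i
    fin_cases i <;> simp
  rw [h]
  simpa using ((hasDerivAt_id y).smul_const (e.symm (EuclideanSpace.single 1 1))).const_add
    (framePoint e s 0)

/-- Tonelli's theorem in the orthonormal frame given by `e`. -/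
theorem lintegral_eq_lintegral_framePoint (e : Plane ≃ₗᵢ[ℝ] Plane) {F : Plane → ENNReal}
    (hF : Measurable F) : ∫⁻ x, F x = ∫⁻ s, ∫⁻ y, F (framePoint e s y) := by
  have h1 : MeasurePreserving (fun z : ℝ × ℝ => framePoint e z.1 z.2) := by
    have a := (volume_preserving_finTwoArrow ℝ).symm
    have b := (EuclideanSpace.volume_preserving_symm_measurableEquiv_toLp (Fin 2)).symm
    have c := e.symm.measurePreserving
    exact c.comp (b.comp a)
  rw [← h1.lintegral_comp hF, Measure.volume_eq_prod, lintegral_prod]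
  exact (hF.comp h1.measurable).aemeasurable

end Lines

/-! ### The one-dimensional Hardy inequality -/

section OneDimensional

theorem norm_sq_div_le {a b : ℂ} {t : ℝ} (ht : 0 < t) :
    2 * inner ℝ a b / (2 * t) - ‖a‖ ^ 2 * 2 / (2 * t) ^ 2 ≤ ‖b‖ ^ 2 - ‖a‖ ^ 2 / (4 * t ^ 2) := by
  have h : 0 ≤ ‖b - (1 / (2 * t)) • a‖ ^ 2 := sq_nonneg _
  rw [norm_sub_sq_real, inner_smul_right, norm_smul, mul_pow, Real.norm_eq_abs, sq_abs,
    real_inner_comm] at h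
  have e1 : 2 * inner ℝ a b / (2 * t) = 2 * (1 / (2 * t) * inner ℝ a b) := by ring
  have e2 : ‖a‖ ^ 2 * 2 / (2 * t) ^ 2 = 2 * ((1 / (2 * t)) ^ 2 * ‖a‖ ^ 2) := by ring
  have e3 : ‖a‖ ^ 2 / (4 * t ^ 2) = (1 / (2 * t)) ^ 2 * ‖a‖ ^ 2 := by
    field_simp
    ring
  rw [e1, e2, e3]
  linarith

/-- Hardy's inequality on an interval. The shift `ε` keeps the integrals proper. -/
theorem integral_norm_sq_div_le {f f' : ℝ → ℂ} (hf : ∀ t, HasDerivAt f (f' t) t)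
    (hf' : Continuous f') (h0 : f 0 = 0) {ε M : ℝ} (hε : 0 < ε) (hM : 0 ≤ M) :
    ∫ t in (0 : ℝ)..M, ‖f t‖ ^ 2 / (t + ε) ^ 2 ≤ 4 * ∫ t in (0 : ℝ)..M, ‖f' t‖ ^ 2 := by
  have hfc : Continuous f := continuous_iff_continuousAt.2 fun t => (hf t).continuousAt
  have hpos : ∀ t ∈ uIcc (0 : ℝ) M, 0 < t + ε := fun t ht => by
    rw [uIcc_of_le hM] at ht
    linarith [ht.1]
  have hder : ∀ t ∈ uIcc (0 : ℝ) M, HasDerivAt (fun t => ‖f t‖ ^ 2 / (2 * (t + ε)))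
      (2 * inner ℝ (f t) (f' t) / (2 * (t + ε)) - ‖f t‖ ^ 2 * 2 / (2 * (t + ε)) ^ 2) t := by
    intro t ht
    have h1 := (hf t).norm_sq
    have h2 : HasDerivAt (fun t : ℝ => 2 * (t + ε)) 2 t := by
      simpa using ((hasDerivAt_id t).add_const ε).const_mul 2
    have hne : 2 * (t + ε) ≠ 0 := by have := hpos t ht; positivity
    have h3 := h1.div h2 hne
    have e : 2 * inner ℝ (f t) (f' t) / (2 * (t + ε)) - ‖f t‖ ^ 2 * 2 / (2 * (t + ε)) ^ 2 =
        (2 * inner ℝ (f t) (f' t) * (2 * (t + ε)) - ‖f t‖ ^ 2 * 2) / (2 * (t + ε)) ^ 2 := by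
      rw [sub_div, sq (2 * (t + ε)), mul_div_mul_right _ _ hne]
    rw [e]
    exact h3
  have hinner : Continuous fun t => inner ℝ (f t) (f' t) := hfc.inner hf'
  have hc1 : ContinuousOn (fun t => 2 * inner ℝ (f t) (f' t) / (2 * (t + ε)) -
      ‖f t‖ ^ 2 * 2 / (2 * (t + ε)) ^ 2) (uIcc 0 M) := by
    refine ContinuousOn.sub ?_ ?_
    · refine ContinuousOn.div (by fun_prop) (by fun_prop) fun t ht => ?_
      have := hpos t ht
      positivity
    · refine ContinuousOn.div (by fun_prop) (by fun_prop) fun t ht => ?_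
      have := hpos t ht
      positivity
  have hc2 : ContinuousOn (fun t => ‖f t‖ ^ 2 / (4 * (t + ε) ^ 2)) (uIcc 0 M) := by
    refine ContinuousOn.div (by fun_prop) (by fun_prop) fun t ht => ?_
    have := hpos t ht
    positivity
  have hc3 : ContinuousOn (fun t => ‖f' t‖ ^ 2) (uIcc 0 M) := by fun_prop
  have hi2 : IntervalIntegrable (fun t => ‖f t‖ ^ 2 / (4 * (t + ε) ^ 2)) volume 0 M :=
    hc2.intervalIntegrable
  have hi3 : IntervalIntegrable (fun t => ‖f' t‖ ^ 2) volume 0 M := hc3.intervalIntegrable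
  have key := intervalIntegral.integral_mono_on (μ := volume) hM hc1.intervalIntegrable
    (hi3.sub hi2) fun t ht => norm_sq_div_le (a := f t) (b := f' t)
      (hpos t (by rwa [uIcc_of_le hM]))
  rw [intervalIntegral.integral_eq_sub_of_hasDerivAt hder hc1.intervalIntegrable, h0] at key
  erw [intervalIntegral.integral_sub hi3 hi2] at key
  have e : ∫ t in (0 : ℝ)..M, ‖f t‖ ^ 2 / (4 * (t + ε) ^ 2) =
      (1 / 4) * ∫ t in (0 : ℝ)..M, ‖f t‖ ^ 2 / (t + ε) ^ 2 := by
    rw [← intervalIntegral.integral_const_mul]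
    congr 1
    funext t
    rw [mul_comm (4 : ℝ), ← div_div]
    ring
  rw [e] at key
  have h5 : 0 ≤ ‖f M‖ ^ 2 / (2 * (M + ε)) := by positivity
  rw [norm_zero] at key
  have h6 : (0 : ℝ) ^ 2 / (2 * (0 + ε)) = 0 := by simp
  linarith

theorem lintegral_norm_sq_div_le {f f' : ℝ → ℂ} (hf : ∀ t, HasDerivAt f (f' t) t)
    (hf' : Continuous f') {a L ε : ℝ} (h0 : f a = 0) (hε : 0 < ε) (hL : 0 ≤ L) :
    ∫⁻ t in Ioc a (a + L), ENNReal.ofReal (‖f t‖ ^ 2 / (t - a + ε) ^ 2) ≤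
      4 * ∫⁻ t, ENNReal.ofReal (‖f' t‖ ^ 2) := by
  have hfc : Continuous f := continuous_iff_continuousAt.2 fun t => (hf t).continuousAt
  have hshift : ∀ t, HasDerivAt (fun t => f (t + a)) (f' (t + a)) t := fun t =>
    (hf (t + a)).comp_add_const t a
  have key := integral_norm_sq_div_le hshift (by fun_prop) (by simpa using h0) hε hL
  have e1 : ∫ t in (0 : ℝ)..L, ‖f (t + a)‖ ^ 2 / (t + ε) ^ 2 =
      ∫ t in a..(a + L), ‖f t‖ ^ 2 / (t - a + ε) ^ 2 := by
    have := intervalIntegral.integral_comp_add_right (a := 0) (b := L)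
      (fun t => ‖f t‖ ^ 2 / (t - a + ε) ^ 2) a
    simp only [add_sub_cancel_right, zero_add] at this
    rw [this, add_comm a L]
  have e2 : ∫ t in (0 : ℝ)..L, ‖f' (t + a)‖ ^ 2 = ∫ t in a..(a + L), ‖f' t‖ ^ 2 := by
    have := intervalIntegral.integral_comp_add_right (a := 0) (b := L) (fun t => ‖f' t‖ ^ 2) a
    simp only [zero_add] at this
    rw [this, add_comm a L]
  have haL : a ≤ a + L := by linarith
  rw [e1, e2, intervalIntegral.integral_of_le haL, intervalIntegral.integral_of_le haL] at key
  have hc1 : ContinuousOn (fun t => ‖f t‖ ^ 2 / (t - a + ε) ^ 2) (Icc a (a + L)) := by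
    refine ContinuousOn.div (by fun_prop) (by fun_prop) fun t ht => ?_
    have : 0 < t - a + ε := by linarith [ht.1]
    positivity
  have hi1 : IntegrableOn (fun t => ‖f t‖ ^ 2 / (t - a + ε) ^ 2) (Ioc a (a + L)) :=
    hc1.integrableOn_Icc.mono_set Ioc_subset_Icc_self
  have hi2 : IntegrableOn (fun t => ‖f' t‖ ^ 2) (Ioc a (a + L)) :=
    (by fun_prop : Continuous fun t => ‖f' t‖ ^ 2).integrableOn_Icc.mono_set Ioc_subset_Icc_self
  rw [← ofReal_integral_eq_lintegral_ofReal hi1 (Filter.Eventually.of_forall fun t => by positivity)]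
  refine (ENNReal.ofReal_le_ofReal key).trans ?_
  rw [ENNReal.ofReal_mul (by norm_num), ofReal_integral_eq_lintegral_ofReal hi2
    (Filter.Eventually.of_forall fun t => by positivity)]
  norm_num
  exact mul_le_mul_right (setLIntegral_le_lintegral _ _) _

end OneDimensional

/-! ### Boundary charts of a Lipschitz domain -/

section Charts

variable {ω : Set Plane}

/-- The distance to the complement of `ω`. It agrees with the distance to the boundary on `ω`, and
vanishes outside `ω`. -/
def complDist (ω : Set Plane) (x : Plane) : ℝ := Metric.infDist x ωᶜ

theorem lipschitzWith_complDist (ω : Set Plane) : LipschitzWith 1 (complDist ω) :=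
  Metric.lipschitz_infDist_pt _

theorem continuous_complDist (ω : Set Plane) : Continuous (complDist ω) :=
  (lipschitzWith_complDist ω).continuous

theorem complDist_nonneg (x : Plane) : 0 ≤ complDist ω x := Metric.infDist_nonneg

theorem compl_nonempty_of_isBounded (hbdd : Bornology.IsBounded ω) : ωᶜ.Nonempty := by
  rw [nonempty_compl]
  rintro rfl
  exact NormedSpace.unbounded_univ ℝ Plane hbdd

theorem complDist_pos (hopen : IsOpen ω) (hbdd : Bornology.IsBounded ω) {x : Plane} (hx : x ∈ ω) :
    0 < complDist ω x :=
  (hopen.isClosed_compl.notMem_iff_infDist_pos (compl_nonempty_of_isBounded hbdd)).1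
    (not_not.2 hx)

theorem complDist_eq_zero {x : Plane} (hx : x ∉ ω) : complDist ω x = 0 :=
  Metric.infDist_zero_of_mem hx

theorem mem_of_complDist_pos {x : Plane} (hx : 0 < complDist ω x) : x ∈ ω := by
  by_contra h
  exact hx.ne' (complDist_eq_zero h)

theorem frontier_subset_compl (hopen : IsOpen ω) : frontier ω ⊆ ωᶜ := fun x hx => by
  rw [hopen.frontier_eq] at hx
  exact hx.2

theorem bdryDist_eq_complDist (hopen : IsOpen ω) (hbdd : Bornology.IsBounded ω) {x : Plane}
    (hx : x ∈ ω) : bdryDist ω x = complDist ω x := by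
  have hne : ω ≠ univ := fun h => by
    have := compl_nonempty_of_isBounded hbdd
    rw [h, compl_univ] at this
    exact not_nonempty_empty this
  obtain ⟨y, hy, hxy⟩ := exists_mem_frontier_infDist_compl_eq_dist hx hne
  refine le_antisymm ?_ (Metric.infDist_le_infDist_of_subset (frontier_subset_compl hopen) ⟨y, hy⟩)
  rw [complDist, hxy]
  exact Metric.infDist_le_dist_of_mem hy

theorem exists_complDist_le (hbdd : Bornology.IsBounded ω) : ∃ M, ∀ x, complDist ω x ≤ M := by
  obtain ⟨z, hz⟩ := compl_nonempty_of_isBounded hbdd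
  obtain ⟨R, hR⟩ := hbdd.subset_closedBall z
  refine ⟨max R 0, fun x => ?_⟩
  by_cases hx : x ∈ ω
  · exact (Metric.infDist_le_dist_of_mem hz).trans ((hR hx).trans (le_max_left _ _))
  · rw [complDist_eq_zero hx]
    exact le_max_right _ _

theorem abs_apply_sub_apply_le (e : Plane ≃ₗᵢ[ℝ] Plane) (x y : Plane) (i : Fin 2) :
    |e x i - e y i| ≤ dist x y := by
  rw [← e.dist_map, dist_eq_norm, ← PiLp.sub_apply, ← Real.norm_eq_abs]
  exact PiLp.norm_apply_le _ i

/-- Near a boundary point, the height above the boundary graph is comparable to the distance to the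
complement. -/
theorem exists_chart (hopen : IsOpen ω) (hlip : HasLipschitzBoundary ω) {p : Plane}
    (hp : p ∈ frontier ω) :
    ∃ (ρ : ℝ) (e : Plane ≃ₗᵢ[ℝ] Plane) (g : ℝ → ℝ) (K : ℝ≥0) (L : ℝ), 0 < ρ ∧ Continuous g ∧
      0 ≤ L ∧ ∀ x ∈ Metric.ball p ρ ∩ ω, g (e x 0) < e x 1 ∧ e x 1 ≤ g (e x 0) + L ∧
        framePoint e (e x 0) (g (e x 0)) ∉ ω ∧
        e x 1 - g (e x 0) ≤ (1 + K) * complDist ω x := by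
  obtain ⟨e, K, g, r, hr, hg, hω⟩ := hlip p hp
  have hpω : p ∈ ωᶜ := frontier_subset_compl hopen hp
  have hK : (0 : ℝ) ≤ K := K.2
  have hρ : 0 < r / (2 + K) := by positivity
  have hρr : (2 + K) * (r / (2 + K)) = r := mul_div_cancel₀ _ (by positivity)
  set ρ := r / (2 + K)
  have hρle : ρ ≤ r := by nlinarith
  have hheight : ∀ x q, q ∈ ωᶜ → q ∈ Metric.ball p r →
      e x 1 - g (e x 0) ≤ (1 + K) * dist x q := by
    intro x q hq hqr
    have h1 : e q 1 ≤ g (e q 0) := not_lt.1 fun h => hq ((hω q hqr).2 h)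
    have h2 := (le_abs_self _).trans (abs_apply_sub_apply_le e x q 1)
    have h3 := (le_abs_self _).trans (Real.dist_eq _ _ ▸ hg.dist_le_mul (e q 0) (e x 0))
    have h4 : dist (e q 0) (e x 0) ≤ dist x q := by
      rw [dist_comm, Real.dist_eq]
      exact abs_apply_sub_apply_le e x q 0
    nlinarith
  refine ⟨ρ, e, g, K, (1 + K) * ρ, hρ, hg.continuous, by positivity, fun x hx => ?_⟩
  have hxp : dist x p < ρ := hx.1
  have h1 : g (e x 0) < e x 1 := (hω x (Metric.ball_subset_ball hρle hx.1)).1 hx.2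
  have h2 := hheight x p hpω (Metric.mem_ball_self hr)
  have h3 : e x 1 - g (e x 0) ≤ (1 + K) * ρ := h2.trans (by gcongr)
  refine ⟨h1, by linarith, ?_, ?_⟩
  · have hd : dist (framePoint e (e x 0) (g (e x 0))) x ≤ (1 + K) * ρ := by
      have hd' := dist_framePoint e (e x 0) (g (e x 0)) (e x 1)
      rw [framePoint_apply, abs_sub_comm, abs_of_pos (by linarith)] at hd'
      exact hd'.trans_le h3
    have hb : framePoint e (e x 0) (g (e x 0)) ∈ Metric.ball p r := by
      rw [Metric.mem_ball]
      calc dist (framePoint e (e x 0) (g (e x 0))) p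
          ≤ dist (framePoint e (e x 0) (g (e x 0))) x + dist x p := dist_triangle _ _ _
        _ < (1 + K) * ρ + ρ := by linarith
        _ = r := by rw [← hρr]; ring
    rw [hω _ hb, apply_framePoint]
    simp
  · rw [← div_le_iff₀' (by positivity), complDist, Metric.le_infDist ⟨p, hpω⟩]
    intro q hq
    rw [div_le_iff₀' (by positivity)]
    by_cases hqr : q ∈ Metric.ball p r
    · exact hheight x q hq hqr
    · refine h2.trans ?_
      have h5 : r ≤ dist q p := not_lt.1 hqr
      have h6 := dist_triangle q x p
      rw [dist_comm q x] at h6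
      have h7 : dist x p ≤ dist x q := by nlinarith
      gcongr

end Charts

/-! ### The Hardy inequality on a Lipschitz domain -/

section Hardy

variable {ω : Set Plane}

/-- Hardy's inequality in a chart, for functions vanishing on the graph of `g`. -/
theorem lintegral_chart_le {S : Set Plane} (hS : MeasurableSet S) (e : Plane ≃ₗᵢ[ℝ] Plane)
    {g : ℝ → ℝ} (hg : Continuous g) {L : ℝ} (hL : 0 ≤ L)
    (h : ∀ x ∈ S, g (e x 0) < e x 1 ∧ e x 1 ≤ g (e x 0) + L ∧
      framePoint e (e x 0) (g (e x 0)) ∉ ω)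
    {φ : Plane → ℂ} (hφ : IsTestFunction ω φ) {ε : ℝ} (hε : 0 < ε) :
    ∫⁻ x in S, ENNReal.ofReal (‖φ x‖ ^ 2 / (e x 1 - g (e x 0) + ε) ^ 2) ≤
      4 * ∫⁻ x, ENNReal.ofReal (gradSq φ x) := by
  have hφc := hφ.contDiff.continuous
  have hm : Measurable fun x => ENNReal.ofReal (‖φ x‖ ^ 2 / (e x 1 - g (e x 0) + ε) ^ 2) := by
    refine Measurable.ennreal_ofReal (Measurable.div (by fun_prop) ?_)
    exact Continuous.measurable (by fun_prop)
  rw [← lintegral_indicator hS, lintegral_eq_lintegral_framePoint e (hm.indicator hS),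
    lintegral_eq_lintegral_framePoint e hφ.continuous_gradSq.measurable.ennreal_ofReal,
    ← lintegral_const_mul' _ _ (by norm_num)]
  refine lintegral_mono fun s => ?_
  by_cases hs : ∃ y, framePoint e s y ∈ S
  · obtain ⟨y, hy⟩ := hs
    have h0 : framePoint e s (g s) ∉ ω := by
      have := (h _ hy).2.2
      rwa [apply_framePoint] at this
    set n : Plane := e.symm (EuclideanSpace.single 1 1)
    have hn : ‖n‖ = 1 := by simp [n]
    have hder : ∀ y, HasDerivAt (fun y => φ (framePoint e s y))
        (fderiv ℝ φ (framePoint e s y) n) y := fun y =>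
      (hφ.contDiff.differentiable (by simp) _).hasFDerivAt.comp_hasDerivAt y
        (hasDerivAt_framePoint e s y)
    have hcont : Continuous (framePoint e s) :=
      continuous_iff_continuousAt.2 fun y => (hasDerivAt_framePoint e s y).continuousAt
    have key := lintegral_norm_sq_div_le hder
      ((hφ.continuous_fderiv_apply (v := fun _ => n) continuous_const).comp hcont) (a := g s)
      (hφ.apply_eq_zero h0) hε hL
    calc _ ≤ ∫⁻ y in Ioc (g s) (g s + L),
          ENNReal.ofReal (‖φ (framePoint e s y)‖ ^ 2 / (y - g s + ε) ^ 2) := by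
          rw [← lintegral_indicator measurableSet_Ioc]
          refine lintegral_mono fun y => ?_
          by_cases hyS : framePoint e s y ∈ S
          · have h1 := h _ hyS
            rw [apply_framePoint] at h1
            rw [indicator_of_mem hyS, indicator_of_mem (show y ∈ Ioc (g s) (g s + L) from
              ⟨by simpa using h1.1, by simpa using h1.2.1⟩), apply_framePoint]
            simp
          · rw [indicator_of_notMem hyS]
            exact zero_le
      _ ≤ 4 * ∫⁻ y, ENNReal.ofReal (‖fderiv ℝ φ (framePoint e s y) n‖ ^ 2) := key
      _ ≤ _ := by
          gcongr
          exact norm_fderiv_apply_sq_le φ _ n hn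
  · push Not at hs
    have : ∀ y, S.indicator (fun x => ENNReal.ofReal
        (‖φ x‖ ^ 2 / (e x 1 - g (e x 0) + ε) ^ 2)) (framePoint e s y) = 0 := fun y =>
      indicator_of_notMem (hs y) _
    simp [this]

theorem IsTestFunction.exists_le_complDist (hopen : IsOpen ω) (hbdd : Bornology.IsBounded ω)
    {φ : Plane → ℂ} (hφ : IsTestFunction ω φ) :
    ∃ ε > 0, ∀ x ∈ tsupport φ, ε ≤ complDist ω x := by
  rcases (tsupport φ).eq_empty_or_nonempty with h | h
  · exact ⟨1, one_pos, fun x hx => by simp [h] at hx⟩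
  · obtain ⟨x, hx, hmin⟩ := hφ.hasCompactSupport.isCompact.exists_isMinOn h
      (continuous_complDist ω).continuousOn
    exact ⟨_, complDist_pos hopen hbdd (hφ.tsupport_subset hx), fun y hy => hmin hy⟩

theorem norm_div_sq_le {a h ε c d : ℝ} (hh : 0 < h + ε) (hd : 0 ≤ d) (hle : h + ε ≤ c * d) :
    (a / d) ^ 2 ≤ c ^ 2 * (a ^ 2 / (h + ε) ^ 2) := by
  have hd' : 0 < d := by
    rcases hd.eq_or_lt with rfl | h'
    · linarith [mul_zero c]
    · exact h'
  rw [div_pow, ← mul_div_assoc, div_le_div_iff₀ (by positivity) (by positivity)]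
  have : (h + ε) ^ 2 ≤ (c * d) ^ 2 := pow_le_pow_left₀ hh.le hle 2
  nlinarith [mul_le_mul_of_nonneg_left this (sq_nonneg a)]

/-- Hardy's inequality near a point of the closure. At interior points a chart with a line outside
`ω` as its graph is used. -/
theorem exists_hardy_nhds (hopen : IsOpen ω) (hbdd : Bornology.IsBounded ω)
    (hlip : HasLipschitzBoundary ω) {p : Plane} (hp : p ∈ closure ω) :
    ∃ ρ > 0, ∃ C : ℝ≥0, ∀ φ, IsTestFunction ω φ →
      ∫⁻ x in Metric.ball p ρ ∩ ω, ENNReal.ofReal ((‖φ x‖ / complDist ω x) ^ 2) ≤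
        C * ∫⁻ x, ENNReal.ofReal (gradSq φ x) := by
  -- it suffices to compare the distance to the complement with the height in a chart
  have reduce : ∀ (ρ : ℝ) (e : Plane ≃ₗᵢ[ℝ] Plane) (g : ℝ → ℝ) (L c : ℝ), Continuous g → 0 ≤ L →
      (∀ x ∈ Metric.ball p ρ ∩ ω, g (e x 0) < e x 1 ∧ e x 1 ≤ g (e x 0) + L ∧
        framePoint e (e x 0) (g (e x 0)) ∉ ω) → ∀ φ, IsTestFunction ω φ →
      (∃ ε > 0, ∀ x ∈ Metric.ball p ρ ∩ ω, φ x ≠ 0 →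
        e x 1 - g (e x 0) + ε ≤ c * complDist ω x) →
      ∫⁻ x in Metric.ball p ρ ∩ ω, ENNReal.ofReal ((‖φ x‖ / complDist ω x) ^ 2) ≤
        (Real.toNNReal (c ^ 2) * 4 : ℝ≥0) * ∫⁻ x, ENNReal.ofReal (gradSq φ x) := by
    rintro ρ e g L c hg hL h φ hφ ⟨ε, hε, hle⟩
    have hS : MeasurableSet (Metric.ball p ρ ∩ ω) := Metric.isOpen_ball.measurableSet.inter
      hopen.measurableSet
    have key := lintegral_chart_le hS e hg hL h hφ hε
    calc _ ≤ ∫⁻ x in Metric.ball p ρ ∩ ω, ENNReal.ofReal (c ^ 2) *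
          ENNReal.ofReal (‖φ x‖ ^ 2 / (e x 1 - g (e x 0) + ε) ^ 2) := by
          refine setLIntegral_mono' hS fun x hx => ?_
          rw [← ENNReal.ofReal_mul (sq_nonneg c)]
          refine ENNReal.ofReal_le_ofReal ?_
          by_cases h0 : φ x = 0
          · simp [h0]
          · exact norm_div_sq_le (by linarith [(h x hx).1]) (complDist_nonneg x) (hle x hx h0)
      _ = ENNReal.ofReal (c ^ 2) * _ := lintegral_const_mul' _ _ ENNReal.ofReal_ne_top
      _ ≤ ENNReal.ofReal (c ^ 2) * (4 * ∫⁻ x, ENNReal.ofReal (gradSq φ x)) := by gcongr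
      _ = _ := by
          rw [← mul_assoc]
          rfl
  by_cases hpω : p ∈ ω
  · have hη := complDist_pos hopen hbdd hpω
    set η := complDist ω p
    obtain ⟨R, hR0, hR⟩ := hbdd.subset_ball_lt 0 0
    refine ⟨η / 2, by positivity, _, fun φ hφ => reduce (η / 2) (LinearIsometryEquiv.refl ℝ Plane)
      (fun _ => -R) (2 * R) (2 * (2 * R + 1) / η) continuous_const (by positivity) ?_ φ hφ
      ⟨1, one_pos, fun x hx _ => ?_⟩⟩
    · intro x hx
      have h1 : ‖x‖ < R := by simpa using hR hx.2
      have h2 : |x 1| ≤ ‖x‖ := by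
        rw [← Real.norm_eq_abs]
        exact PiLp.norm_apply_le x 1
      have h3 := abs_le.1 (h2.trans h1.le)
      have h4 := abs_lt.1 (h2.trans_lt h1)
      refine ⟨by simpa using h4.1, by simp; linarith, fun hmem => ?_⟩
      have h5 : ‖framePoint (LinearIsometryEquiv.refl ℝ Plane) (x 0) (-R)‖ < R := by
        simpa using hR hmem
      have h6 : |(-R : ℝ)| ≤ ‖framePoint (LinearIsometryEquiv.refl ℝ Plane) (x 0) (-R)‖ := by
        rw [← Real.norm_eq_abs]
        exact PiLp.norm_apply_le (framePoint (LinearIsometryEquiv.refl ℝ Plane) (x 0) (-R)) 1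
      rw [abs_neg, abs_of_pos hR0] at h6
      linarith
    · have h1 : ‖x‖ < R := by simpa using hR hx.2
      have h2 : |x 1| ≤ ‖x‖ := by
        rw [← Real.norm_eq_abs]
        exact PiLp.norm_apply_le x 1
      have h3 := (abs_le.1 (h2.trans h1.le)).2
      have h4 : η / 2 ≤ complDist ω x := by
        have := (lipschitzWith_complDist ω).dist_le_mul p x
        have h5 : dist x p < η / 2 := hx.1
        rw [NNReal.coe_one, one_mul, Real.dist_eq, dist_comm] at this
        have h6 := (le_abs_self _).trans this
        linarith
      have h5 : 2 * (2 * R + 1) / η * (η / 2) = 2 * R + 1 := by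
        field_simp
      have h6 : 2 * (2 * R + 1) / η * (η / 2) ≤ 2 * (2 * R + 1) / η * complDist ω x := by gcongr
      simp only [LinearIsometryEquiv.coe_refl, id]
      linarith
  · have hpf : p ∈ frontier ω := by
      rw [hopen.frontier_eq]
      exact ⟨hp, hpω⟩
    obtain ⟨ρ, e, g, K, L, hρ, hg, hL, h⟩ := exists_chart hopen hlip hpf
    refine ⟨ρ, hρ, _, fun φ hφ => reduce ρ e g L (2 + K) hg hL
      (fun x hx => ⟨(h x hx).1, (h x hx).2.1, (h x hx).2.2.1⟩) φ hφ ?_⟩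
    obtain ⟨ε, hε, hle⟩ := hφ.exists_le_complDist hopen hbdd
    refine ⟨ε, hε, fun x hx h0 => ?_⟩
    linarith [(h x hx).2.2.2, hle x (subset_tsupport φ h0)]

/-- Hardy's inequality with some constant, by compactness of the closure of `ω`. -/
theorem exists_hardy (hopen : IsOpen ω) (hbdd : Bornology.IsBounded ω)
    (hlip : HasLipschitzBoundary ω) :
    ∃ C : ℝ≥0, ∀ φ, IsTestFunction ω φ →
      ∫⁻ x in ω, ENNReal.ofReal ((‖φ x‖ / complDist ω x) ^ 2) ≤
        C * ∫⁻ x, ENNReal.ofReal (gradSq φ x) := by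
  have hcomp : IsCompact (closure ω) := hbdd.isCompact_closure
  have key := hcomp.induction_on (p := fun S => ∃ C : ℝ≥0, ∀ φ, IsTestFunction ω φ →
      ∫⁻ x in S ∩ ω, ENNReal.ofReal ((‖φ x‖ / complDist ω x) ^ 2) ≤
        C * ∫⁻ x, ENNReal.ofReal (gradSq φ x)) ?_ ?_ ?_ ?_
  · obtain ⟨C, hC⟩ := key
    refine ⟨C, fun φ hφ => ?_⟩
    have := hC φ hφ
    rwa [inter_eq_right.2 subset_closure] at this
  · exact ⟨0, fun φ _ => by simp⟩
  · rintro s t hst ⟨C, hC⟩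
    exact ⟨C, fun φ hφ => (lintegral_mono_set (inter_subset_inter_left _ hst)).trans (hC φ hφ)⟩
  · rintro s t ⟨C, hC⟩ ⟨D, hD⟩
    refine ⟨C + D, fun φ hφ => ?_⟩
    rw [union_inter_distrib_right, ENNReal.coe_add, add_mul]
    exact (lintegral_union_le _ _ _).trans (add_le_add (hC φ hφ) (hD φ hφ))
  · intro x hx
    obtain ⟨ρ, hρ, C, hC⟩ := exists_hardy_nhds hopen hbdd hlip hx
    exact ⟨_, mem_nhdsWithin_of_mem_nhds (Metric.ball_mem_nhds x hρ), C, hC⟩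

end Hardy

/-! ### Positivity of the Hardy quotients -/

section Quotient

variable {ω : Set Plane}

/-- The infimum `c⁻²` of the Hardy quotients. -/
def hardyInf (ω : Set Plane) : ℝ :=
  sInf {q : ℝ | ∃ φ : Plane → ℂ, IsTestFunction ω φ ∧ φ ≠ 0 ∧ q = hardyQuotient ω φ}

theorem hardyQuotient_nonneg (φ : Plane → ℂ) : 0 ≤ hardyQuotient ω φ :=
  div_nonneg (integral_nonneg fun x => gradSq_nonneg φ x) (integral_nonneg fun _ => sq_nonneg _)

theorem hardyInf_nonneg : 0 ≤ hardyInf ω := by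
  refine Real.sInf_nonneg ?_
  rintro q ⟨φ, -, -, rfl⟩
  exact hardyQuotient_nonneg φ

theorem bddBelow_hardyQuotient :
    BddBelow {q : ℝ | ∃ φ : Plane → ℂ, IsTestFunction ω φ ∧ φ ≠ 0 ∧ q = hardyQuotient ω φ} := by
  refine ⟨0, ?_⟩
  rintro q ⟨φ, -, -, rfl⟩
  exact hardyQuotient_nonneg φ

variable (hopen : IsOpen ω) (hbdd : Bornology.IsBounded ω) (hlip : HasLipschitzBoundary ω)

include hopen hbdd hlip

theorem integrableOn_norm_div_sq {φ : Plane → ℂ} (hφ : IsTestFunction ω φ) :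
    IntegrableOn (fun x => (‖φ x‖ / complDist ω x) ^ 2) ω := by
  have hm : Measurable fun x => (‖φ x‖ / complDist ω x) ^ 2 :=
    (hφ.contDiff.continuous.norm.measurable.div (continuous_complDist ω).measurable).pow_const 2
  refine ⟨hm.aestronglyMeasurable, ?_⟩
  rw [hasFiniteIntegral_iff_ofReal (Filter.Eventually.of_forall fun x => sq_nonneg _)]
  obtain ⟨C, hC⟩ := exists_hardy hopen hbdd hlip
  refine (hC φ hφ).trans_lt (ENNReal.mul_lt_top ENNReal.coe_lt_top ?_)
  exact (hasFiniteIntegral_iff_ofReal (Filter.Eventually.of_forall fun x => gradSq_nonneg φ x)).1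
    hφ.integrable_gradSq.2

omit hlip in
theorem setIntegral_bdryDist_eq (φ : Plane → ℂ) :
    ∫ x in ω, (‖φ x‖ / bdryDist ω x) ^ 2 = ∫ x in ω, (‖φ x‖ / complDist ω x) ^ 2 :=
  setIntegral_congr_fun hopen.measurableSet fun x hx => by
    simp only [bdryDist_eq_complDist hopen hbdd hx]

omit hopen hbdd hlip in
theorem IsTestFunction.setIntegral_gradSq {φ : Plane → ℂ} (hφ : IsTestFunction ω φ) :
    ∫ x in ω, gradSq φ x = ∫ x, gradSq φ x := by
  refine setIntegral_eq_integral_of_forall_compl_eq_zero fun x hx => ?_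
  have h1 : x ∉ tsupport φ := fun h => hx (hφ.tsupport_subset h)
  have h2 : fderiv ℝ φ x = 0 := by
    by_contra h
    exact h1 (support_fderiv_subset ℝ h)
  simp [gradSq, planePartial, h2]

omit hlip in
/-- Hardy's inequality with the constant `c⁻²` of the definition. -/
theorem hardyInf_mul_le {φ : Plane → ℂ} (hφ : IsTestFunction ω φ) :
    hardyInf ω * ∫ x in ω, (‖φ x‖ / complDist ω x) ^ 2 ≤ ∫ x in ω, gradSq φ x := by
  by_cases h0 : φ = 0
  · have : ∀ x, (‖φ x‖ / complDist ω x) ^ 2 = 0 := fun x => by simp [h0]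
    simp only [this, integral_zero, mul_zero]
    exact integral_nonneg fun x => gradSq_nonneg φ x
  · have h1 : hardyInf ω ≤ hardyQuotient ω φ := csInf_le bddBelow_hardyQuotient ⟨φ, hφ, h0, rfl⟩
    rw [hardyQuotient, setIntegral_bdryDist_eq hopen hbdd] at h1
    have hD : 0 ≤ ∫ x in ω, (‖φ x‖ / complDist ω x) ^ 2 := integral_nonneg fun _ => sq_nonneg _
    rcases hD.eq_or_lt with h | h
    · rw [← h, mul_zero]
      exact integral_nonneg fun x => gradSq_nonneg φ x
    · exact (le_div_iff₀ h).1 h1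

theorem setIntegral_norm_div_sq_pos {φ : Plane → ℂ} (hφ : IsTestFunction ω φ) (h0 : φ ≠ 0) :
    0 < ∫ x in ω, (‖φ x‖ / complDist ω x) ^ 2 := by
  have hD : 0 ≤ ∫ x in ω, (‖φ x‖ / complDist ω x) ^ 2 := integral_nonneg fun _ => sq_nonneg _
  refine hD.lt_of_ne' fun h => h0 ?_
  rw [setIntegral_eq_zero_iff_of_nonneg_ae (Filter.Eventually.of_forall fun _ => sq_nonneg _)
    (integrableOn_norm_div_sq hopen hbdd hlip hφ)] at h
  have h1 : φ =ᵐ[volume] 0 := by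
    filter_upwards [(ae_restrict_iff' hopen.measurableSet).1 h] with x hx
    by_cases hxω : x ∈ ω
    · have h2 := hx hxω
      have h3 := (complDist_pos hopen hbdd hxω).ne'
      simpa [h3] using h2
    · exact hφ.apply_eq_zero hxω
  exact (hφ.contDiff.continuous.ae_eq_iff_eq volume continuous_const).1 h1

/-- The Hardy constant is finite. -/
theorem hardyInf_pos (hne : ω.Nonempty) : 0 < hardyInf ω := by
  obtain ⟨C, hC⟩ := exists_hardy hopen hbdd hlip
  have hC0 : (0 : ℝ) ≤ C := C.2
  have hpos : (0 : ℝ) < 1 / (C + 1) := by positivity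
  refine hpos.trans_le (le_csInf ?_ ?_)
  · obtain ⟨x, hx⟩ := hne
    obtain ⟨f, hfs, hfc, hfd, -, hf1⟩ := exists_contDiff_tsupport_subset (n := ⊤)
      (hopen.mem_nhds hx)
    have hsupp : Function.support (fun x => (f x : ℂ)) = Function.support f := by
      ext x
      simp
    refine ⟨_, fun x => (f x : ℂ), ⟨Complex.ofRealCLM.contDiff.comp hfd,
      hfc.comp_left Complex.ofReal_zero, by rwa [tsupport, hsupp]⟩, fun h => ?_, rfl⟩
    have := congrFun h x
    simp [hf1] at this
  · rintro q ⟨φ, hφ, h0, rfl⟩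
    have hD := setIntegral_norm_div_sq_pos hopen hbdd hlip hφ h0
    have hle : ∫ x in ω, (‖φ x‖ / complDist ω x) ^ 2 ≤ C * ∫ x in ω, gradSq φ x := by
      have h1 := hC φ hφ
      rw [← ofReal_integral_eq_lintegral_ofReal (integrableOn_norm_div_sq hopen hbdd hlip hφ)
        (Filter.Eventually.of_forall fun _ => sq_nonneg _),
        ← ofReal_integral_eq_lintegral_ofReal hφ.integrable_gradSq
        (Filter.Eventually.of_forall fun x => gradSq_nonneg φ x), ← ENNReal.ofReal_coe_nnreal,
        ← ENNReal.ofReal_mul hC0, ENNReal.ofReal_le_ofReal_iff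
        (mul_nonneg hC0 (integral_nonneg fun x => gradSq_nonneg φ x))] at h1
      rwa [hφ.setIntegral_gradSq]
    have hN : 0 ≤ ∫ x in ω, gradSq φ x := integral_nonneg fun x => gradSq_nonneg φ x
    rw [hardyQuotient, setIntegral_bdryDist_eq hopen hbdd, div_le_div_iff₀ (by positivity) hD]
    change _ ≤ (∫ x in ω, gradSq φ x) * _
    linarith

end Quotient

/-! ### Integrability of negative powers of the distance -/

section NegativePowers

variable {ω : Set Plane}

/-- In a chart, negative powers `t ^ (-q)`, `q < 1`, of the height are integrable. -/
theorem lintegral_chart_rpow_lt_top {S : Set Plane} (hS : MeasurableSet S)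
    (e : Plane ≃ₗᵢ[ℝ] Plane) {g : ℝ → ℝ} (hg : Continuous g) {L : ℝ} (hL : 0 ≤ L) {p : Plane}
    {ρ : ℝ} (hSρ : S ⊆ Metric.ball p ρ)
    (h : ∀ x ∈ S, g (e x 0) < e x 1 ∧ e x 1 ≤ g (e x 0) + L) {q : ℝ} (hq : q < 1) :
    ∫⁻ x in S, ENNReal.ofReal ((e x 1 - g (e x 0)) ^ (-q)) < ⊤ := by
  have hm : Measurable fun x => ENNReal.ofReal ((e x 1 - g (e x 0)) ^ (-q)) :=
    ((Continuous.measurable (by fun_prop : Continuous fun x => e x 1 - g (e x 0))).pow_const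
      _).ennreal_ofReal
  set J := ∫⁻ t in Ioc 0 L, ENNReal.ofReal (t ^ (-q)) with hJ
  have hJtop : J < ⊤ := by
    have hi : IntegrableOn (fun t : ℝ => t ^ (-q)) (Ioc 0 L) := by
      rw [← intervalIntegrable_iff_integrableOn_Ioc_of_le hL]
      exact intervalIntegral.intervalIntegrable_rpow' (by linarith)
    exact hi.setLIntegral_lt_top
  rw [← lintegral_indicator hS, lintegral_eq_lintegral_framePoint e (hm.indicator hS)]
  calc _ ≤ ∫⁻ s, (Icc (e p 0 - ρ) (e p 0 + ρ)).indicator (fun _ => J) s := by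
        refine lintegral_mono fun s => ?_
        by_cases hs : ∃ y, framePoint e s y ∈ S
        · obtain ⟨y, hy⟩ := hs
          have hs' : s ∈ Icc (e p 0 - ρ) (e p 0 + ρ) := by
            have h1 := abs_apply_sub_apply_le e (framePoint e s y) p 0
            have h2 : dist (framePoint e s y) p < ρ := hSρ hy
            rw [apply_framePoint] at h1
            have h3 := abs_le.1 (h1.trans h2.le)
            simp only [Matrix.cons_val_zero] at h3
            exact ⟨by linarith, by linarith⟩
          rw [indicator_of_mem hs']
          have hshift : J = ∫⁻ y in Ioc (g s) (g s + L), ENNReal.ofReal ((y - g s) ^ (-q)) := by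
            have hmp := measurePreserving_sub_right (volume : Measure ℝ) (g s)
            have := hmp.setLIntegral_comp_preimage (measurableSet_Ioc (a := (0 : ℝ)) (b := L))
              (f := fun t => ENNReal.ofReal (t ^ (-q)))
              (measurable_id.pow_const _).ennreal_ofReal
            rw [hJ, ← this]
            congr 2
            ext y
            simp only [mem_preimage, mem_Ioc]
            constructor <;> rintro ⟨a, b⟩ <;> constructor <;> linarith
          rw [hshift, ← lintegral_indicator measurableSet_Ioc]
          refine lintegral_mono fun y => ?_
          by_cases hyS : framePoint e s y ∈ S
          · have h1 := h _ hyS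
            rw [apply_framePoint] at h1
            rw [indicator_of_mem hyS, indicator_of_mem (show y ∈ Ioc (g s) (g s + L) from
              ⟨by simpa using h1.1, by simpa using h1.2⟩), apply_framePoint]
            simp
          · rw [indicator_of_notMem hyS]
            exact zero_le
        · push Not at hs
          have : ∀ y, S.indicator (fun x => ENNReal.ofReal
              ((e x 1 - g (e x 0)) ^ (-q))) (framePoint e s y) = 0 := fun y =>
            indicator_of_notMem (hs y) _
          simp [this]
    _ = J * volume (Icc (e p 0 - ρ) (e p 0 + ρ)) := by
        rw [lintegral_indicator measurableSet_Icc, lintegral_const, Measure.restrict_apply_univ]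
    _ < ⊤ := ENNReal.mul_lt_top hJtop (by simp)

variable (hopen : IsOpen ω) (hbdd : Bornology.IsBounded ω) (hlip : HasLipschitzBoundary ω)

include hopen hbdd hlip

theorem exists_lintegral_rpow_nhds {q : ℝ} (hq0 : 0 < q) (hq : q < 1) {p : Plane}
    (hp : p ∈ closure ω) :
    ∃ ρ > 0, ∫⁻ x in Metric.ball p ρ ∩ ω, ENNReal.ofReal (complDist ω x ^ (-q)) < ⊤ := by
  have hm : ∀ ρ, MeasurableSet (Metric.ball p ρ ∩ ω) := fun ρ =>
    Metric.isOpen_ball.measurableSet.inter hopen.measurableSet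
  by_cases hpω : p ∈ ω
  · have hη := complDist_pos hopen hbdd hpω
    set η := complDist ω p
    refine ⟨η / 2, by positivity, ?_⟩
    calc _ ≤ ∫⁻ x in Metric.ball p (η / 2) ∩ ω, ENNReal.ofReal ((η / 2) ^ (-q)) := by
          refine setLIntegral_mono' (hm _) fun x hx => ENNReal.ofReal_le_ofReal ?_
          refine Real.rpow_le_rpow_of_nonpos (by positivity) ?_ (by linarith)
          have := (lipschitzWith_complDist ω).dist_le_mul p x
          have h5 : dist x p < η / 2 := hx.1
          rw [NNReal.coe_one, one_mul, Real.dist_eq, dist_comm] at this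
          have h6 := (le_abs_self _).trans this
          linarith
      _ = ENNReal.ofReal ((η / 2) ^ (-q)) * volume (Metric.ball p (η / 2) ∩ ω) := by
          rw [lintegral_const, Measure.restrict_apply_univ]
      _ < ⊤ := ENNReal.mul_lt_top ENNReal.ofReal_lt_top
          ((measure_mono inter_subset_left).trans_lt measure_ball_lt_top)
  · have hpf : p ∈ frontier ω := by
      rw [hopen.frontier_eq]
      exact ⟨hp, hpω⟩
    obtain ⟨ρ, e, g, K, L, hρ, hg, hL, h⟩ := exists_chart hopen hlip hpf
    refine ⟨ρ, hρ, ?_⟩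
    have hK : (0 : ℝ) < 1 + K := by have : (0 : ℝ) ≤ K := K.2; linarith
    have key := lintegral_chart_rpow_lt_top (hm ρ) e hg hL inter_subset_left
      (fun x hx => ⟨(h x hx).1, (h x hx).2.1⟩) hq
    calc _ ≤ ∫⁻ x in Metric.ball p ρ ∩ ω, ENNReal.ofReal ((1 + K) ^ q) *
          ENNReal.ofReal ((e x 1 - g (e x 0)) ^ (-q)) := by
          refine setLIntegral_mono' (hm _) fun x hx => ?_
          have h1 : 0 < e x 1 - g (e x 0) := by linarith [(h x hx).1]
          rw [← ENNReal.ofReal_mul (by positivity)]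
          refine ENNReal.ofReal_le_ofReal ?_
          have h2 : (e x 1 - g (e x 0)) / (1 + K) ≤ complDist ω x :=
            (div_le_iff₀' hK).2 (h x hx).2.2.2
          refine (Real.rpow_le_rpow_of_nonpos (by positivity) h2 (by linarith)).trans (le_of_eq ?_)
          rw [Real.div_rpow h1.le hK.le, Real.rpow_neg hK.le, div_inv_eq_mul, mul_comm]
      _ = ENNReal.ofReal ((1 + K) ^ q) * _ := lintegral_const_mul' _ _ ENNReal.ofReal_ne_top
      _ < ⊤ := ENNReal.mul_lt_top ENNReal.ofReal_lt_top key

theorem integrableOn_complDist_rpow {q : ℝ} (hq0 : 0 < q) (hq : q < 1) :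
    IntegrableOn (fun x => complDist ω x ^ (-q)) ω := by
  have hcomp : IsCompact (closure ω) := hbdd.isCompact_closure
  have key := hcomp.induction_on
    (p := fun S => ∫⁻ x in S ∩ ω, ENNReal.ofReal (complDist ω x ^ (-q)) < ⊤) ?_ ?_ ?_ ?_
  · rw [inter_eq_right.2 subset_closure] at key
    refine ⟨((continuous_complDist ω).measurable.pow_const _).aestronglyMeasurable, ?_⟩
    rwa [hasFiniteIntegral_iff_ofReal
      (Filter.Eventually.of_forall fun x => Real.rpow_nonneg (complDist_nonneg x) _)]
  · simp
  · exact fun s t hst ht => (lintegral_mono_set (inter_subset_inter_left _ hst)).trans_lt ht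
  · intro s t hs ht
    rw [union_inter_distrib_right]
    exact (lintegral_union_le _ _ _).trans_lt (ENNReal.add_lt_top.2 ⟨hs, ht⟩)
  · intro x hx
    obtain ⟨ρ, hρ, h⟩ := exists_lintegral_rpow_nhds hopen hbdd hlip hq0 hq hx
    exact ⟨_, mem_nhdsWithin_of_mem_nhds (Metric.ball_mem_nhds x hρ), h⟩

end NegativePowers

/-! ### The Hardy constant is at least two -/

section UpperBound

theorem exists_abs_deriv_smoothTransition_le :
    ∃ B, 0 ≤ B ∧ ∀ t, |deriv Real.smoothTransition t| ≤ B := by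
  have hc : Continuous (deriv Real.smoothTransition) :=
    (Real.smoothTransition.contDiff (n := 1)).continuous_deriv le_rfl
  obtain ⟨B, hB⟩ := (isCompact_Icc (a := (0 : ℝ)) (b := 1)).exists_bound_of_continuousOn
    hc.continuousOn
  refine ⟨max B 0, le_max_right _ _, fun t => ?_⟩
  by_cases ht : t ∈ Icc (0 : ℝ) 1
  · exact (hB t ht).trans (le_max_left _ _)
  · have h0 : deriv Real.smoothTransition t = 0 := by
      rw [mem_Icc, not_and_or, not_le, not_le] at ht
      rcases ht with h | h
      · rw [Filter.EventuallyEq.deriv_eq (f := fun _ => (0 : ℝ))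
          ((eventually_lt_nhds h).mono fun y hy => Real.smoothTransition.zero_of_nonpos hy.le)]
        simp
      · rw [Filter.EventuallyEq.deriv_eq (f := fun _ => (1 : ℝ))
          ((eventually_gt_nhds h).mono fun y hy => Real.smoothTransition.one_of_one_le hy.le)]
        simp
    simp [h0]

/-- The power `t ^ s`, smoothly cut off: it vanishes for `t ≤ 2 * ε` and is `t ^ s` for
`3 * ε ≤ t`. -/
def cutoffPow (ε s t : ℝ) : ℝ := Real.smoothTransition (t / ε - 2) * t ^ s

variable {ε s : ℝ}

theorem cutoffPow_eq_zero (hε : 0 < ε) {t : ℝ} (ht : t ≤ 2 * ε) : cutoffPow ε s t = 0 := by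
  rw [cutoffPow, Real.smoothTransition.zero_of_nonpos, zero_mul]
  have := (div_le_iff₀ hε).2 ht
  linarith

theorem cutoffPow_eq_rpow (hε : 0 < ε) {t : ℝ} (ht : 3 * ε ≤ t) : cutoffPow ε s t = t ^ s := by
  rw [cutoffPow, Real.smoothTransition.one_of_one_le, one_mul]
  have := (le_div_iff₀ hε).2 ht
  linarith

theorem contDiff_cutoffPow (hε : 0 < ε) : ContDiff ℝ ((⊤ : ℕ∞) : WithTop ℕ∞) (cutoffPow ε s) := by
  rw [contDiff_iff_contDiffAt]
  intro t
  rcases lt_or_ge t (2 * ε) with h | h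
  · exact contDiffAt_const.congr_of_eventuallyEq (f := fun _ => (0 : ℝ))
      ((eventually_lt_nhds h).mono fun y hy => cutoffPow_eq_zero hε hy.le)
  · have ht : t ≠ 0 := by have : 0 < t := by linarith
                          exact this.ne'
    refine ContDiffAt.mul ?_ (Real.contDiffAt_rpow_const_of_ne ht)
    exact Real.smoothTransition.contDiff.contDiffAt.comp t (by fun_prop)

theorem deriv_cutoffPow_bounds (hε : 0 < ε) (hs0 : 0 ≤ s) (hs1 : s ≤ 1) {B : ℝ} (hB0 : 0 ≤ B)
    (hB : ∀ t, |deriv Real.smoothTransition t| ≤ B) {t : ℝ} (ht : 0 < t) :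
    |deriv (cutoffPow ε s) t| ≤ (3 * B + 1) * t ^ (s - 1) ∧
      (3 * ε < t → |deriv (cutoffPow ε s) t| ≤ s * t ^ (s - 1)) := by
  have hp : 0 < t ^ (s - 1) := Real.rpow_pos_of_pos ht _
  have hd : HasDerivAt (cutoffPow ε s) (deriv Real.smoothTransition (t / ε - 2) * (1 / ε) * t ^ s +
      Real.smoothTransition (t / ε - 2) * (s * t ^ (s - 1))) t := by
    have h1 : HasDerivAt (fun t : ℝ => t / ε - 2) (1 / ε) t :=
      ((hasDerivAt_id t).div_const ε).sub_const 2
    have h2 := ((Real.smoothTransition.contDiff (n := 1)).differentiable (by simp)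
      (t / ε - 2)).hasDerivAt.comp t h1
    exact h2.mul (Real.hasDerivAt_rpow_const (Or.inl ht.ne'))
  have hlarge : 3 * ε < t → |deriv (cutoffPow ε s) t| ≤ s * t ^ (s - 1) := by
    intro h
    rw [Filter.EventuallyEq.deriv_eq (f := fun t => t ^ s)
      ((eventually_gt_nhds h).mono fun y hy => cutoffPow_eq_rpow hε hy.le),
      (Real.hasDerivAt_rpow_const (Or.inl ht.ne')).deriv, abs_of_nonneg (by positivity)]
  refine ⟨?_, hlarge⟩
  rcases lt_or_ge (3 * ε) t with h | h
  · refine (hlarge h).trans ?_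
    gcongr
    linarith
  · rw [hd.deriv]
    have e1 : t ^ s = t * t ^ (s - 1) := by
      rw [Real.rpow_sub_one ht.ne']
      field_simp
    have hχ0 := Real.smoothTransition.nonneg (t / ε - 2)
    have hχ1 := Real.smoothTransition.le_one (t / ε - 2)
    have h2 : t / ε ≤ 3 := (div_le_iff₀ hε).2 h
    have h2' : 0 ≤ t / ε := by positivity
    refine (abs_add_le _ _).trans ?_
    rw [add_mul]
    gcongr
    · rw [e1, show deriv Real.smoothTransition (t / ε - 2) * (1 / ε) * (t * t ^ (s - 1)) =
        deriv Real.smoothTransition (t / ε - 2) * (t / ε) * t ^ (s - 1) by ring, abs_mul, abs_mul,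
        abs_of_nonneg hp.le, abs_of_nonneg h2', mul_comm 3 B]
      gcongr
      exact hB _
    · rw [abs_of_nonneg (by positivity)]
      nlinarith [mul_nonneg hs0 hp.le, mul_le_mul hs1 le_rfl hp.le zero_le_one]

theorem gradSq_ofReal {f : Plane → ℝ} {x : Plane} (hf : DifferentiableAt ℝ f x) :
    gradSq (fun x => (f x : ℂ)) x = planeDeriv 0 f x ^ 2 + planeDeriv 1 f x ^ 2 := by
  have h : fderiv ℝ (fun x => (f x : ℂ)) x = Complex.ofRealCLM.comp (fderiv ℝ f x) :=
    (Complex.ofRealCLM.hasFDerivAt.comp x hf.hasFDerivAt).fderiv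
  simp [gradSq, planePartial, planeDeriv, h]

theorem planeDeriv_comp {H : ℝ → ℝ} {d : Plane → ℝ} {x : Plane} (i : Fin 2)
    (hH : DifferentiableAt ℝ H (d x)) (hd : DifferentiableAt ℝ d x) :
    planeDeriv i (fun x => H (d x)) x = deriv H (d x) * planeDeriv i d x := by
  have h : fderiv ℝ (fun x => H (d x)) x = deriv H (d x) • fderiv ℝ d x :=
    (hH.hasDerivAt.comp_hasFDerivAt x hd.hasFDerivAt).fderiv
  simp [planeDeriv, h]

variable {ω : Set Plane} (hopen : IsOpen ω) (hbdd : Bornology.IsBounded ω)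
  (hlip : HasLipschitzBoundary ω)

include hopen hbdd hlip

/-- Hardy's inequality for a smoothly cut off `δ ^ s`. The condition `s > 1/2` makes
`δ ^ (2 s - 2)` integrable. -/
theorem hardyInf_mul_setIntegral_rpow_le (hs0 : 1 / 2 < s) (hs1 : s < 1) {B : ℝ} (hB0 : 0 ≤ B)
    (hB : ∀ t, |deriv Real.smoothTransition t| ≤ B) (hε : 0 < ε) :
    hardyInf ω * ((∫ x in ω, complDist ω x ^ (-(2 - 2 * s))) -
        ∫ x in ω ∩ {x | complDist ω x ≤ 3 * ε}, complDist ω x ^ (-(2 - 2 * s))) ≤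
      s ^ 2 * (∫ x in ω, complDist ω x ^ (-(2 - 2 * s))) + (3 * B + 1) ^ 2 *
        ∫ x in ω ∩ {x | complDist ω x ≤ 3 * ε}, complDist ω x ^ (-(2 - 2 * s)) := by
  obtain ⟨d, hdc, hdl, hd⟩ := exists_contDiff_lipschitz_approx (lipschitzWith_complDist ω) hε
  have hdd : Differentiable ℝ d := hdc.differentiable (by simp)
  have hHd : Differentiable ℝ (cutoffPow ε s) := (contDiff_cutoffPow hε).differentiable (by simp)
  have hI := integrableOn_complDist_rpow hopen hbdd hlip (q := 2 - 2 * s) (by linarith)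
    (by linarith)
  set S := {x | complDist ω x ≤ 3 * ε} with hS
  have hSm : MeasurableSet S := measurableSet_le (continuous_complDist ω).measurable
    measurable_const
  have hclosed : IsClosed {x | ε ≤ complDist ω x} :=
    isClosed_le continuous_const (continuous_complDist ω)
  have hsub : {x | ε ≤ complDist ω x} ⊆ ω := fun x hx => mem_of_complDist_pos (hε.trans_le hx)
  have hcpt : IsCompact {x | ε ≤ complDist ω x} :=
    Metric.isCompact_of_isClosed_isBounded hclosed (hbdd.subset hsub)
  set v : Plane → ℂ := fun x => (cutoffPow ε s (d x) : ℂ) with hv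
  have hsupp : Function.support v ⊆ {x | ε ≤ complDist ω x} := by
    intro x hx
    by_contra h
    refine hx ?_
    have h1 : complDist ω x < ε := not_le.1 h
    simp [hv, cutoffPow_eq_zero hε (show d x ≤ 2 * ε by linarith [(hd x).2])]
  have hts : tsupport v ⊆ {x | ε ≤ complDist ω x} := closure_minimal hsupp hclosed
  have hvt : IsTestFunction ω v :=
    ⟨Complex.ofRealCLM.contDiff.comp ((contDiff_cutoffPow hε).comp hdc),
      hcpt.of_isClosed_subset (isClosed_tsupport v) hts, hts.trans hsub⟩
  have hpow : ∀ {t : ℝ}, 0 < t → (t ^ (s - 1)) ^ 2 = t ^ (-(2 - 2 * s)) := fun ht => by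
    rw [← Real.rpow_natCast, ← Real.rpow_mul ht.le]
    congr 1
    push_cast
    ring
  -- `|∇v| ≤ s d ^ (s - 1)` where `d > 3 ε`; the cut-off contributes only where `δ ≤ d ≤ 3 ε`
  have hup : ∫ x in ω, gradSq v x ≤ ∫ x in ω, (s ^ 2 * complDist ω x ^ (-(2 - 2 * s)) +
      S.indicator (fun x => (3 * B + 1) ^ 2 * complDist ω x ^ (-(2 - 2 * s))) x) := by
    refine setIntegral_mono_on hvt.integrable_gradSq.integrableOn
      ((hI.const_mul _).add ((hI.const_mul _).indicator hSm)) hopen.measurableSet fun x hx => ?_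
    have hδ := complDist_pos hopen hbdd hx
    have hdx : 0 < d x := hδ.trans_le (hd x).1
    have hmono : d x ^ (-(2 - 2 * s)) ≤ complDist ω x ^ (-(2 - 2 * s)) :=
      Real.rpow_le_rpow_of_nonpos hδ (hd x).1 (by linarith)
    have hg : gradSq v x ≤ deriv (cutoffPow ε s) (d x) ^ 2 := by
      rw [hv, gradSq_ofReal (f := fun x => cutoffPow ε s (d x)) ((hHd _).comp x (hdd x)), planeDeriv_comp 0 (hHd _) (hdd x),
        planeDeriv_comp 1 (hHd _) (hdd x)]
      nlinarith [planeDeriv_sq_add_sq_le hdl x, sq_nonneg (deriv (cutoffPow ε s) (d x))]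
    obtain ⟨b1, b2⟩ := deriv_cutoffPow_bounds hε (by linarith) hs1.le hB0 hB hdx
    have hq : 0 ≤ complDist ω x ^ (-(2 - 2 * s)) := by positivity
    rcases lt_or_ge (3 * ε) (d x) with h | h
    · have h1 : deriv (cutoffPow ε s) (d x) ^ 2 ≤ s ^ 2 * complDist ω x ^ (-(2 - 2 * s)) := by
        rw [← sq_abs]
        refine (pow_le_pow_left₀ (abs_nonneg _) (b2 h) 2).trans ?_
        rw [mul_pow, hpow hdx]
        gcongr
      have h2 : 0 ≤ S.indicator (fun x => (3 * B + 1) ^ 2 * complDist ω x ^ (-(2 - 2 * s))) x :=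
        indicator_nonneg (fun y _ => mul_nonneg (sq_nonneg _)
          (Real.rpow_nonneg (complDist_nonneg y) _)) x
      linarith
    · have h1 : deriv (cutoffPow ε s) (d x) ^ 2 ≤
          (3 * B + 1) ^ 2 * complDist ω x ^ (-(2 - 2 * s)) := by
        rw [← sq_abs]
        refine (pow_le_pow_left₀ (abs_nonneg _) b1 2).trans ?_
        rw [mul_pow, hpow hdx]
        gcongr
      rw [indicator_of_mem (show x ∈ S from (hd x).1.trans h)]
      have : 0 ≤ s ^ 2 * complDist ω x ^ (-(2 - 2 * s)) := by positivity
      linarith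
  -- `v = d ^ s ≥ δ ^ s` outside `S`
  have hlow : ∫ x in ω, (complDist ω x ^ (-(2 - 2 * s)) -
      S.indicator (fun x => complDist ω x ^ (-(2 - 2 * s))) x) ≤
      ∫ x in ω, (‖v x‖ / complDist ω x) ^ 2 := by
    refine setIntegral_mono_on (hI.sub (hI.indicator hSm))
      (integrableOn_norm_div_sq hopen hbdd hlip hvt) hopen.measurableSet fun x hx => ?_
    have hδ := complDist_pos hopen hbdd hx
    by_cases hxS : x ∈ S
    · rw [indicator_of_mem hxS, sub_self]
      exact sq_nonneg _
    · have h3 : 3 * ε < complDist ω x := not_le.1 hxS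
      have hdx : 0 < d x := hδ.trans_le (hd x).1
      rw [indicator_of_notMem hxS, sub_zero, ← hpow hδ, Real.rpow_sub_one hδ.ne', hv]
      simp only [Complex.norm_real, Real.norm_eq_abs]
      rw [cutoffPow_eq_rpow hε (h3.le.trans (hd x).1), abs_of_nonneg (by positivity)]
      gcongr
      exact (hd x).1
  rw [integral_add (hI.const_mul _) ((hI.const_mul _).indicator hSm), integral_const_mul,
    setIntegral_indicator hSm, integral_const_mul] at hup
  rw [integral_sub hI (hI.indicator hSm), setIntegral_indicator hSm] at hlow
  exact (mul_le_mul_of_nonneg_left hlow hardyInf_nonneg).trans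
    ((hardyInf_mul_le hopen hbdd hvt).trans hup)

/-- The functions `δ ^ s`, with `s` close to `1/2`, show that the Hardy constant is at least two. -/
theorem hardyInf_le (hne : ω.Nonempty) : hardyInf ω ≤ 1 / 4 := by
  obtain ⟨B, hB0, hB⟩ := exists_abs_deriv_smoothTransition_le
  have key : ∀ s : ℝ, 1 / 2 < s → s < 1 → hardyInf ω ≤ s ^ 2 := by
    intro s hs0 hs1
    have hI := integrableOn_complDist_rpow hopen hbdd hlip (q := 2 - 2 * s) (by linarith)
      (by linarith)
    have hpos : 0 < ∫ x in ω, complDist ω x ^ (-(2 - 2 * s)) := by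
      rw [setIntegral_pos_iff_support_of_nonneg_ae
        (Filter.Eventually.of_forall fun x => Real.rpow_nonneg (complDist_nonneg x) _) hI]
      refine (hopen.measure_pos volume hne).trans_le (measure_mono fun x hx => ⟨?_, hx⟩)
      exact (Real.rpow_pos_of_pos (complDist_pos hopen hbdd hx) _).ne'
    have hlim : Filter.Tendsto (fun n : ℕ => ∫ x in ω ∩ {x | complDist ω x ≤ 3 * (1 / ((n : ℝ) + 1))},
        complDist ω x ^ (-(2 - 2 * s))) Filter.atTop (nhds 0) := by
      have hmeas : ∀ n : ℕ, MeasurableSet (ω ∩ {x | complDist ω x ≤ 3 * (1 / ((n : ℝ) + 1))}) :=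
        fun n => hopen.measurableSet.inter
          (measurableSet_le (continuous_complDist ω).measurable measurable_const)
      have hanti : Antitone fun n : ℕ => ω ∩ {x | complDist ω x ≤ 3 * (1 / ((n : ℝ) + 1))} := by
        refine fun m n hmn => inter_subset_inter_right _ fun x hx => ?_
        refine (show complDist ω x ≤ 3 * (1 / ((n : ℝ) + 1)) from hx).trans ?_
        gcongr
      have hinter : ⋂ n : ℕ, ω ∩ {x | complDist ω x ≤ 3 * (1 / ((n : ℝ) + 1))} = ∅ := by
        refine eq_empty_of_forall_notMem fun x hx => ?_
        rw [mem_iInter] at hx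
        have hδ := complDist_pos hopen hbdd (hx 0).1
        obtain ⟨n, hn⟩ := exists_nat_one_div_lt (show 0 < complDist ω x / 3 by positivity)
        have : complDist ω x ≤ 3 * (1 / ((n : ℝ) + 1)) := (hx n).2
        linarith
      have := tendsto_setIntegral_of_antitone hmeas hanti
        ⟨0, hI.mono_set inter_subset_left⟩
      rwa [hinter, setIntegral_empty] at this
    have h1 := (hlim.const_sub (∫ x in ω, complDist ω x ^ (-(2 - 2 * s)))).const_mul (hardyInf ω)
    have h2 := (hlim.const_mul ((3 * B + 1) ^ 2)).const_add
      (s ^ 2 * ∫ x in ω, complDist ω x ^ (-(2 - 2 * s)))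
    have h3 := le_of_tendsto_of_tendsto' h1 h2 fun n =>
      hardyInf_mul_setIntegral_rpow_le hopen hbdd hlip hs0 hs1 hB0 hB (by positivity)
    rw [sub_zero, mul_zero, add_zero] at h3
    exact le_of_mul_le_mul_right h3 hpos
  have hlim : Filter.Tendsto (fun s : ℝ => s ^ 2) (nhdsWithin (1 / 2) (Ioi (1 / 2)))
      (nhds ((1 / 2) ^ 2)) :=
    ((continuous_pow 2).tendsto _).mono_left nhdsWithin_le_nhds
  have h := ge_of_tendsto hlim (b := hardyInf ω) (by
    filter_upwards [Ioo_mem_nhdsGT (show (1 / 2 : ℝ) < 1 by norm_num)] with s hs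
    exact key s hs.1 hs.2)
  norm_num at h ⊢
  exact h

end UpperBound

/-! ### Hardy's inequality for the Heisenberg gradient -/

section FiberIntegral

theorem HasCompactSupport.comp_prodMk {Z : Type*} [Zero Z] {ψ : Space → Z}
    (hc : HasCompactSupport ψ) (x : Plane) : HasCompactSupport fun t => ψ (x, t) :=
  HasCompactSupport.intro (hc.isCompact.image continuous_snd) fun _ ht =>
    image_eq_zero_of_notMem_tsupport fun h => ht ⟨_, h, rfl⟩

variable {ψ : Space → ℝ} (hψ : ContDiff ℝ ((⊤ : ℕ∞) : WithTop ℕ∞) ψ) (hc : HasCompactSupport ψ)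

include hψ hc

theorem contDiff_integral_prodMk :
    ContDiff ℝ ((⊤ : ℕ∞) : WithTop ℕ∞) fun x => ∫ t, ψ (x, t) := by
  -- the integral is the convolution of `ψ(x', ·)` with the constant `1`, evaluated at `0`
  have h := contDiffOn_convolution_left_with_param_comp (μ := (volume : Measure ℝ))
    (ContinuousLinearMap.mul ℝ ℝ) (s := (univ : Set Plane)) (n := ⊤) (v := fun _ => (0 : ℝ))
    contDiffOn_const (f := fun _ => (1 : ℝ)) (g := fun x t => ψ (x, t))
    (k := Prod.snd '' tsupport ψ) isOpen_univ (hc.isCompact.image continuous_snd)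
    (fun x t _ ht => image_eq_zero_of_notMem_tsupport fun h => ht ⟨_, h, rfl⟩)
    (locallyIntegrable_const 1) hψ.contDiffOn
  rw [contDiffOn_univ] at h
  simpa [convolution] using h

theorem hasFDerivAt_integral_prodMk (x : Plane) :
    HasFDerivAt (fun x => ∫ t, ψ (x, t))
      (∫ t, (fderiv ℝ ψ (x, t)).comp (ContinuousLinearMap.inl ℝ Plane ℝ)) x := by
  have hdc : Continuous (fderiv ℝ ψ) := hψ.continuous_fderiv (by simp)
  have hdcs : HasCompactSupport (fderiv ℝ ψ) := hc.fderiv (𝕜 := ℝ)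
  obtain ⟨C, hC⟩ := hdcs.exists_bound_of_continuous hdc
  have hk : IsCompact (Prod.snd '' tsupport ψ) := hc.isCompact.image continuous_snd
  have hcomp : Continuous fun p : Space =>
      (fderiv ℝ ψ p).comp (ContinuousLinearMap.inl ℝ Plane ℝ) := by fun_prop
  refine hasFDerivAt_integral_of_dominated_of_fderiv_le (𝕜 := ℝ) (s := univ)
    (F' := fun x t => (fderiv ℝ ψ (x, t)).comp (ContinuousLinearMap.inl ℝ Plane ℝ))
    (bound := (Prod.snd '' tsupport ψ).indicator fun _ => C * 1) Filter.univ_mem ?_ ?_ ?_ ?_ ?_ ?_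
  · exact Filter.Eventually.of_forall fun y =>
      (hψ.continuous.comp (by fun_prop : Continuous fun t : ℝ => (y, t))).aestronglyMeasurable
  · exact (hψ.continuous.comp (by fun_prop : Continuous fun t : ℝ =>
      (x, t))).integrable_of_hasCompactSupport (HasCompactSupport.comp_prodMk hc x)
  · exact (hcomp.comp (by fun_prop : Continuous fun t : ℝ => (x, t))).aestronglyMeasurable
  · refine Filter.Eventually.of_forall fun t y _ => ?_
    by_cases ht : t ∈ Prod.snd '' tsupport ψ
    · rw [indicator_of_mem ht]
      exact (ContinuousLinearMap.opNorm_comp_le _ _).trans (mul_le_mul (hC _)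
        (ContinuousLinearMap.norm_inl_le_one ℝ _ _) (norm_nonneg _)
        ((norm_nonneg _).trans (hC (y, t))))
    · have h0 : fderiv ℝ ψ (y, t) = 0 := by
        by_contra h
        exact ht ⟨_, support_fderiv_subset ℝ h, rfl⟩
      simp [indicator_of_notMem ht, h0]
  · rw [integrable_indicator_iff hk.measurableSet]
    exact integrableOn_const hk.measure_ne_top
  · refine Filter.Eventually.of_forall fun t y _ => ?_
    exact ((hψ.differentiable (by simp)) (y, t)).hasFDerivAt.comp y (hasFDerivAt_prodMk_left y t)

/-- The derivative of `∫ ψ(x', t) dt` in a direction of the plane is the integral of the derivative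
of `ψ` in any direction above it, since `∂ψ/∂x₃` integrates to zero. -/
theorem fderiv_integral_prodMk_apply (x v : Plane) (r : ℝ) :
    fderiv ℝ (fun x => ∫ t, ψ (x, t)) x v = ∫ t, fderiv ℝ ψ (x, t) (v, r) := by
  have hdc : Continuous (fderiv ℝ ψ) := hψ.continuous_fderiv (by simp)
  have hdcs : HasCompactSupport (fderiv ℝ ψ) := hc.fderiv (𝕜 := ℝ)
  have hline : Continuous fun t : ℝ => (x, t) := by fun_prop
  have hint : Integrable fun t => fderiv ℝ ψ (x, t) :=
    (hdc.comp hline).integrable_of_hasCompactSupport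
      (HasCompactSupport.comp_prodMk hdcs x)
  have hint' : Integrable fun t =>
      (fderiv ℝ ψ (x, t)).comp (ContinuousLinearMap.inl ℝ Plane ℝ) :=
    ((ContinuousLinearMap.compL ℝ Plane Space ℝ).flip
      (ContinuousLinearMap.inl ℝ Plane ℝ)).integrable_comp hint
  have hzero : ∫ t, fderiv ℝ ψ (x, t) (0, 1) = 0 := by
    refine integral_eq_zero_of_hasDerivAt_of_integrable (f := fun t => ψ (x, t)) (fun t => ?_)
      (hint.apply_continuousLinearMap _)
      ((hψ.continuous.comp hline).integrable_of_hasCompactSupport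
        (HasCompactSupport.comp_prodMk hc x))
    have := ((hψ.differentiable (by simp)) (x, t)).hasFDerivAt.comp_hasDerivAt t
      ((hasDerivAt_const t x).prodMk (hasDerivAt_id t))
    exact this
  rw [(hasFDerivAt_integral_prodMk hψ hc x).fderiv, ContinuousLinearMap.integral_apply hint']
  have hsplit : ∀ t, fderiv ℝ ψ (x, t) (v, r) =
      fderiv ℝ ψ (x, t) (v, 0) + r * fderiv ℝ ψ (x, t) (0, 1) := fun t => by
    rw [← smul_eq_mul, ← map_smul, ← map_add]
    simp
  simp_rw [hsplit]
  rw [integral_add (hint.apply_continuousLinearMap _)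
    ((hint.apply_continuousLinearMap _).const_mul r), integral_const_mul, hzero, mul_zero, add_zero]
  simp

end FiberIntegral

section FiberNorm

theorem sq_integral_mul_le {f g : ℝ → ℝ} (hf0 : 0 ≤ f) (hg0 : 0 ≤ g) (hf : Continuous f)
    (hg : Continuous g) (hfc : HasCompactSupport f) (hgc : HasCompactSupport g) :
    (∫ t, f t * g t) ^ 2 ≤ (∫ t, f t ^ 2) * ∫ t, g t ^ 2 := by
  have h := integral_mul_le_Lp_mul_Lq_of_nonneg (μ := volume) Real.HolderConjugate.two_two
    (Filter.Eventually.of_forall hf0) (Filter.Eventually.of_forall hg0)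
    (hf.memLp_of_hasCompactSupport hfc) (hg.memLp_of_hasCompactSupport hgc)
  simp only [Real.rpow_two, ← Real.sqrt_eq_rpow] at h
  have h0 : 0 ≤ ∫ t, f t * g t := integral_nonneg fun t => mul_nonneg (hf0 t) (hg0 t)
  refine (pow_le_pow_left₀ h0 h 2).trans (le_of_eq ?_)
  rw [mul_pow, Real.sq_sqrt (integral_nonneg fun _ => sq_nonneg _),
    Real.sq_sqrt (integral_nonneg fun _ => sq_nonneg _)]

/-- `∫ |φ(x', t)|² dt`, the square of the norm of `φ` on the line above `x'`. -/
def fiberNormSq (φ : Space → ℂ) (x : Plane) : ℝ := ∫ t, ‖φ (x, t)‖ ^ 2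

theorem fiberNormSq_nonneg (φ : Space → ℂ) (x : Plane) : 0 ≤ fiberNormSq φ x :=
  integral_nonneg fun _ => sq_nonneg _

theorem integrable_norm_sq_of_hasCompactSupport {φ : Space → ℂ} (hφ : Continuous φ)
    (hc : HasCompactSupport φ) : Integrable fun p : Space => ‖φ p‖ ^ 2 := by
  have h1 : Continuous fun p : Space => ‖φ p‖ ^ 2 := hφ.norm.pow 2
  have h2 : HasCompactSupport fun p : Space => ‖φ p‖ ^ 2 :=
    hc.comp_left (g := fun z : ℂ => ‖z‖ ^ 2) (by simp)
  exact h1.integrable_of_hasCompactSupport h2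

theorem integrable_fiberNormSq {φ : Space → ℂ} (hφ : Continuous φ) (hc : HasCompactSupport φ) :
    Integrable (fiberNormSq φ) :=
  (integrable_norm_sq_of_hasCompactSupport hφ hc).integral_prod_left

variable {Ω : Set Space} {φ : Space → ℂ} (hφ : IsTestFunction Ω φ)

include hφ

theorem IsTestFunction.contDiff_norm_sq :
    ContDiff ℝ ((⊤ : ℕ∞) : WithTop ℕ∞) fun p => ‖φ p‖ ^ 2 := hφ.contDiff.norm_sq ℝ

theorem IsTestFunction.hasCompactSupport_norm_sq : HasCompactSupport fun p => ‖φ p‖ ^ 2 :=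
  hφ.hasCompactSupport.comp_left (g := fun z => ‖z‖ ^ 2) (by simp)

theorem IsTestFunction.contDiff_fiberNormSq :
    ContDiff ℝ ((⊤ : ℕ∞) : WithTop ℕ∞) (fiberNormSq φ) :=
  contDiff_integral_prodMk hφ.contDiff_norm_sq hφ.hasCompactSupport_norm_sq

/-- With `v` the unit vector `eᵢ` and a suitable `r`, the derivative on the right is `Xᵢφ`. -/
theorem IsTestFunction.sq_fderiv_fiberNormSq_le (x v : Plane) (r : ℝ) :
    fderiv ℝ (fiberNormSq φ) x v ^ 2 ≤
      4 * fiberNormSq φ x * ∫ t, ‖fderiv ℝ φ (x, t) (v, r)‖ ^ 2 := by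
  have hline : Continuous fun t : ℝ => (x, t) := by fun_prop
  have hDc : Continuous fun t => fderiv ℝ φ (x, t) (v, r) :=
    (hφ.continuous_fderiv_apply (continuous_const (y := ((v, r) : Space)))).comp hline
  have hDs : HasCompactSupport fun t => fderiv ℝ φ (x, t) (v, r) :=
    HasCompactSupport.comp_prodMk
      (hφ.hasCompactSupport_fderiv_apply fun _ => ((v, r) : Space)) x
  have hc1 := (hφ.contDiff.continuous.comp hline).norm
  have hs1 := (HasCompactSupport.comp_prodMk hφ.hasCompactSupport x).norm
  have hd : ∀ t, ‖fderiv ℝ (fun p => ‖φ p‖ ^ 2) (x, t) (v, r)‖ ≤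
      2 * (‖φ (x, t)‖ * ‖fderiv ℝ φ (x, t) (v, r)‖) := fun t => by
    have h1 := ((hφ.contDiff.differentiable (by simp)) (x, t)).hasFDerivAt.norm_sq
    rw [h1.fderiv]
    simp only [smul_apply, ContinuousLinearMap.comp_apply, innerSL_apply_apply]
    rw [nsmul_eq_mul, norm_mul]
    simp only [Nat.cast_ofNat, Real.norm_ofNat]
    gcongr
    exact norm_inner_le_norm _ _
  have h1 : |fderiv ℝ (fiberNormSq φ) x v| ≤
      2 * ∫ t, ‖φ (x, t)‖ * ‖fderiv ℝ φ (x, t) (v, r)‖ := by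
    rw [show fderiv ℝ (fiberNormSq φ) x v = _ from fderiv_integral_prodMk_apply
      hφ.contDiff_norm_sq hφ.hasCompactSupport_norm_sq x v r, ← integral_const_mul]
    exact norm_integral_le_of_norm_le (((hc1.mul hDc.norm).integrable_of_hasCompactSupport
      hs1.mul_right).const_mul 2) (Filter.Eventually.of_forall hd)
  have h2 := sq_integral_mul_le (fun _ => norm_nonneg _) (fun _ => norm_nonneg _) hc1 hDc.norm hs1
    hDs.norm
  rw [← sq_abs]
  refine (pow_le_pow_left₀ (abs_nonneg _) h1 2).trans ?_
  rw [mul_pow]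
  simp only [Function.comp_apply] at h2
  unfold fiberNormSq
  linarith

end FiberNorm

section HeisenbergHardy

variable {ω : Set Plane} {a b : ℝ} {φ : Space → ℂ} (hφ : IsTestFunction (ω ×ˢ Ioo a b) φ)

include hφ

omit hφ in
theorem fiberNormSq_eq_zero {x : Plane} (hx : x ∉ Prod.fst '' tsupport φ) :
    fiberNormSq φ x = 0 := by
  have : ∀ t, ‖φ (x, t)‖ ^ 2 = 0 := fun t => by
    rw [image_eq_zero_of_notMem_tsupport fun h => hx ⟨_, h, rfl⟩]
    simp
  simp [fiberNormSq, this]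

/-- The regularized fibre norm `√(∫ |φ(x', t)|² dt + ε²) - ε`, which is smooth, and vanishes where
`φ(x', ·)` does. -/
def fiberNormReg (φ : Space → ℂ) (ε : ℝ) (x : Plane) : ℝ := √(fiberNormSq φ x + ε ^ 2) - ε

theorem IsTestFunction.image_fst_tsupport_subset : Prod.fst '' tsupport φ ⊆ ω := by
  rintro _ ⟨p, hp, rfl⟩
  exact (hφ.tsupport_subset hp).1

theorem IsTestFunction.fiberNormSq_apply_eq_zero {x : Plane} (hx : x ∉ ω) :
    fiberNormSq φ x = 0 :=
  fiberNormSq_eq_zero fun h => hx (hφ.image_fst_tsupport_subset h)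

theorem IsTestFunction.contDiff_fiberNormReg {ε : ℝ} (hε : 0 < ε) :
    ContDiff ℝ ((⊤ : ℕ∞) : WithTop ℕ∞) (fiberNormReg φ ε) := by
  refine ContDiff.sub (ContDiff.sqrt (hφ.contDiff_fiberNormSq.add contDiff_const) fun x => ?_)
    contDiff_const
  have := fiberNormSq_nonneg φ x
  positivity

theorem IsTestFunction.isTestFunction_fiberNormReg {ε : ℝ} (hε : 0 < ε) :
    IsTestFunction ω fun x => (fiberNormReg φ ε x : ℂ) := by
  have hcpt : IsCompact (Prod.fst '' tsupport φ) := hφ.hasCompactSupport.isCompact.image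
    continuous_fst
  have hsupp : Function.support (fun x => (fiberNormReg φ ε x : ℂ)) ⊆
      Prod.fst '' tsupport φ := by
    intro x hx
    by_contra h
    refine hx ?_
    simp [fiberNormReg, fiberNormSq_eq_zero h, Real.sqrt_sq hε.le]
  have hts := closure_minimal hsupp hcpt.isClosed
  exact ⟨Complex.ofRealCLM.contDiff.comp (hφ.contDiff_fiberNormReg hε),
    hcpt.of_isClosed_subset (isClosed_tsupport _) hts, hts.trans hφ.image_fst_tsupport_subset⟩

theorem IsTestFunction.sq_planeDeriv_fiberNormReg_le {ε : ℝ} (hε : 0 < ε) (i : Fin 2) (x : Plane)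
    (r : ℝ) : planeDeriv i (fiberNormReg φ ε) x ^ 2 ≤
      ∫ t, ‖fderiv ℝ φ (x, t) (EuclideanSpace.single i 1, r)‖ ^ 2 := by
  have hG := fiberNormSq_nonneg φ x
  have hpos : 0 < fiberNormSq φ x + ε ^ 2 := by positivity
  have hd : DifferentiableAt ℝ (fiberNormSq φ) x :=
    hφ.contDiff_fiberNormSq.differentiable (by simp) x
  have h1 : HasFDerivAt (fiberNormReg φ ε)
      ((1 / (2 * √(fiberNormSq φ x + ε ^ 2))) • fderiv ℝ (fiberNormSq φ) x) x :=
    ((hd.hasFDerivAt.add_const (ε ^ 2)).sqrt hpos.ne').sub_const ε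
  have h2 := hφ.sq_fderiv_fiberNormSq_le x (EuclideanSpace.single i 1) r
  set I := ∫ t, ‖fderiv ℝ φ (x, t) (EuclideanSpace.single i 1, r)‖ ^ 2
  have hI : 0 ≤ I := integral_nonneg fun _ => sq_nonneg _
  rw [planeDeriv, h1.fderiv, smul_apply, smul_eq_mul, mul_pow, div_pow,
    mul_pow, Real.sq_sqrt hpos.le, one_pow, one_div, inv_mul_le_iff₀ (by positivity)]
  nlinarith [mul_nonneg (sq_nonneg ε) hI]

theorem IsTestFunction.gradSq_fiberNormReg_le {ε : ℝ} (hε : 0 < ε) (x : Plane) :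
    gradSq (fun x => (fiberNormReg φ ε x : ℂ)) x ≤
      fiberNormSq (heisX1 φ) x + fiberNormSq (heisX2 φ) x := by
  rw [gradSq_ofReal ((hφ.contDiff_fiberNormReg hε).differentiable (by simp) x)]
  exact add_le_add (hφ.sq_planeDeriv_fiberNormReg_le hε 0 x (x 1 / 2))
    (hφ.sq_planeDeriv_fiberNormReg_le hε 1 x (-(x 0 / 2)))

variable (hopen : IsOpen ω) (hbdd : Bornology.IsBounded ω)

include hopen hbdd

theorem IsTestFunction.integrableOn_fiberNormSq_div :
    IntegrableOn (fun x => fiberNormSq φ x / complDist ω x ^ 2) ω := by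
  have hGc : Continuous (fiberNormSq φ) := hφ.contDiff_fiberNormSq.continuous
  have hcpt : IsCompact (Prod.fst '' tsupport φ) := hφ.hasCompactSupport.isCompact.image
    continuous_fst
  have hcont : ContinuousOn (fun x => fiberNormSq φ x / complDist ω x ^ 2)
      (Prod.fst '' tsupport φ) :=
    hGc.continuousOn.div ((continuous_complDist ω).pow 2).continuousOn fun x hx =>
      (pow_pos (complDist_pos hopen hbdd (hφ.image_fst_tsupport_subset hx)) 2).ne'
  refine (IntegrableOn.integrable_of_forall_notMem_eq_zero
    (hcont.integrableOn_compact hcpt) fun x hx => ?_).integrableOn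
  rw [fiberNormSq_eq_zero hx, zero_div]

/-- Hardy's inequality for the norm of `φ` on the lines parallel to the third axis. It follows from
Hardy's inequality on `ω` because `|∇ √(∫ |φ|² dx₃)|² ≤ ∫ |X₁φ|² + |X₂φ|² dx₃`. -/
theorem IsTestFunction.hardyInf_mul_fiberNormSq_le :
    hardyInf ω * ∫ x in ω, fiberNormSq φ x / complDist ω x ^ 2 ≤
      (∫ p, ‖heisX1 φ p‖ ^ 2) + ∫ p, ‖heisX2 φ p‖ ^ 2 := by
  have i1 := integrable_fiberNormSq (continuous_heisX1 hφ) (hasCompactSupport_heisX1 hφ)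
  have i2 := integrable_fiberNormSq (continuous_heisX2 hφ) (hasCompactSupport_heisX2 hφ)
  have e1 : ∫ p, ‖heisX1 φ p‖ ^ 2 = ∫ x, fiberNormSq (heisX1 φ) x :=
    integral_prod _ (integrable_norm_sq_of_hasCompactSupport (continuous_heisX1 hφ)
      (hasCompactSupport_heisX1 hφ))
  have e2 : ∫ p, ‖heisX2 φ p‖ ^ 2 = ∫ x, fiberNormSq (heisX2 φ) x :=
    integral_prod _ (integrable_norm_sq_of_hasCompactSupport (continuous_heisX2 hφ)
      (hasCompactSupport_heisX2 hφ))
  have key : ∀ ε : ℝ, 0 < ε → hardyInf ω * ∫ x in ω, (fiberNormReg φ ε x / complDist ω x) ^ 2 ≤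
      (∫ p, ‖heisX1 φ p‖ ^ 2) + ∫ p, ‖heisX2 φ p‖ ^ 2 := by
    intro ε hε
    have h1 := hardyInf_mul_le hopen hbdd (hφ.isTestFunction_fiberNormReg hε)
    rw [(hφ.isTestFunction_fiberNormReg hε).setIntegral_gradSq] at h1
    have h2 := integral_mono (hφ.isTestFunction_fiberNormReg hε).integrable_gradSq (i1.add i2)
      (hφ.gradSq_fiberNormReg_le hε)
    rw [integral_add' i1 i2, ← e1, ← e2] at h2
    refine (le_of_eq ?_).trans (h1.trans h2)
    congr 2
    ext x
    rw [div_pow, div_pow, Complex.norm_real, Real.norm_eq_abs, sq_abs]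
  have hlim : Filter.Tendsto (fun ε => ∫ x in ω, (fiberNormReg φ ε x / complDist ω x) ^ 2)
      (nhdsWithin 0 (Ioi 0)) (nhds (∫ x in ω, fiberNormSq φ x / complDist ω x ^ 2)) := by
    refine tendsto_integral_filter_of_dominated_convergence
      (fun x => fiberNormSq φ x / complDist ω x ^ 2) ?_ ?_
      (hφ.integrableOn_fiberNormSq_div hopen hbdd) ?_
    · filter_upwards [self_mem_nhdsWithin] with ε hε
      exact (((hφ.contDiff_fiberNormReg hε).continuous.measurable.div
        (continuous_complDist ω).measurable).pow_const 2).aestronglyMeasurable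
    · filter_upwards [self_mem_nhdsWithin] with ε hε
      refine Filter.Eventually.of_forall fun x => ?_
      have hε : 0 < ε := hε
      have hG := fiberNormSq_nonneg φ x
      rw [Real.norm_eq_abs, abs_of_nonneg (sq_nonneg _), div_pow]
      gcongr
      have h1 : ε ≤ √(fiberNormSq φ x + ε ^ 2) := Real.le_sqrt_of_sq_le (by linarith)
      have h2 := Real.sq_sqrt (show 0 ≤ fiberNormSq φ x + ε ^ 2 by positivity)
      unfold fiberNormReg
      nlinarith
    · refine Filter.Eventually.of_forall fun x => ?_
      have hc : Continuous fun ε => (fiberNormReg φ ε x / complDist ω x) ^ 2 := by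
        unfold fiberNormReg
        fun_prop
      have := (hc.tendsto 0).mono_left (nhdsWithin_le_nhds (s := Ioi 0))
      simpa [fiberNormReg, div_pow, Real.sq_sqrt (fiberNormSq_nonneg φ x)] using this
  refine le_of_tendsto (hlim.const_mul _) ?_
  filter_upwards [self_mem_nhdsWithin] with ε hε using key ε hε

end HeisenbergHardy

section FormHardy

variable {ω : Set Plane} {a b : ℝ} (hopen : IsOpen ω) (hbdd : Bornology.IsBounded ω)

include hopen hbdd

/-- `max (δ, β)`, as a function on `Space`: a bounded weight which is bounded away from zero. -/
def distWeight (ω : Set Plane) (β : ℝ) (p : Space) : ℝ := max (complDist ω p.1) β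

omit hopen in
theorem isBddCont_distWeight (β : ℝ) : IsBddCont (distWeight ω β) := by
  obtain ⟨M, hM⟩ := exists_complDist_le hbdd
  refine ⟨((continuous_complDist ω).comp continuous_fst).max continuous_const,
    max M |β|, fun p => ?_⟩
  have h0 : 0 ≤ complDist ω p.1 := complDist_nonneg _
  rw [distWeight, abs_of_nonneg (h0.trans (le_max_left _ _))]
  exact max_le_max (hM _) (le_abs_self _)

omit hopen in
theorem isBddCont_distWeight_rpow {β : ℝ} (hβ : 0 < β) (s : ℝ) :
    IsBddCont fun p => distWeight ω β p ^ s :=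
  isBddCont_rpow (isBddCont_distWeight hbdd β) hβ (fun _ => le_max_right _ _) s

/-- Hardy's inequality for a test function and its Heisenberg gradient, as elements of `L²`. -/
theorem hardyInf_mul_norm_sq_le_of_mem_testGraph {β : ℝ} (hβ : 0 < β)
    {v h₁ h₂ : L2 (ω ×ˢ Ioo a b)} (hv : (v, h₁, h₂) ∈ testGraph (ω ×ˢ Ioo a b)) :
    hardyInf ω * ‖realMul _ (fun p => distWeight ω β p ^ (-1 : ℝ)) v‖ ^ 2 ≤
      ‖h₁‖ ^ 2 + ‖h₂‖ ^ 2 := by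
  obtain ⟨φ, hφ, e0, e1, e2⟩ := hv
  have hw := isBddCont_distWeight_rpow hbdd hβ (-1)
  have hset : ∀ {ψ : Space → ℂ}, (∀ p ∉ tsupport φ, ψ p = 0) →
      ∫ p in ω ×ˢ Ioo a b, ‖ψ p‖ ^ 2 = ∫ p, ‖ψ p‖ ^ 2 := fun hψ =>
    setIntegral_eq_integral_of_forall_compl_eq_zero fun p hp => by
      rw [hψ p fun h => hp (hφ.tsupport_subset h)]
      simp
  have hd0 : ∀ p ∉ tsupport φ, fderiv ℝ φ p = 0 := fun p hp => by
    by_contra h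
    exact hp (support_fderiv_subset ℝ h)
  have n1 : ‖h₁‖ ^ 2 = ∫ p, ‖heisX1 φ p‖ ^ 2 := by
    rw [norm_sq_eq_integral, ← hset fun p hp => by simp [heisX1, hd0 p hp]]
    exact integral_congr_ae (e1.mono fun p hp => by simp only [hp])
  have n2 : ‖h₂‖ ^ 2 = ∫ p, ‖heisX2 φ p‖ ^ 2 := by
    rw [norm_sq_eq_integral, ← hset fun p hp => by simp [heisX2, hd0 p hp]]
    exact integral_congr_ae (e2.mono fun p hp => by simp only [hp])
  have hint : Integrable fun p : Space => (distWeight ω β p ^ (-1 : ℝ)) ^ 2 * ‖φ p‖ ^ 2 := by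
    have h1 : Continuous fun p : Space => (distWeight ω β p ^ (-1 : ℝ)) ^ 2 * ‖φ p‖ ^ 2 :=
      (hw.1.pow 2).mul (hφ.contDiff.continuous.norm.pow 2)
    have h2 : HasCompactSupport fun p : Space =>
        (distWeight ω β p ^ (-1 : ℝ)) ^ 2 * ‖φ p‖ ^ 2 :=
      hφ.hasCompactSupport_norm_sq.mul_left
    exact h1.integrable_of_hasCompactSupport h2
  have hfib : ∀ x, ∫ t, (distWeight ω β (x, t) ^ (-1 : ℝ)) ^ 2 * ‖φ (x, t)‖ ^ 2 =
      (max (complDist ω x) β ^ (-1 : ℝ)) ^ 2 * fiberNormSq φ x := fun x =>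
    integral_const_mul ((max (complDist ω x) β ^ (-1 : ℝ)) ^ 2) fun t => ‖φ (x, t)‖ ^ 2
  have n0 : ‖realMul _ (fun p => distWeight ω β p ^ (-1 : ℝ)) v‖ ^ 2 =
      ∫ x, (max (complDist ω x) β ^ (-1 : ℝ)) ^ 2 * fiberNormSq φ x := by
    rw [norm_realMul_sq hw, integral_congr_ae (g := fun p =>
      (distWeight ω β p ^ (-1 : ℝ)) ^ 2 * ‖φ p‖ ^ 2) (e0.mono fun p hp => by simp only [hp]),
      setIntegral_eq_integral_of_forall_compl_eq_zero fun p hp => by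
        rw [hφ.apply_eq_zero hp]
        simp]
    exact (integral_prod _ hint).trans (integral_congr_ae (Filter.Eventually.of_forall hfib))
  rw [n0, n1, n2]
  refine (mul_le_mul_of_nonneg_left ?_ hardyInf_nonneg).trans
    (hφ.hardyInf_mul_fiberNormSq_le hopen hbdd)
  rw [← setIntegral_eq_integral_of_forall_compl_eq_zero (s := ω) fun x hx => by
    rw [hφ.fiberNormSq_apply_eq_zero hx, mul_zero]]
  have hGc : Continuous (fiberNormSq φ) := hφ.contDiff_fiberNormSq.continuous
  refine setIntegral_mono_on ?_ (hφ.integrableOn_fiberNormSq_div hopen hbdd)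
    hopen.measurableSet fun x hx => ?_
  · exact (hint.integral_prod_left.congr (Filter.Eventually.of_forall hfib)).integrableOn
  · have hδ := complDist_pos hopen hbdd hx
    rw [div_eq_inv_mul, Real.rpow_neg_one, inv_pow]
    gcongr
    · exact fiberNormSq_nonneg φ x
    · exact le_max_left _ _

/-- Hardy's inequality on the form domain. -/
theorem hardyInf_mul_norm_sq_le {β : ℝ} (hβ : 0 < β) {v h₁ h₂ : L2 (ω ×ˢ Ioo a b)}
    (hv : (v, h₁, h₂) ∈ formGraph (ω ×ˢ Ioo a b)) :
    hardyInf ω * ‖realMul _ (fun p => distWeight ω β p ^ (-1 : ℝ)) v‖ ^ 2 ≤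
      ‖h₁‖ ^ 2 + ‖h₂‖ ^ 2 := by
  have hv' : (v, h₁, h₂) ∈ closure (testGraph (ω ×ˢ Ioo a b) :
      Set (L2 (ω ×ˢ Ioo a b) × L2 (ω ×ˢ Ioo a b) × L2 (ω ×ˢ Ioo a b))) := hv
  have hcont : Continuous fun p : L2 (ω ×ˢ Ioo a b) × L2 (ω ×ˢ Ioo a b) × L2 (ω ×ˢ Ioo a b) =>
      ‖p.2.1‖ ^ 2 + ‖p.2.2‖ ^ 2 -
        hardyInf ω * ‖realMul _ (fun q => distWeight ω β q ^ (-1 : ℝ)) p.1‖ ^ 2 := by fun_prop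
  have h := map_mem_closure (t := Ici (0 : ℝ)) hcont hv' fun p hp =>
    sub_nonneg.2 (hardyInf_mul_norm_sq_le_of_mem_testGraph hopen hbdd hβ hp)
  rw [isClosed_Ici.closure_eq] at h
  exact sub_nonneg.1 h

end FormHardy

/-! ### Smooth regularizations of a power of the distance -/

section Weight

/-- The function `(t ^ (n + 1) + β ^ (n + 1)) ^ (-α / (n + 1))`, a smooth approximation of
`max t β ^ (-α)` on `t ≥ 0`. -/
def smoothMaxPow (α β : ℝ) (n : ℕ) (t : ℝ) : ℝ :=
  (t ^ (n + 1) + β ^ (n + 1)) ^ (-(α / (n + 1)))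

variable {α β t : ℝ} {n : ℕ}

theorem pow_add_pow_pos (hβ : 0 < β) (ht : 0 ≤ t) : 0 < t ^ (n + 1) + β ^ (n + 1) := by
  positivity

theorem smoothMaxPow_pos (hβ : 0 < β) (ht : 0 ≤ t) : 0 < smoothMaxPow α β n t :=
  Real.rpow_pos_of_pos (pow_add_pow_pos hβ ht) _

theorem pow_rpow_neg_div (hβ : 0 ≤ β) (α : ℝ) (n : ℕ) :
    (β ^ (n + 1)) ^ (-(α / (n + 1))) = β ^ (-α) := by
  rw [← Real.rpow_natCast, ← Real.rpow_mul hβ]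
  congr 1
  push_cast
  field_simp

theorem smoothMaxPow_le (hα : 0 ≤ α) (hβ : 0 < β) (ht : 0 ≤ t) :
    smoothMaxPow α β n t ≤ max t β ^ (-α) := by
  have hm : 0 < max t β := hβ.trans_le (le_max_right _ _)
  rw [← pow_rpow_neg_div hm.le α n]
  refine Real.rpow_le_rpow_of_nonpos (by positivity) ?_ (neg_nonpos.2 (by positivity))
  rcases le_total t β with h | h
  · rw [max_eq_right h]
    linarith [pow_nonneg ht (n + 1)]
  · rw [max_eq_left h]
    linarith [pow_nonneg hβ.le (n + 1)]

theorem le_sq_smoothMaxPow (hα : 0 ≤ α) (hβ : 0 < β) (ht : 0 ≤ t) (htβ : t ≤ β) :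
    2 ^ (-(2 * α / (n + 1))) * β ^ (-(2 * α)) ≤ smoothMaxPow α β n t ^ 2 := by
  have h1 : (2 * β ^ (n + 1)) ^ (-(α / (n + 1))) ≤ smoothMaxPow α β n t := by
    refine Real.rpow_le_rpow_of_nonpos (pow_add_pow_pos hβ ht) ?_ (neg_nonpos.2 (by positivity))
    linarith [pow_le_pow_left₀ ht htβ (n + 1)]
  refine (le_of_eq ?_).trans (pow_le_pow_left₀ (by positivity) h1 2)
  rw [Real.mul_rpow (by norm_num) (by positivity), pow_rpow_neg_div hβ.le, mul_pow,
    ← Real.rpow_mul_natCast (by norm_num), ← Real.rpow_mul_natCast hβ.le]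
  congr 2 <;> push_cast <;> ring

/-- The logarithmic derivative of `smoothMaxPow α β n` is `-α` times this function of `t`. -/
def smoothMaxLogDeriv (β : ℝ) (n : ℕ) (t : ℝ) : ℝ := t ^ n / (t ^ (n + 1) + β ^ (n + 1))

theorem smoothMaxLogDeriv_nonneg (hβ : 0 < β) (ht : 0 ≤ t) : 0 ≤ smoothMaxLogDeriv β n t := by
  unfold smoothMaxLogDeriv
  positivity

theorem smoothMaxLogDeriv_le (hβ : 0 < β) (ht : 0 ≤ t) :
    smoothMaxLogDeriv β n t ≤ (max t β)⁻¹ := by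
  have hm : 0 < max t β := hβ.trans_le (le_max_right _ _)
  rw [smoothMaxLogDeriv, div_le_iff₀ (pow_add_pow_pos hβ ht), inv_mul_eq_div, le_div_iff₀ hm]
  rcases le_total t β with h | h
  · rw [max_eq_right h, pow_succ β]
    have := mul_le_mul_of_nonneg_right (pow_le_pow_left₀ ht h n) hβ.le
    linarith [pow_nonneg ht (n + 1)]
  · rw [max_eq_left h, pow_succ t]
    linarith [pow_nonneg hβ.le (n + 1)]

theorem smoothMaxLogDeriv_le_mul_pow (hβ : 0 < β) (ht : 0 ≤ t) {τ : ℝ} (htτ : t ≤ τ) :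
    smoothMaxLogDeriv β n t ≤ β⁻¹ * (τ / β) ^ n := by
  have hτ := ht.trans htτ
  calc smoothMaxLogDeriv β n t ≤ τ ^ n / β ^ (n + 1) := by
        unfold smoothMaxLogDeriv
        gcongr
        linarith [pow_nonneg ht (n + 1)]
    _ = β⁻¹ * (τ / β) ^ n := by
        rw [pow_succ, div_pow]
        field_simp

theorem hasDerivAt_smoothMaxPow (hβ : 0 < β) (ht : 0 ≤ t) :
    HasDerivAt (smoothMaxPow α β n) (-α * smoothMaxLogDeriv β n t * smoothMaxPow α β n t) t := by
  have hpos := pow_add_pow_pos (n := n) hβ ht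
  have h := ((hasDerivAt_pow (n + 1) t).add_const (β ^ (n + 1))).rpow_const
    (p := -(α / (n + 1))) (Or.inl hpos.ne')
  refine h.congr_deriv ?_
  rw [Real.rpow_sub_one hpos.ne', smoothMaxLogDeriv, smoothMaxPow]
  push_cast
  field_simp

variable {d : Plane → ℝ} (hd : ContDiff ℝ ((⊤ : ℕ∞) : WithTop ℕ∞) d) (hd0 : ∀ x, 0 ≤ d x)

include hd hd0

theorem contDiff_smoothMaxPow_comp (hβ : 0 < β) :
    ContDiff ℝ ((⊤ : ℕ∞) : WithTop ℕ∞) fun x => smoothMaxPow α β n (d x) :=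
  ContDiff.rpow_const_of_ne ((hd.pow _).add contDiff_const) fun x =>
    (pow_add_pow_pos hβ (hd0 x)).ne'

theorem sum_sq_planeDeriv_smoothMaxPow_le (hβ : 0 < β) (hdl : LipschitzWith 1 d) (x : Plane) :
    planeDeriv 0 (fun x => smoothMaxPow α β n (d x)) x ^ 2 +
        planeDeriv 1 (fun x => smoothMaxPow α β n (d x)) x ^ 2 ≤
      α ^ 2 * smoothMaxLogDeriv β n (d x) ^ 2 * smoothMaxPow α β n (d x) ^ 2 := by
  have hdx : DifferentiableAt ℝ d x := hd.differentiable (by simp) x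
  have hH := hasDerivAt_smoothMaxPow (α := α) (n := n) hβ (hd0 x)
  rw [planeDeriv_comp 0 hH.differentiableAt hdx, planeDeriv_comp 1 hH.differentiableAt hdx,
    hH.deriv]
  have h := mul_le_mul_of_nonneg_left (planeDeriv_sq_add_sq_le hdl x)
    (sq_nonneg (-α * smoothMaxLogDeriv β n (d x) * smoothMaxPow α β n (d x)))
  linarith

theorem isBddCont_smoothMaxPow (hα : 0 ≤ α) (hβ : 0 < β) :
    IsBddCont fun p : Space => smoothMaxPow α β n (d p.1) := by
  refine ⟨(contDiff_smoothMaxPow_comp hd hd0 hβ).continuous.comp continuous_fst, β ^ (-α),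
    fun p => ?_⟩
  rw [abs_of_pos (smoothMaxPow_pos hβ (hd0 _))]
  exact (smoothMaxPow_le hα hβ (hd0 _)).trans
    (Real.rpow_le_rpow_of_nonpos hβ (le_max_right _ _) (by linarith))

theorem isBddCont_planeDeriv_smoothMaxPow (hα : 0 ≤ α) (hβ : 0 < β) (hdl : LipschitzWith 1 d)
    (i : Fin 2) :
    IsBddCont fun p : Space => planeDeriv i (fun x => smoothMaxPow α β n (d x)) p.1 := by
  refine ⟨?_, α * β⁻¹ * β ^ (-α), fun p => ?_⟩
  · have h : Continuous fun x => fderiv ℝ (fun x => smoothMaxPow α β n (d x)) x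
        (EuclideanSpace.single i 1) :=
      ((contDiff_smoothMaxPow_comp hd hd0 hβ).continuous_fderiv (by simp)).clm_apply
        continuous_const
    exact h.comp continuous_fst
  · have h := sum_sq_planeDeriv_smoothMaxPow_le (α := α) (n := n) hd hd0 hβ hdl p.1
    have h1 : planeDeriv i (fun x => smoothMaxPow α β n (d x)) p.1 ^ 2 ≤
        (α * smoothMaxLogDeriv β n (d p.1) * smoothMaxPow α β n (d p.1)) ^ 2 := by
      rw [mul_pow, mul_pow]
      refine le_trans ?_ h
      fin_cases i
      · exact le_add_of_nonneg_right (sq_nonneg _)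
      · exact le_add_of_nonneg_left (sq_nonneg _)
    have hθ := smoothMaxLogDeriv_nonneg (n := n) hβ (hd0 p.1)
    have hW := smoothMaxPow_pos (α := α) (n := n) hβ (hd0 p.1)
    refine (abs_le_of_sq_le_sq h1 (by positivity)).trans ?_
    gcongr
    · exact (smoothMaxLogDeriv_le hβ (hd0 _)).trans (inv_anti₀ hβ (le_max_right _ _))
    · exact (smoothMaxPow_le hα hβ (hd0 _)).trans
        (Real.rpow_le_rpow_of_nonpos hβ (le_max_right _ _) (by linarith))

end Weight

/-! ### The estimate near the boundary -/

section Boundary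

variable {ω : Set Plane} {a b : ℝ} (hopen : IsOpen ω) (hbdd : Bornology.IsBounded ω)
  (u : (heisenbergLaplacian (ω ×ˢ Ioo a b)).domain) {β : ℝ}

include hopen hbdd

/-- Hardy's inequality for elements of the operator domain. -/
theorem hardyInf_mul_norm_sq_le_inner (hβ : 0 < β) :
    hardyInf ω * ‖realMul _ (fun p => distWeight ω β p ^ (-1 : ℝ)) (u : L2 (ω ×ˢ Ioo a b))‖ ^ 2 ≤
      (inner ℂ (u : L2 (ω ×ˢ Ioo a b)) (heisenbergLaplacian (ω ×ˢ Ioo a b) u)).re := by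
  obtain ⟨g₁, g₂, hg, H⟩ := heisenbergLaplacian_spec (hopen.prod isOpen_Ioo) u
  rw [← H _ _ _ hg, Complex.add_re, ← RCLike.re_eq_complex_re, inner_self_eq_norm_sq,
    inner_self_eq_norm_sq]
  exact hardyInf_mul_norm_sq_le hopen hbdd hβ hg

/-- The operator inequality `c⁻² δ⁻² ≤ A(Ω)`, raised to the power `2 / c ≤ 1`. -/
theorem exists_mem_domain_norm_distWeight_le (hpos : 0 < hardyInf ω) (hle : hardyInf ω ≤ 1 / 4)
    (hβ : 0 < β) :
    ∃ hu : (u : L2 (ω ×ˢ Ioo a b)) ∈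
        (nonnegPower (heisenbergLaplacian (ω ×ˢ Ioo a b)) √(hardyInf ω)).domain,
      ‖realMul _ (fun p => distWeight ω β p ^ (-(2 * √(hardyInf ω))))
          (u : L2 (ω ×ˢ Ioo a b))‖ ≤ (hardyInf ω)⁻¹ ^ √(hardyInf ω) *
        ‖nonnegPower (heisenbergLaplacian (ω ×ˢ Ioo a b)) √(hardyInf ω) ⟨u, hu⟩‖ := by
  have hΩ : IsOpen (ω ×ˢ Ioo a b) := hopen.prod isOpen_Ioo
  refine exists_mem_domain_nonnegPower_realMul_le (isBddCont_distWeight hbdd β) hβ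
    (fun _ => le_max_right _ _) (heisenbergLaplacian_symm hΩ) (heisenbergLaplacian_nonneg hΩ)
    (exists_resolvent_heisenbergLaplacian hΩ) (inv_pos.2 hpos) (fun v => ?_)
    (Real.sqrt_pos.2 hpos) ?_ u
  · rw [inv_mul_eq_div, le_div_iff₀ hpos, mul_comm]
    exact hardyInf_mul_norm_sq_le_inner hopen hbdd v hβ
  · rw [show (1 / 2 : ℝ) = √(1 / 4) by
      rw [show (1 / 4 : ℝ) = (1 / 2) ^ 2 by norm_num, Real.sqrt_sq (by norm_num)]]
    exact Real.sqrt_le_sqrt hle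

omit hopen hbdd in
theorem measurableSet_complDist_lt (ρ : ℝ) :
    MeasurableSet {p : Space | complDist ω p.1 < ρ} :=
  measurableSet_lt ((continuous_complDist ω).comp continuous_fst).measurable measurable_const

/-- Davies' argument. Hardy's inequality is applied to `σu`, where `σ` is a smooth substitute for
`max(δ, β) ^ (-α)`. As `α² = c⁻²`, the Hardy term dominates the term with `|∇σ|²` everywhere, and the
difference is bounded below on the strip, where `σ` is almost constant. -/
theorem integral_strip_le_of_approx {d : Plane → ℝ}
    (hd : ContDiff ℝ ((⊤ : ℕ∞) : WithTop ℕ∞) d) (hdl : LipschitzWith 1 d)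
    (hδd : ∀ x, complDist ω x ≤ d x) {α τ ρ : ℝ} (hα : 0 ≤ α) (hαh : α ^ 2 = hardyInf ω)
    (hdτ : ∀ x, complDist ω x < ρ → d x ≤ τ) (hρτ : ρ ≤ τ) (hτβ : τ ≤ β) (hβ : 0 < β) (n : ℕ) :
    hardyInf ω * (2 ^ (-(2 * α / (n + 1))) * β ^ (-(2 * α)) *
        (β⁻¹ ^ 2 * (1 - ((τ / β) ^ n) ^ 2))) *
        ∫ p in {p : Space | complDist ω p.1 < ρ},
          ‖(u : L2 (ω ×ˢ Ioo a b)) p‖ ^ 2 ∂(volume.restrict (ω ×ˢ Ioo a b)) ≤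
      ‖heisenbergLaplacian (ω ×ˢ Ioo a b) u‖ *
        ‖realMul _ (fun p => distWeight ω β p ^ (-(2 * α))) (u : L2 (ω ×ˢ Ioo a b))‖ := by
  have hΩ : IsOpen (ω ×ˢ Ioo a b) := hopen.prod isOpen_Ioo
  have hd0 : ∀ x, 0 ≤ d x := fun x => (complDist_nonneg x).trans (hδd x)
  set σ : Plane → ℝ := fun x => smoothMaxPow α β n (d x) with hσ
  have h0 : IsBddCont fun p : Space => σ p.1 := isBddCont_smoothMaxPow hd hd0 hα hβ
  have h1 : IsBddCont fun p : Space => planeDeriv 0 σ p.1 :=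
    isBddCont_planeDeriv_smoothMaxPow hd hd0 hα hβ hdl 0
  have h2 : IsBddCont fun p : Space => planeDeriv 1 σ p.1 :=
    isBddCont_planeDeriv_smoothMaxPow hd hd0 hα hβ hdl 1
  have hw := isBddCont_distWeight_rpow hbdd hβ (-1)
  have hw' := isBddCont_distWeight_rpow hbdd hβ (-(2 * α))
  have hwpos : ∀ p : Space, 0 < distWeight ω β p := fun p => hβ.trans_le (le_max_right _ _)
  have hwd : ∀ p : Space, distWeight ω β p ≤ max (d p.1) β := fun p =>
    max_le_max (hδd _) le_rfl
  obtain ⟨k₁, k₂, hk, hform⟩ :=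
    form_mul_eq hΩ (contDiff_smoothMaxPow_comp (α := α) (n := n) hd hd0 hβ) h0 h1 h2 u
  have hhardy := hardyInf_mul_norm_sq_le hopen hbdd hβ hk
  set U : L2 (ω ×ˢ Ioo a b) := (u : L2 (ω ×ˢ Ioo a b)) with hU
  have hinner : (inner ℂ (realMul _ (fun p : Space => σ p.1 * σ p.1) U)
      (heisenbergLaplacian (ω ×ˢ Ioo a b) u)).re ≤
      ‖heisenbergLaplacian (ω ×ˢ Ioo a b) u‖ *
        ‖realMul _ (fun p => distWeight ω β p ^ (-(2 * α))) U‖ := by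
    refine (Complex.re_le_norm _).trans ((norm_inner_le_norm _ _).trans ?_)
    rw [mul_comm]
    refine mul_le_mul_of_nonneg_left (norm_realMul_le_of_le (h0.mul h0) hw' (fun p => ?_) U)
      (norm_nonneg _)
    have hp := smoothMaxPow_pos (α := α) (n := n) hβ (hd0 p.1)
    have hle : σ p.1 ≤ distWeight ω β p ^ (-α) := (smoothMaxPow_le hα hβ (hd0 p.1)).trans
      (Real.rpow_le_rpow_of_nonpos (hwpos p) (hwd p) (by linarith))
    rw [abs_of_pos (mul_pos hp hp), abs_of_pos (Real.rpow_pos_of_pos (hwpos p) _),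
      show -(2 * α) = -α + -α by ring, Real.rpow_add (hwpos p)]
    exact mul_le_mul hle hle hp.le (Real.rpow_nonneg (hwpos p).le _)
  rw [realMul_apply_mul hw h0, norm_realMul_sq (hw.mul h0), hform, norm_realMul_sq h1,
    norm_realMul_sq h2] at hhardy
  have i0 := integrable_mul_norm_sq (μ := volume.restrict (ω ×ˢ Ioo a b))
    ((hw.mul h0).mul (hw.mul h0)) U
  have i1 := integrable_mul_norm_sq (μ := volume.restrict (ω ×ˢ Ioo a b)) (h1.mul h1) U
  have i2 := integrable_mul_norm_sq (μ := volume.restrict (ω ×ˢ Ioo a b)) (h2.mul h2) U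
  simp only [← sq] at i0 i1 i2
  have hT := measurableSet_complDist_lt (ω := ω) ρ
  have hmono : ∫ p in ω ×ˢ Ioo a b, {p : Space | complDist ω p.1 < ρ}.indicator (fun p =>
      hardyInf ω * (2 ^ (-(2 * α / (n + 1))) * β ^ (-(2 * α)) *
        (β⁻¹ ^ 2 * (1 - ((τ / β) ^ n) ^ 2))) * ‖U p‖ ^ 2) p ≤
      ∫ p in ω ×ˢ Ioo a b, (hardyInf ω * ((distWeight ω β p ^ (-1 : ℝ) * σ p.1) ^ 2 * ‖U p‖ ^ 2) -
        planeDeriv 0 σ p.1 ^ 2 * ‖U p‖ ^ 2 - planeDeriv 1 σ p.1 ^ 2 * ‖U p‖ ^ 2) := by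
    refine integral_mono (((integrable_norm_sq U).const_mul _).indicator hT)
      (((i0.const_mul _).sub i1).sub i2) fun p => ?_
    have hθ0 := smoothMaxLogDeriv_nonneg (n := n) hβ (hd0 p.1)
    have hθ : smoothMaxLogDeriv β n (d p.1) ≤ (distWeight ω β p)⁻¹ :=
      (smoothMaxLogDeriv_le hβ (hd0 p.1)).trans (inv_anti₀ (hwpos p) (hwd p))
    have hgrad := sum_sq_planeDeriv_smoothMaxPow_le (α := α) (n := n) hd hd0 hβ hdl p.1
    rw [hαh] at hgrad
    have hfac : hardyInf ω * (σ p.1 ^ 2 *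
        ((distWeight ω β p)⁻¹ ^ 2 - smoothMaxLogDeriv β n (d p.1) ^ 2)) * ‖U p‖ ^ 2 ≤
        hardyInf ω * ((distWeight ω β p ^ (-1 : ℝ) * σ p.1) ^ 2 * ‖U p‖ ^ 2) -
        planeDeriv 0 σ p.1 ^ 2 * ‖U p‖ ^ 2 - planeDeriv 1 σ p.1 ^ 2 * ‖U p‖ ^ 2 := by
      rw [Real.rpow_neg_one, mul_pow]
      have := mul_le_mul_of_nonneg_right hgrad (sq_nonneg ‖U p‖)
      linarith
    refine le_trans ?_ hfac
    by_cases hp : complDist ω p.1 < ρ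
    · rw [indicator_of_mem (show p ∈ {p : Space | complDist ω p.1 < ρ} from hp)]
      have hdp := hdτ _ hp
      have hwβ : distWeight ω β p = β := max_eq_right (by linarith)
      have hτ0 : 0 ≤ τ := (hd0 p.1).trans hdp
      have hθτ := smoothMaxLogDeriv_le_mul_pow (n := n) hβ (hd0 p.1) hdp
      have hq1 : (τ / β) ^ n ≤ 1 := pow_le_one₀ (by positivity) ((div_le_one hβ).2 hτβ)
      have hq0 : 0 ≤ (τ / β) ^ n := by positivity
      have hbr : β⁻¹ ^ 2 * (1 - ((τ / β) ^ n) ^ 2) ≤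
          (distWeight ω β p)⁻¹ ^ 2 - smoothMaxLogDeriv β n (d p.1) ^ 2 := by
        have := pow_le_pow_left₀ hθ0 hθτ 2
        rw [mul_pow] at this
        rw [hwβ]
        linarith
      have hσ2 := le_sq_smoothMaxPow (n := n) hα hβ (hd0 p.1) (hdp.trans hτβ)
      have hbr0 : 0 ≤ β⁻¹ ^ 2 * (1 - ((τ / β) ^ n) ^ 2) :=
        mul_nonneg (sq_nonneg _) (by nlinarith)
      exact mul_le_mul_of_nonneg_right (mul_le_mul_of_nonneg_left
        (mul_le_mul hσ2 hbr hbr0 (sq_nonneg _)) hardyInf_nonneg) (sq_nonneg _)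
    · rw [indicator_of_notMem (show p ∉ {p : Space | complDist ω p.1 < ρ} from hp)]
      have := pow_le_pow_left₀ hθ0 hθ 2
      exact mul_nonneg (mul_nonneg hardyInf_nonneg
        (mul_nonneg (sq_nonneg _) (sub_nonneg.2 this))) (sq_nonneg _)
  have hsplit := (integral_sub ((i0.const_mul (hardyInf ω)).sub i1) i2).trans (congrArg₂ (· - ·)
    ((integral_sub (i0.const_mul (hardyInf ω)) i1).trans
      (congrArg₂ (· - ·) (integral_const_mul _ _) rfl)) rfl)
  rw [integral_indicator hT, integral_const_mul] at hmono
  have hfinal := hmono.trans (le_of_eq hsplit)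
  linarith

/-- The limit `n → ∞` of the preceding estimate, in which `σ` becomes constant on the strip, of width
`ρ < β`. -/
theorem hardyInf_mul_setIntegral_strip_le {ρ : ℝ} (hρ : 0 < ρ) (hρβ : ρ < β) :
    hardyInf ω * (β ^ (-(2 * √(hardyInf ω))) * β⁻¹ ^ 2) *
        ∫ p in {p : Space | complDist ω p.1 < ρ},
          ‖(u : L2 (ω ×ˢ Ioo a b)) p‖ ^ 2 ∂(volume.restrict (ω ×ˢ Ioo a b)) ≤
      ‖heisenbergLaplacian (ω ×ˢ Ioo a b) u‖ *
        ‖realMul _ (fun p => distWeight ω β p ^ (-(2 * √(hardyInf ω))))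
          (u : L2 (ω ×ˢ Ioo a b))‖ := by
  have hβ : 0 < β := hρ.trans hρβ
  set α := √(hardyInf ω)
  set τ := (ρ + β) / 2 with hτ
  obtain ⟨d, hdc, hdl, hd⟩ := exists_contDiff_lipschitz_approx (lipschitzWith_complDist ω)
    (show 0 < (β - ρ) / 2 by linarith)
  have key := integral_strip_le_of_approx hopen hbdd u hdc hdl (fun x => (hd x).1) (τ := τ) (ρ := ρ)
    (Real.sqrt_nonneg _) (Real.sq_sqrt hardyInf_nonneg)
    (fun x hx => by linarith [(hd x).2]) (by linarith) (by linarith) hβ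
  have l1 : Filter.Tendsto (fun n : ℕ => (2 : ℝ) ^ (-(2 * α / ((n : ℝ) + 1)))) Filter.atTop
      (nhds 1) := by
    have h := (tendsto_one_div_add_atTop_nhds_zero_nat (𝕜 := ℝ)).const_mul (-(2 * α))
    have h' := ((Real.continuous_const_rpow (show (2 : ℝ) ≠ 0 by norm_num)).tendsto _).comp h
    rw [mul_zero, Real.rpow_zero] at h'
    refine h'.congr fun n => ?_
    simp only [Function.comp_apply]
    congr 1
    ring
  have l2 : Filter.Tendsto (fun n : ℕ => (τ / β) ^ n) Filter.atTop (nhds 0) :=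
    tendsto_pow_atTop_nhds_zero_of_lt_one (by positivity) ((div_lt_one hβ).2 (by linarith))
  have l3 := (((l1.mul_const (β ^ (-(2 * α)))).mul (((l2.pow 2).const_sub 1).const_mul
    (β⁻¹ ^ 2))).const_mul (hardyInf ω)).mul_const (∫ p in {p : Space | complDist ω p.1 < ρ},
          ‖(u : L2 (ω ×ˢ Ioo a b)) p‖ ^ 2 ∂(volume.restrict (ω ×ˢ Ioo a b)))
  have h := le_of_tendsto' l3 key
  simpa using h

/-- The iterated integral over the boundary strip as an integral with respect to the measure of
`L²(Ω)`. -/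
theorem integral_integral_bdryStrip (hab : a ≤ b) (f : L2 (ω ×ˢ Ioo a b)) (ρ : ℝ) :
    ∫ x₃ in a..b, ∫ x' in bdryStrip ω ρ, ‖f (x', x₃)‖ ^ 2 =
      ∫ p in {p : Space | complDist ω p.1 < ρ}, ‖f p‖ ^ 2 ∂(volume.restrict (ω ×ˢ Ioo a b)) := by
  have hT := measurableSet_complDist_lt (ω := ω) ρ
  have hset : {p : Space | complDist ω p.1 < ρ} ∩ ω ×ˢ Ioo a b = bdryStrip ω ρ ×ˢ Ioo a b := by
    ext p
    constructor
    · rintro ⟨h1, h2, h3⟩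
      exact ⟨⟨h2, (bdryDist_eq_complDist hopen hbdd h2).trans_lt h1⟩, h3⟩
    · rintro ⟨⟨h1, h2⟩, h3⟩
      exact ⟨(bdryDist_eq_complDist hopen hbdd h1).symm.trans_lt h2, h1, h3⟩
  have hint : Integrable (fun p => ‖f p‖ ^ 2)
      ((volume.restrict (bdryStrip ω ρ)).prod (volume.restrict (Ioo a b))) := by
    rw [Measure.prod_restrict, ← hset, ← Measure.restrict_restrict hT]
    exact (integrable_norm_sq f).restrict
  rw [Measure.restrict_restrict hT, hset, intervalIntegral.integral_of_le hab,
    integral_Ioc_eq_integral_Ioo, ← integral_prod_symm _ hint, Measure.prod_restrict]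
  rfl

end Boundary

end

theorem proposition3p1 (ω : Set Plane) (hopen : IsOpen ω) (hbdd : Bornology.IsBounded ω)
    (hsc : IsSimplyConnected ω) (hlip : HasLipschitzBoundary ω)
    (a b : ℝ) (hab : a < b)
    (u : (heisenbergLaplacian (ω ×ˢ Ioo a b)).domain) (β : ℝ) (hβ : 0 < β) :
    ∃ hu : (u : L2 (ω ×ˢ Ioo a b)) ∈
        (nonnegPower (heisenbergLaplacian (ω ×ˢ Ioo a b)) (1 / hardyConst ω)).domain,
      ∫ x₃ in a..b, ∫ x' in bdryStrip ω β, ‖(u : L2 (ω ×ˢ Ioo a b)) (x', x₃)‖ ^ 2 ≤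
        hardyConst ω ^ (2 + 2 / hardyConst ω) * β ^ (2 + 2 / hardyConst ω) *
          ‖heisenbergLaplacian (ω ×ˢ Ioo a b) u‖ *
          ‖nonnegPower (heisenbergLaplacian (ω ×ˢ Ioo a b)) (1 / hardyConst ω) ⟨u, hu⟩‖ := by
  have hne : ω.Nonempty := hsc.nonempty
  have hpos : 0 < hardyInf ω := hardyInf_pos hopen hbdd hlip hne
  have hle : hardyInf ω ≤ 1 / 4 := hardyInf_le hopen hbdd hlip hne
  have hα : 0 < √(hardyInf ω) := Real.sqrt_pos.2 hpos
  have hc : hardyConst ω = (√(hardyInf ω))⁻¹ := by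
    rw [Real.sqrt_eq_rpow, ← Real.rpow_neg hpos.le]
    rfl
  have hc1 : 1 / hardyConst ω = √(hardyInf ω) := by rw [hc, one_div, inv_inv]
  have hc2 : 2 / hardyConst ω = 2 * √(hardyInf ω) := by rw [hc, div_inv_eq_mul]
  rw [hc1, hc2]
  -- `hu` does not depend on the weight; the estimate is used for all weights `max(δ, β')`, `β' > β`
  obtain ⟨hu, -⟩ := exists_mem_domain_norm_distWeight_le hopen hbdd u hpos hle hβ
  refine ⟨hu, ?_⟩
  rw [integral_integral_bdryStrip hopen hbdd hab.le]
  set I := ∫ p in {p : Space | complDist ω p.1 < β},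
    ‖(u : L2 (ω ×ˢ Ioo a b)) p‖ ^ 2 ∂(volume.restrict (ω ×ˢ Ioo a b))
  set N := ‖nonnegPower (heisenbergLaplacian (ω ×ˢ Ioo a b)) √(hardyInf ω) ⟨u, hu⟩‖ with hN
  set α := √(hardyInf ω) with hαdef
  have key : ∀ β' > β, hardyInf ω * (β' ^ (-(2 * α)) * β'⁻¹ ^ 2) * I ≤
      ‖heisenbergLaplacian (ω ×ˢ Ioo a b) u‖ * ((hardyInf ω)⁻¹ ^ α * N) := by
    intro β' hβ'
    obtain ⟨_, h⟩ := exists_mem_domain_norm_distWeight_le hopen hbdd u hpos hle (hβ.trans hβ')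
    exact (hardyInf_mul_setIntegral_strip_le hopen hbdd u hβ hβ').trans
      (mul_le_mul_of_nonneg_left h (norm_nonneg _))
  have hlim : Filter.Tendsto (fun β' => hardyInf ω * (β' ^ (-(2 * α)) * β'⁻¹ ^ 2) * I)
      (nhdsWithin β (Ioi β)) (nhds (hardyInf ω * (β ^ (-(2 * α)) * β⁻¹ ^ 2) * I)) := by
    have hc : ContinuousAt (fun β' => hardyInf ω * (β' ^ (-(2 * α)) * β'⁻¹ ^ 2) * I) β :=
      (((Real.continuousAt_rpow_const β _ (Or.inl hβ.ne')).mul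
        ((continuousAt_inv₀ hβ.ne').pow 2)).const_mul _).mul_const _
    exact hc.tendsto.mono_left nhdsWithin_le_nhds
  have h := le_of_tendsto hlim (by filter_upwards [self_mem_nhdsWithin] with β' hβ' using key β' hβ')
  have e1 : hardyConst ω ^ (2 + 2 * α) = (hardyInf ω)⁻¹ * (hardyInf ω)⁻¹ ^ α := by
    have hsq : α⁻¹ ^ 2 = (hardyInf ω)⁻¹ := by rw [inv_pow, hαdef, Real.sq_sqrt hpos.le]
    rw [hc, Real.rpow_add (inv_pos.2 hα), Real.rpow_mul (inv_pos.2 hα).le, Real.rpow_two, hsq]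
  have e2 : β ^ (2 + 2 * α) = (β ^ (-(2 * α)) * β⁻¹ ^ 2)⁻¹ := by
    rw [Real.rpow_add hβ, Real.rpow_neg hβ.le, Real.rpow_two, mul_inv, inv_inv, inv_pow, inv_inv,
      mul_comm]
  have hq : 0 < β ^ (-(2 * α)) * β⁻¹ ^ 2 := by positivity
  rw [e1, e2]
  calc I = (hardyInf ω)⁻¹ * (β ^ (-(2 * α)) * β⁻¹ ^ 2)⁻¹ *
        (hardyInf ω * (β ^ (-(2 * α)) * β⁻¹ ^ 2) * I) := by
        field_simp
    _ ≤ (hardyInf ω)⁻¹ * (β ^ (-(2 * α)) * β⁻¹ ^ 2)⁻¹ *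
        (‖heisenbergLaplacian (ω ×ˢ Ioo a b) u‖ * ((hardyInf ω)⁻¹ ^ α * N)) := by gcongr
    _ = _ := by ring
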